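/- **Conventions.** All vector spaces are real and finite-dimensional; scalar products are non-degenerate symmetric bilinear forms, possibly indefinite; an involution is a map with square $\mathrm{id}$, and a subscript $\pm$ denotes its $\pm1$-eigenspace. A *Lie algebra with involution* $(\mathfrak l,\theta_{\mathfrak l})$ is a Lie algebra with an involutive automorphism. An *orthogonal $(\mathfrak l,\theta_{\mathfrak l})$-module* is a representation $\rho$ of $\mathfrak l$ on a space $\mathfrak a$ with a scalar product $\langle\cdot,\cdot\rangle$ and an involutive isometry $\theta_{\mathfrak a}$ such that every $\rho(L)$ is skew and $\theta_{\mathfrak a}\rho(\theta_{\mathfrak l}L)=\rho(L)\theta_{\mathfrak a}$. A *morphism of triples* $(S,U):(\mathfrak l_1,\theta_1,\mathfrak a_1)\to(\mathfrak l_2,\theta_2,\mathfrak a_2)$ is a Lie algebra homomorphism $S:\mathfrak l_1\to\mathfrak l_2$ and an isometric embedding $U:\mathfrak a_2\to\mathfrak a_1$, both commuting with the involutions, with $U\rho_2(S(L))=\rho_1(L)U$; it is an *isomorphism* if $S,U$ are bijective, and non-zero if $S\neq0$ or $U\ne 0$. **Quadratic cohomology.** Let $C^p(\mathfrak l,\mathfrak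 a)$ and $C^p(\mathfrak l)$ be the alternating $p$-forms on $\mathfrak l$ with values in $\mathfrak a$ and $\mathbb R$ (trivial module), with the Chevalley–Eilenberg differential $d$; $\langle\cdot\wedge\cdot\rangle$ is the wedge product followed by the scalar product of $\mathfrak a$. The subscript $+$ denotes cochains fixed by $(\theta_{\mathfrak l},\theta_{\mathfrak a})^*$, where $(S,U)^*\alpha=U\circ S^*\alpha$ and $(S,U)^*\gamma=S^*\gamma$. Let $$\mathcal Z^2_Q(\mathfrak l,\mathfrak a)_+=\{(\alpha,\gamma)\in C^2(\mathfrak l,\mathfrak a)_+\oplus C^3(\mathfrak l)_+ : d\alpha=0,\ d\gamma=\tfrac12\langle\alpha\wedge\alpha\rangle\},$$ and let $\mathcal H^2_Q(\mathfrak l,\theta_{\mathfrak l},\mathfrak a)$ be the set of classes $[\alpha,\gamma]$ of such pairs under $(\alpha,\gamma)\sim(\alpha+d\tau,\ \gamma+d\sigma+\langle(\alpha+\frac12d\tau)\wedge\tau\rangle)$ for $\tau\in C^1(\mathfrak l,\mathfrak a)_+$, $\sigma\in C^2(\mathfrak l)_+$. **Admissibility.** Let $R_0(\mathfrak l)=\mathfrak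 l$ and let $R_{k}(\mathfrak l)$ be the smallest ideal of $\mathfrak l$ contained in $R_{k-1}(\mathfrak l)$ with $R_{k-1}(\mathfrak l)/R_k(\mathfrak l)$ a semi-simple $\mathfrak l$-module; let $S(\mathfrak l)$ be the largest ideal that is a semi-simple $\mathfrak l$-module. Suppose that $(T_1)$: $[\mathfrak l_-,\mathfrak l_-]=\mathfrak l_+$ (linear span of brackets), and that $\mathfrak a$ is semi-simple, so that $\mathfrak a=\mathfrak a^{\mathfrak l}\oplus\rho(\mathfrak l)\mathfrak a$; let $\alpha_0$ be the component of $\alpha$ in $\mathfrak a^{\mathfrak l}$. Regard $\alpha_0$ and the bracket as linear maps on $\bigwedge^2\mathfrak l$. A class is *admissible*, written $[\alpha,\gamma]\in\mathcal H^2_Q(\mathfrak l,\theta_{\mathfrak l},\mathfrak a)_\sharp$, if, with $m$ such that $R_{m+1}(\mathfrak l)=0$, its representative $(\alpha,\gamma)$ satisfies the following conditions (they do not depend on the representative): - $(T_2)$ $(\mathfrak a^{\mathfrak l})_+=\alpha_0(\ker[\cdot,\cdot]_{\mathfrak l_-})$, where $[\cdot,\cdot]_{\mathfrak l_-}$ is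 the bracket on $\bigwedge^2\mathfrak l_-$; - $(A_0)$ if $L_0\in\mathfrak z(\mathfrak l)\cap\ker\rho$ and there are $A_0\in\mathfrak a$, $Z_0\in\mathfrak l^*$ with $\alpha(L,L_0)=\rho(L)A_0$ and $\gamma(L,L_0,\cdot)=-\langle A_0,\alpha(L,\cdot)\rangle+Z_0([L,\cdot])$ for all $L\in\mathfrak l$, then $L_0=0$; - $(B_0)$ $\alpha_0(\ker[\cdot,\cdot]_{\mathfrak l})\subset\mathfrak a^{\mathfrak l}$ is non-degenerate; - $(A_k)$, $1\le k\le m$: if $\mathfrak k\subset S(\mathfrak l)\cap R_k(\mathfrak l)$ is an ideal of $\mathfrak l$ for which there are linear maps $\Phi_1:\mathfrak k\to\mathfrak a$, $\Phi_2:\mathfrak k\to R_k(\mathfrak l)^*$ with $\alpha(L,K)=\rho(L)\Phi_1(K)-\Phi_1([L,K])$ and $\gamma(L,K,\cdot)=-\langle\Phi_1(K),\alpha(L,\cdot)\rangle+\Phi_2(K)([L,\cdot])+\Phi_2([L,K])$ on $R_k(\mathfrak l)$ for all $L\in\mathfrak l$, $K\in\mathfrak k$, then $\mathfrak k=0$;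 - $(B_k)$, $1\le k\le m$: let $\mathfrak b_k\subset\mathfrak a$ be the maximal submodule for which there is a linear map $\Phi:R_k(\mathfrak l)\to\mathfrak a$ with $\langle\alpha(L,K),B\rangle=\langle\rho(L)\Phi(K)-\Phi([L,K]),B\rangle$ for all $L\in\mathfrak l$, $K\in R_k(\mathfrak l)$, $B\in\mathfrak b_k$; then $\mathfrak b_k$ is non-degenerate. $(\mathfrak l,\theta_{\mathfrak l})$ is *admissible* if it satisfies $(T_1)$ and has a semi-simple orthogonal module $\mathfrak a$ with $\mathcal H^2_Q(\mathfrak l,\theta_{\mathfrak l},\mathfrak a)_\sharp\neq\emptyset$. **Decomposability of classes.** A *non-trivial decomposition* of $(\mathfrak l,\theta_{\mathfrak l},\mathfrak a)$ consists of two non-zero morphisms of triples $(q_i,j_i):(\mathfrak l,\theta_{\mathfrak l},\mathfrak a)\to(\mathfrak l_i,\theta_{\mathfrak l_i},\mathfrak a_i)$, $i=1,2$, such that $((q_1,q_2),\,j_1+j_2)$ is an isomorphism of triples onto the (orthogonal) direct sum. A class $\varphi\in\mathcal H^2_Q(\mathfrak l,\theta_{\mathfrak l},\mathfrak a)$ is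 *decomposable* if $\varphi=(q_1,j_1)^*\varphi_1+(q_2,j_2)^*\varphi_2$ for such a decomposition and some $\varphi_i=[\alpha_i,\gamma_i]\in\mathcal H^2_Q(\mathfrak l_i,\theta_{\mathfrak l_i},\mathfrak a_i)$, where the sum means the class of the cocycle $(q_1,j_1)^*(\alpha_1,\gamma_1)+(q_2,j_2)^*(\alpha_2,\gamma_2)$; otherwise it is *indecomposable*. Let $\mathcal H^2_Q(\mathfrak l,\theta_{\mathfrak l},\mathfrak a)_0$ be the set of indecomposable elements of $\mathcal H^2_Q(\mathfrak l,\theta_{\mathfrak l},\mathfrak a)_\sharp$. **Symmetric triples.** A *metric Lie algebra with involution* $(\mathfrak g,\theta,\langle\cdot,\cdot\rangle)$ is a Lie algebra with an invariant scalar product and an isometric involutive automorphism. It is a *symmetric triple* if $[\mathfrak g_-,\mathfrak g_-]=\mathfrak g_+$ and $\mathfrak g_+$ acts faithfully on $\mathfrak g_-$. A symmetric triple is *indecomposable* if it is not isomorphic to the direct sum of two non-zero symmetric triples. For $(\alpha,\gamma)\in\mathcal Z^2_Q(\mathfrak l,\mathfrak a)_+$, $\mathfrak d_{\alpha,\gamma}(\mathfrak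 l,\theta_{\mathfrak l},\mathfrak a)$ is the metric Lie algebra with involution on $\mathfrak l^*\oplus\mathfrak a\oplus\mathfrak l$ with $$\langle Z_1+A_1+L_1,Z_2+A_2+L_2\rangle=\langle A_1,A_2\rangle+Z_1(L_2)+Z_2(L_1),\qquad \theta=\theta_{\mathfrak l}^*\oplus\theta_{\mathfrak a}\oplus\theta_{\mathfrak l},$$ $[\mathfrak l^*,\mathfrak l^*\oplus\mathfrak a]=0$, $[L_1,L_2]=\gamma(L_1,L_2,\cdot)+\alpha(L_1,L_2)+[L_1,L_2]_{\mathfrak l}$, $[L,A]=\rho(L)A-\langle A,\alpha(L,\cdot)\rangle$, $[L,Z]=-Z([L,\cdot]_{\mathfrak l})$, $[A_1,A_2]=\langle\rho(\cdot)A_1,A_2\rangle$. **Proposition.** Let $(\mathfrak l,\theta_{\mathfrak l})$ be an admissible Lie algebra with involution, let $\mathfrak a$ be an orthogonal $(\mathfrak l,\theta_{\mathfrak l})$-module and let $(\alpha,\gamma)\in\mathcal Z^2_Q(\mathfrak l,\mathfrak a)_+$ be such that $[\alpha,\gamma]\in\mathcal H^2_Q(\mathfrak l,\theta_{\mathfrak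 l},\mathfrak a)_\sharp$ (in particular $\mathfrak a$ is semi-simple). Then $\mathfrak d_{\alpha,\gamma}(\mathfrak l,\theta_{\mathfrak l},\mathfrak a)$ is a symmetric triple, and it is indecomposable if and only if $[\alpha,\gamma]\in\mathcal H^2_Q(\mathfrak l,\theta_{\mathfrak l},\mathfrak a)_0$, that is, if and only if the class $[\alpha,\gamma]$ is indecomposable. -/

import Mathlib

universe u v

namespace SymTriple

/-! ### Lie algebras with involution and orthogonal modules -/

/-- A Lie algebra with involution: a finite-dimensional real Lie algebra together with an
involutive automorphism `θ`. -/
structure LieInv : Type (u + 1) where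
  carrier : Type u
  [lieRing : LieRing carrier]
  [lieAlgebra : LieAlgebra ℝ carrier]
  [finDim : FiniteDimensional ℝ carrier]
  θ : carrier →ₗ⁅ℝ⁆ carrier
  θ_θ : ∀ x, θ (θ x) = x

instance : CoeSort LieInv.{u} (Type u) := ⟨LieInv.carrier⟩

attribute [instance] LieInv.lieRing LieInv.lieAlgebra LieInv.finDim

/-- The `(+1)`-eigenspace of the involution. -/
def LieInv.plus (l : LieInv.{u}) : Submodule ℝ l := LinearMap.eqLocus (l.θ : l →ₗ[ℝ] l) LinearMap.id

/-- The `(-1)`-eigenspace of the involution. -/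
def LieInv.minus (l : LieInv.{u}) : Submodule ℝ l :=
  LinearMap.eqLocus (l.θ : l →ₗ[ℝ] l) (-LinearMap.id)

/-- The condition `[l₋, l₋] = l₊`, where `[l₋, l₋]` is the linear span of all brackets. -/
def LieInv.BracketMinusEqPlus (l : LieInv.{u}) : Prop :=
  Submodule.span ℝ {z : l | ∃ x ∈ l.minus, ∃ y ∈ l.minus, ⁅x, y⁆ = z} = l.plus

/-- `l₊` acts faithfully on `l₋`. -/
def LieInv.FaithfulOnMinus (l : LieInv.{u}) : Prop :=
  ∀ x ∈ l.plus, (∀ y ∈ l.minus, ⁅x, y⁆ = 0) → x = 0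

/-- The direct sum of two Lie algebras with involution. -/
def LieInv.prod (l₁ l₂ : LieInv.{u}) : LieInv.{u} where
  carrier := l₁ × l₂
  θ := LieHom.prod (l₁.θ.comp (LieHom.fst ℝ l₁ l₂)) (l₂.θ.comp (LieHom.snd ℝ l₁ l₂))
  θ_θ := fun x => Prod.ext (l₁.θ_θ x.1) (l₂.θ_θ x.2)

/-- An orthogonal `(l, θ_l)`-module: a finite-dimensional real representation of `l` with an
invariant scalar product (a non-degenerate symmetric bilinear form, possibly indefinite) and an
involutive isometry `θ` compatible with the representation and with `θ_l`. -/
structure OrthMod (l : LieInv.{u}) : Type (max u (v + 1)) where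
  carrier : Type v
  [addCommGroup : AddCommGroup carrier]
  [module : Module ℝ carrier]
  [finDim : FiniteDimensional ℝ carrier]
  [lieRingModule : LieRingModule l carrier]
  [lieModule : LieModule ℝ l carrier]
  form : LinearMap.BilinForm ℝ carrier
  form_symm : ∀ A B, form A B = form B A
  form_nondeg : ∀ A, (∀ B, form A B = 0) → A = 0
  form_inv : ∀ (x : l) (A B : carrier), form ⁅x, A⁆ B + form A ⁅x, B⁆ = 0
  θ : carrier →ₗ[ℝ] carrier
  θ_θ : ∀ A, θ (θ A) = A
  θ_isom : ∀ A B, form (θ A) (θ B) = form A B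
  θ_lie : ∀ (x : l) (A : carrier), θ ⁅l.θ x, A⁆ = ⁅x, θ A⁆

instance (l : LieInv.{u}) : CoeSort (OrthMod.{u, v} l) (Type v) := ⟨OrthMod.carrier⟩

attribute [instance] OrthMod.addCommGroup OrthMod.module OrthMod.finDim OrthMod.lieRingModule
  OrthMod.lieModule

/-- The `(+1)`-eigenspace of the involution of an orthogonal module. -/
def OrthMod.plus {l : LieInv.{u}} (a : OrthMod.{u, v} l) : Submodule ℝ a :=
  LinearMap.eqLocus a.θ LinearMap.id

/-- The orthogonal direct sum of an `(l₁, θ₁)`-module and an `(l₂, θ₂)`-module, as a module over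
the direct sum `l₁ ⊕ l₂`. -/
def OrthMod.prod {l₁ l₂ : LieInv.{u}} (a₁ : OrthMod.{u, v} l₁) (a₂ : OrthMod.{u, v} l₂) :
    OrthMod.{u, v} (l₁.prod l₂) :=
  letI i₁ : LieRingModule (l₁.prod l₂) (a₁ × a₂) :=
    { bracket := fun x A => (⁅x.1, A.1⁆, ⁅x.2, A.2⁆)
      add_lie := fun x y A => Prod.ext (add_lie x.1 y.1 A.1) (add_lie x.2 y.2 A.2)
      lie_add := fun x A B => Prod.ext (lie_add x.1 A.1 B.1) (lie_add x.2 A.2 B.2)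
      leibniz_lie := fun x y A =>
        Prod.ext (leibniz_lie x.1 y.1 A.1) (leibniz_lie x.2 y.2 A.2) }
  letI i₂ : LieModule ℝ (l₁.prod l₂) (a₁ × a₂) :=
    { smul_lie := fun t x A => Prod.ext (smul_lie t x.1 A.1) (smul_lie t x.2 A.2)
      lie_smul := fun t x A => Prod.ext (lie_smul t x.1 A.1) (lie_smul t x.2 A.2) }
  { carrier := a₁ × a₂
    form := a₁.form.compl₁₂ (LinearMap.fst ℝ a₁ a₂) (LinearMap.fst ℝ a₁ a₂) +
      a₂.form.compl₁₂ (LinearMap.snd ℝ a₁ a₂) (LinearMap.snd ℝ a₁ a₂)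
    form_symm := fun A B => by
      simp [a₁.form_symm A.1 B.1, a₂.form_symm A.2 B.2]
    form_nondeg := fun A h => by
      refine Prod.ext (a₁.form_nondeg _ fun B => ?_) (a₂.form_nondeg _ fun B => ?_)
      · simpa using h (B, 0)
      · simpa using h (0, B)
    form_inv := fun x A B => by
      have h₁ := a₁.form_inv x.1 A.1 B.1
      have h₂ := a₂.form_inv x.2 A.2 B.2
      change (a₁.form ⁅x.1, A.1⁆ B.1 + a₂.form ⁅x.2, A.2⁆ B.2) +
        (a₁.form A.1 ⁅x.1, B.1⁆ + a₂.form A.2 ⁅x.2, B.2⁆) = 0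
      linarith
    θ := a₁.θ.prodMap a₂.θ
    θ_θ := fun A => Prod.ext (a₁.θ_θ A.1) (a₂.θ_θ A.2)
    θ_isom := fun A B => by simp [a₁.θ_isom, a₂.θ_isom]
    θ_lie := fun x A => Prod.ext (a₁.θ_lie x.1 A.1) (a₂.θ_lie x.2 A.2) }

/-- A morphism of triples `(S, U) : (l₁, θ₁, a₁) → (l₂, θ₂, a₂)`. Note that `U` goes in the
reverse direction. -/
structure TripleHom {l₁ l₂ : LieInv.{u}} (a₁ : OrthMod.{u, v} l₁) (a₂ : OrthMod.{u, v} l₂) where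
  S : l₁ →ₗ⁅ℝ⁆ l₂
  U : a₂ →ₗ[ℝ] a₁
  U_isom : ∀ A B, a₁.form (U A) (U B) = a₂.form A B
  U_lie : ∀ (x : l₁) (A : a₂), U ⁅S x, A⁆ = ⁅x, U A⁆
  S_θ : ∀ x, S (l₁.θ x) = l₂.θ (S x)
  U_θ : ∀ A, U (a₂.θ A) = a₁.θ (U A)

section Morphisms

variable {l l₁ l₂ : LieInv.{u}} {a : OrthMod.{u, v} l} {a₁ : OrthMod.{u, v} l₁}
  {a₂ : OrthMod.{u, v} l₂}

/-- An isomorphism of triples. -/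
def TripleHom.IsIso (T : TripleHom a₁ a₂) : Prop :=
  Function.Bijective T.S ∧ Function.Bijective T.U

/-- A morphism `(S, U)` of triples is non-zero if `S ≠ 0` or `U ≠ 0`. -/
def TripleHom.IsNonzero (T : TripleHom a₁ a₂) : Prop :=
  T.S ≠ 0 ∨ T.U ≠ 0

/-- Two morphisms form a non-trivial decomposition of `(l, θ, a)`: both are non-zero, and their
sum is an isomorphism of triples onto the direct sum `(l₁, θ₁, a₁) ⊕ (l₂, θ₂, a₂)`. -/
def IsNontrivialDecomposition (T₁ : TripleHom a a₁) (T₂ : TripleHom a a₂) : Prop :=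
  T₁.IsNonzero ∧ T₂.IsNonzero ∧ ∃ T : TripleHom a (a₁.prod a₂), T.IsIso ∧
    (∀ x : l, T.S x = ((T₁.S x, T₂.S x) : l₁ × l₂)) ∧
    ∀ (A₁ : a₁) (A₂ : a₂), T.U ((A₁, A₂) : a₁ × a₂) = T₁.U A₁ + T₂.U A₂

end Morphisms

/-! ### Quadratic cohomology in degree two -/

section Cochains

variable {l : LieInv.{u}} (a : OrthMod.{u, v} l)

/-- The differential `C¹(l, a) → C²(l, a)`. -/
def dOne (τ : l →ₗ[ℝ] a) (x y : l) : a := ⁅x, τ y⁆ - ⁅y, τ x⁆ - τ ⁅x, y⁆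

/-- The differential `C²(l, a) → C³(l, a)`. -/
def dTwo (α : l →ₗ[ℝ] l →ₗ[ℝ] a) (x y z : l) : a :=
  ⁅x, α y z⁆ - ⁅y, α x z⁆ + ⁅z, α x y⁆ - α ⁅x, y⁆ z + α ⁅x, z⁆ y - α ⁅y, z⁆ x

/-- The differential `C²(l) → C³(l)` (trivial coefficients). -/
def dTwoTriv (σ : l →ₗ[ℝ] l →ₗ[ℝ] ℝ) (x y z : l) : ℝ :=
  - σ ⁅x, y⁆ z + σ ⁅x, z⁆ y - σ ⁅y, z⁆ x

/-- The differential `C³(l) → C⁴(l)` (trivial coefficients). -/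
def dThreeTriv (γ : l →ₗ[ℝ] l →ₗ[ℝ] l →ₗ[ℝ] ℝ) (x y z w : l) : ℝ :=
  - γ ⁅x, y⁆ z w + γ ⁅x, z⁆ y w - γ ⁅x, w⁆ y z - γ ⁅y, z⁆ x w + γ ⁅y, w⁆ x z - γ ⁅z, w⁆ x y

/-- The product `⟨β ∧ τ⟩ ∈ C³(l)` of `β ∈ C²(l, a)` and `τ ∈ C¹(l, a)`. -/
def wedgeTwoOne (β : l → l → a) (τ : l → a) (x y z : l) : ℝ :=
  a.form (β x y) (τ z) - a.form (β x z) (τ y) + a.form (β y z) (τ x)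

/-- The product `⟨α ∧ β⟩ ∈ C⁴(l)` of `α, β ∈ C²(l, a)`. -/
def wedgeTwoTwo (α β : l → l → a) (x y z w : l) : ℝ :=
  a.form (α x y) (β z w) - a.form (α x z) (β y w) + a.form (α x w) (β y z)
    + a.form (α y z) (β x w) - a.form (α y w) (β x z) + a.form (α z w) (β x y)

/-- The set `Z²_Q(l, a)₊` of quadratic 2-cocycles `(α, γ) ∈ C²(l, a) ⊕ C³(l)` that are fixed by
the involutions induced by `θ_l` and `θ_a`: alternating forms with `dα = 0` and
`dγ = ½ ⟨α ∧ α⟩`. -/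
@[ext]
structure QuadCocycle where
  α : l →ₗ[ℝ] l →ₗ[ℝ] a
  γ : l →ₗ[ℝ] l →ₗ[ℝ] l →ₗ[ℝ] ℝ
  α_self : ∀ x, α x x = 0
  γ_self_left : ∀ x y, γ x x y = 0
  γ_self_right : ∀ x y, γ x y y = 0
  dα : ∀ x y z, dTwo a α x y z = 0
  dγ : ∀ x y z w, dThreeTriv γ x y z w = (1 / 2) * wedgeTwoTwo a (fun x y => α x y)
    (fun x y => α x y) x y z w
  α_θ : ∀ x y, a.θ (α (l.θ x) (l.θ y)) = α x y
  γ_θ : ∀ x y z, γ (l.θ x) (l.θ y) (l.θ z) = γ x y z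

variable {a}

/-- `c₂` is obtained from `c₁` by the action of an invariant quadratic 1-cochain
`(τ, σ) ∈ C¹(l, a)₊ ⊕ C²(l)₊`, that is
`c₂ = (α₁ + dτ, γ₁ + dσ + ⟨(α₁ + ½ dτ) ∧ τ⟩)`. -/
def QuadCocycle.Equiv (c₁ c₂ : QuadCocycle a) : Prop :=
  ∃ (τ : l →ₗ[ℝ] a) (σ : l →ₗ[ℝ] l →ₗ[ℝ] ℝ),
    (∀ x, a.θ (τ (l.θ x)) = τ x) ∧
    (∀ x, σ x x = 0) ∧ (∀ x y, σ (l.θ x) (l.θ y) = σ x y) ∧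
    (∀ x y, c₂.α x y = c₁.α x y + dOne a τ x y) ∧
    (∀ x y z, c₂.γ x y z = c₁.γ x y z + dTwoTriv σ x y z +
      wedgeTwoOne a (fun x y => c₁.α x y + (1 / 2 : ℝ) • dOne a τ x y) τ x y z)

theorem QuadCocycle.Equiv.refl (c : QuadCocycle a) : c.Equiv c :=
  ⟨0, 0, by simp, by simp, by simp, by simp [dOne], by simp [dTwoTriv, wedgeTwoOne]⟩

theorem dOne_add (τ₁ τ₂ : l →ₗ[ℝ] a) (x y : l) :
    dOne a (τ₁ + τ₂) x y = dOne a τ₁ x y + dOne a τ₂ x y := by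
  simp only [dOne, LinearMap.add_apply, lie_add]; abel

theorem dOne_neg (τ : l →ₗ[ℝ] a) (x y : l) : dOne a (-τ) x y = - dOne a τ x y := by
  simp only [dOne, LinearMap.neg_apply, lie_neg]; abel

theorem wedgeTwoOne_self_dOne (τ : l →ₗ[ℝ] a) (c : QuadCocycle a) (x y z : l) :
    wedgeTwoOne a (fun x y => c.α x y + dOne a τ x y + (1 / 2 : ℝ) • dOne a (-τ) x y) (fun x => -τ x) x y z
      = - wedgeTwoOne a (fun x y => c.α x y + (1 / 2 : ℝ) • dOne a τ x y) τ x y z := by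
  simp only [wedgeTwoOne, dOne_neg, LinearMap.neg_apply, map_add, map_smul, map_neg,
    LinearMap.add_apply, LinearMap.smul_apply, smul_eq_mul, smul_neg, LinearMap.neg_apply]
  ring

theorem QuadCocycle.Equiv.symm {c₁ c₂ : QuadCocycle a} (h : c₁.Equiv c₂) : c₂.Equiv c₁ := by
  obtain ⟨τ, σ, h₁, h₂, h₃, h₄, h₅⟩ := h
  refine ⟨-τ, -σ, by simp [h₁], by simp [h₂], by simp [h₃], fun x y => ?_, fun x y z => ?_⟩
  · rw [h₄, dOne_neg]; abel
  · have := wedgeTwoOne_self_dOne τ c₁ x y z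
    have e : ⇑(-τ) = fun x => -τ x := rfl
    simp only [h₄, h₅, e, this]
    simp only [dTwoTriv, LinearMap.neg_apply]
    ring

/-- The alternating form `⟨τ₁ ∧ τ₂⟩ ∈ C²(l)`. -/
def wedgeOneOne (τ₁ τ₂ : l →ₗ[ℝ] a) : l →ₗ[ℝ] l →ₗ[ℝ] ℝ :=
  a.form.compl₁₂ τ₁ τ₂ - (a.form.compl₁₂ τ₁ τ₂).flip

theorem QuadCocycle.Equiv.trans {c₁ c₂ c₃ : QuadCocycle a} (h : c₁.Equiv c₂)
    (h' : c₂.Equiv c₃) : c₁.Equiv c₃ := by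
  obtain ⟨τ, σ, h₁, h₂, h₃, h₄, h₅⟩ := h
  obtain ⟨τ', σ', h₁', h₂', h₃', h₄', h₅'⟩ := h'
  refine ⟨τ + τ', σ + σ' + (1 / 2 : ℝ) • wedgeOneOne τ τ', by simp [h₁, h₁'],
    by simp [h₂, h₂', wedgeOneOne], fun x y => ?_, fun x y => ?_, fun x y z => ?_⟩
  · have e (x y : l) : a.form (τ (l.θ x)) (τ' (l.θ y)) = a.form (τ x) (τ' y) := by
      rw [← a.θ_isom, h₁, h₁']
    simp [h₃, h₃', wedgeOneOne, e]
  · rw [h₄', h₄, dOne_add]; abel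
  · have hs (A B : a) : a.form A B = a.form B A := a.form_symm A B
    have i (x : l) (A B : a) : a.form ⁅x, A⁆ B = - a.form A ⁅x, B⁆ := by
      linarith [a.form_inv x A B]
    have hw : dTwoTriv (wedgeOneOne τ τ') x y z =
        wedgeTwoOne a (dOne a τ) τ' x y z - wedgeTwoOne a (dOne a τ') τ x y z := by
      simp only [dTwoTriv, wedgeOneOne, wedgeTwoOne, dOne, map_sub, LinearMap.sub_apply,
        LinearMap.flip_apply, LinearMap.compl₁₂_apply, i]
      rw [hs (τ' ⁅x, y⁆), hs (τ' ⁅x, z⁆), hs (τ' ⁅y, z⁆), hs (τ' x) ⁅y, τ z⁆, hs (τ' x) ⁅z, τ y⁆,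
        hs (τ' y) ⁅x, τ z⁆, hs (τ' y) ⁅z, τ x⁆, hs (τ' z) ⁅x, τ y⁆, hs (τ' z) ⁅y, τ x⁆]
      simp only [i]
      ring
    have hd : dTwoTriv (σ + σ' + (1 / 2 : ℝ) • wedgeOneOne τ τ') x y z =
        dTwoTriv σ x y z + dTwoTriv σ' x y z + (1 / 2) * dTwoTriv (wedgeOneOne τ τ') x y z := by
      simp only [dTwoTriv, LinearMap.add_apply, LinearMap.smul_apply, smul_eq_mul]
      ring
    rw [h₅', h₅, hd, hw]
    simp only [wedgeTwoOne, dOne_add, h₄, map_add, map_smul, LinearMap.add_apply,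
      LinearMap.smul_apply, smul_eq_mul]
    ring

/-- The orbit relation of the action of the invariant quadratic 1-cochains on cocycles. -/
instance QuadCocycle.setoid (a : OrthMod.{u, v} l) : Setoid (QuadCocycle a) where
  r := QuadCocycle.Equiv
  iseqv := ⟨QuadCocycle.Equiv.refl, QuadCocycle.Equiv.symm, QuadCocycle.Equiv.trans⟩

/-- The quadratic cohomology set `H²_Q(l, θ, a)`. -/
def QuadCohomology (a : OrthMod.{u, v} l) : Type (max u v) := Quotient (QuadCocycle.setoid a)

/-- The cohomology class `[α, γ]`. -/
def QuadCocycle.toClass (c : QuadCocycle a) : QuadCohomology a := Quotient.mk _ c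

end Cochains

section Pullback

variable {l l₁ l₂ : LieInv.{u}} {a : OrthMod.{u, v} l} {a₁ : OrthMod.{u, v} l₁}
  {a₂ : OrthMod.{u, v} l₂}

/-- The pullback `(S, U)^*(α, γ) = (U ∘ S^*α, S^*γ)` of cocycles under a morphism of triples. -/
def TripleHom.pullback (T : TripleHom a₁ a₂) (c : QuadCocycle a₂) : QuadCocycle a₁ where
  α := (c.α.compl₁₂ (T.S : l₁ →ₗ[ℝ] l₂) (T.S : l₁ →ₗ[ℝ] l₂)).compr₂ T.U
  γ := LinearMap.mk₂ ℝ (fun x y => c.γ (T.S x) (T.S y) ∘ₗ (T.S : l₁ →ₗ[ℝ] l₂))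
    (fun x y z => by ext; simp) (fun t x y => by ext; simp)
    (fun x y z => by ext; simp) (fun t x y => by ext; simp)
  α_self := fun x => by simp [c.α_self]
  γ_self_left := fun x y => by simp [c.γ_self_left]
  γ_self_right := fun x y => by simp [c.γ_self_right]
  dα := fun x y z => by
    have h := congrArg T.U (c.dα (T.S x) (T.S y) (T.S z))
    simpa [dTwo, T.U_lie] using h
  dγ := fun x y z w => by
    have h := c.dγ (T.S x) (T.S y) (T.S z) (T.S w)
    simpa [dThreeTriv, wedgeTwoTwo, T.U_isom] using h
  α_θ := fun x y => by simp [T.S_θ, ← T.U_θ, c.α_θ]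
  γ_θ := fun x y z => by simp [T.S_θ, c.γ_θ]

/-- A class `φ ∈ H²_Q(l, θ, a)` is decomposable if it is a sum
`(q₁, j₁)^* φ₁ + (q₂, j₂)^* φ₂` for a non-trivial decomposition `(qᵢ, jᵢ)` of `(l, θ, a)` and
classes `φᵢ ∈ H²_Q(lᵢ, θᵢ, aᵢ)`. Here `φᵢ = [cᵢ]` and addition is induced by the addition of
the pulled back cocycles in the vector space `C²(l, a) ⊕ C³(l)`; the sum is again a cocycle, called
`c` below, because the images of `j₁` and `j₂` are orthogonal. -/
def QuadCohomology.IsDecomposable (φ : QuadCohomology a) : Prop :=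
  ∃ (l₁ l₂ : LieInv.{u}) (a₁ : OrthMod.{u, v} l₁) (a₂ : OrthMod.{u, v} l₂)
    (T₁ : TripleHom a a₁) (T₂ : TripleHom a a₂), IsNontrivialDecomposition T₁ T₂ ∧
    ∃ (c₁ : QuadCocycle a₁) (c₂ : QuadCocycle a₂) (c : QuadCocycle a), c.toClass = φ ∧
      c.α = (T₁.pullback c₁).α + (T₂.pullback c₂).α ∧
      c.γ = (T₁.pullback c₁).γ + (T₂.pullback c₂).γ

end Pullback

/-! ### Admissibility -/

section LieSubmodules

variable {L : Type u} [LieRing L] [LieAlgebra ℝ L] {M : Type v} [AddCommGroup M] [Module ℝ M]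
  [LieRingModule L M] [LieModule ℝ L M]

/-- For submodules `N ≤ P` of a module over a Lie algebra: the quotient module `P / N` is
semi-simple, that is, every submodule `Q / N` of `P / N` (with `N ≤ Q ≤ P`) has a complementary
submodule `Q' / N`. -/
def SemisimpleSection (N P : LieSubmodule ℝ L M) : Prop :=
  N ≤ P ∧ ∀ Q : LieSubmodule ℝ L M, N ≤ Q → Q ≤ P →
    ∃ Q' : LieSubmodule ℝ L M, N ≤ Q' ∧ Q' ≤ P ∧ Q ⊓ Q' = N ∧ Q ⊔ Q' = P

variable (L)

/-- The ideal `S(L)`: the largest ideal of `L` that is a semi-simple `L`-module. -/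
noncomputable def socle : LieIdeal ℝ L := sSup {I : LieIdeal ℝ L | SemisimpleSection ⊥ I}

/-- The ideals `R_k(L)`: `R_0(L) = L`, and `R_{k+1}(L)` is the smallest ideal contained in `R_k(L)`
such that the `L`-module `R_k(L) / R_{k+1}(L)` is semi-simple. -/
noncomputable def radSeries : ℕ → LieIdeal ℝ L
  | 0 => ⊤
  | k + 1 => sInf {J : LieIdeal ℝ L | SemisimpleSection J (radSeries k)}

end LieSubmodules

section Admissible

variable {l : LieInv.{u}} (a : OrthMod.{u, v} l)

/-- The orthogonal module is semi-simple. -/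
def OrthMod.IsSemisimple : Prop := SemisimpleSection (⊥ : LieSubmodule ℝ l a) ⊤

/-- The restriction of the scalar product to the subspace `W` is non-degenerate. -/
def OrthMod.IsNondegenerateOn (W : Submodule ℝ a) : Prop :=
  ∀ A ∈ W, (∀ B ∈ W, a.form A B = 0) → A = 0

/-- The space `a^l` of invariants. -/
def OrthMod.invariants : Submodule ℝ a := (LieModule.maxTrivSubmodule ℝ l a).toSubmodule

/-- The space `ρ(l) a`, the linear span of all `ρ(L) A`. -/
def OrthMod.actionSpan : Submodule ℝ a := Submodule.span ℝ {B : a | ∃ (x : l) (A : a), ⁅x, A⁆ = B}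

/-- For a semi-simple module, where `a = a^l ⊕ ρ(l) a`, this is the image of the subspace `W` under
the projection of `a` onto `a^l` along `ρ(l) a`: it consists of those `A ∈ a^l` such that
`A = B + C` for some `B ∈ W` and `C ∈ ρ(l) a`. -/
def OrthMod.projInvariants (W : Submodule ℝ a) : Submodule ℝ a := a.invariants ⊓ (W ⊔ a.actionSpan)

variable {a} (c : QuadCocycle a)

/-- For a subspace `V` of `l`, the subspace `α(ker [·,·]_V)` of `a`, where both the bracket and the
alternating map `α` are regarded as linear maps on bivectors: it consists of all `∑ α(xᵢ, yᵢ)`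
with `xᵢ, yᵢ ∈ V` and `∑ [xᵢ, yᵢ] = 0`. (We use `V ⊗ V` in place of its quotient `⋀² V`, through
which both maps factor; the image of the kernel is the same.) -/
noncomputable def QuadCocycle.alphaKer (V : Submodule ℝ l) : Submodule ℝ a :=
  Submodule.map (TensorProduct.lift (c.α.domRestrict₁₂ V V))
    (LinearMap.ker (TensorProduct.lift
      ((LieModule.toEnd ℝ l l : l →ₗ[ℝ] Module.End ℝ l).domRestrict₁₂ V V)))

/-- Condition `(A_0)`. -/
def QuadCocycle.CondA0 : Prop :=
  ∀ x₀ : l, (∀ x : l, ⁅x, x₀⁆ = 0) → (∀ A : a, ⁅x₀, A⁆ = 0) →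
    (∃ (A₀ : a) (Z₀ : Module.Dual ℝ l),
      (∀ x : l, c.α x x₀ = ⁅x, A₀⁆) ∧
      (∀ x y : l, c.γ x x₀ y = - a.form A₀ (c.α x y) + Z₀ ⁅x, y⁆)) →
    x₀ = 0

/-- Condition `(B_0)`: the subspace `α₀(ker [·,·]_l)` of `a^l` is non-degenerate, where `α₀` is
the component of `α` in `a^l`. -/
def QuadCocycle.CondB0 : Prop := a.IsNondegenerateOn (a.projInvariants (c.alphaKer ⊤))

/-- Condition `(T_2)`: `(a^l)₊ = α₀(ker [·,·]_{l₋})`. -/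
def QuadCocycle.CondT2 : Prop := a.invariants ⊓ a.plus = a.projInvariants (c.alphaKer l.minus)

/-- Condition `(A_k)` for `k ≥ 1`. -/
def QuadCocycle.CondA (k : ℕ) : Prop :=
  ∀ I : LieIdeal ℝ l, I ≤ socle l ⊓ radSeries l k →
    (∃ (Φ₁ : I →ₗ[ℝ] a) (Φ₂ : I →ₗ[ℝ] Module.Dual ℝ (radSeries l k)),
      (∀ (x : l) (K : I), c.α x K = ⁅x, Φ₁ K⁆ - Φ₁ ⁅x, K⁆) ∧
      (∀ (x : l) (K : I) (y : radSeries l k),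
        c.γ x K y = - a.form (Φ₁ K) (c.α x y) + Φ₂ K ⁅x, y⁆ + Φ₂ ⁅x, K⁆ y)) →
    I = ⊥

/-- The system of equations in condition `(B_k)` is solvable for the submodule `b` of `a`. -/
def QuadCocycle.SolvableOn (k : ℕ) (b : LieSubmodule ℝ l a) : Prop :=
  ∃ Φ : radSeries l k →ₗ[ℝ] a, ∀ (x : l) (K : radSeries l k), ∀ B ∈ b,
    a.form (c.α x K) B = a.form (⁅x, Φ K⁆ - Φ ⁅x, K⁆) B

/-- Condition `(B_k)` for `k ≥ 1`: the maximal submodule `b_k` on which the system of equations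
is solvable is non-degenerate. -/
def QuadCocycle.CondB (k : ℕ) : Prop :=
  ∀ b : LieSubmodule ℝ l a, IsGreatest {b' | c.SolvableOn k b'} b →
    a.IsNondegenerateOn b.toSubmodule

/-- The cocycle satisfies `(T_2)`, `(A_k)` and `(B_k)` for `0 ≤ k ≤ m`, where `m` is such that
`R_{m+1}(l) = 0` (for `k > m` the conditions `(A_k)` and `(B_k)` hold trivially). -/
def QuadCocycle.IsAdmissible : Prop :=
  c.CondT2 ∧ c.CondA0 ∧ c.CondB0 ∧
    ∃ m : ℕ, radSeries l (m + 1) = ⊥ ∧ ∀ k, 1 ≤ k → k ≤ m → c.CondA k ∧ c.CondB k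

/-- The set `H²_Q(l, θ, a)_♯` of admissible cohomology classes. They are defined for semi-simple
modules only. -/
def admissibleClasses (a : OrthMod.{u, v} l) : Set (QuadCohomology a) :=
  {φ | a.IsSemisimple ∧ ∃ c : QuadCocycle a, c.toClass = φ ∧ c.IsAdmissible}

/-- The set `H²_Q(l, θ, a)_0` of admissible indecomposable cohomology classes. -/
def indecomposableClasses (a : OrthMod.{u, v} l) : Set (QuadCohomology a) :=
  {φ | φ ∈ admissibleClasses a ∧ ¬ φ.IsDecomposable}

/-- A Lie algebra with involution `(l, θ)` is admissible if `[l₋, l₋] = l₊` and if there is a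
semi-simple orthogonal `(l, θ)`-module `a` with `H²_Q(l, θ, a)_♯ ≠ ∅`. (Every finite-dimensional
real module is isomorphic to one whose underlying type is in `Type`.) -/
def LieInv.IsAdmissible (l : LieInv.{u}) : Prop :=
  l.BracketMinusEqPlus ∧
    ∃ a : OrthMod.{u, 0} l, a.IsSemisimple ∧ (admissibleClasses a).Nonempty

end Admissible

/-! ### Metric Lie algebras with involution and symmetric triples -/

/-- A metric Lie algebra with involution: a finite-dimensional real Lie algebra with an invariant
scalar product (non-degenerate, symmetric, possibly indefinite) and an involutive isometric
automorphism. -/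
structure MetricLieInv : Type (u + 1) extends LieInv.{u} where
  form : LinearMap.BilinForm ℝ carrier
  form_symm : ∀ x y, form x y = form y x
  form_nondeg : ∀ x, (∀ y, form x y = 0) → x = 0
  form_inv : ∀ x y z : carrier, form ⁅x, y⁆ z + form y ⁅x, z⁆ = 0
  θ_isom : ∀ x y, form (θ x) (θ y) = form x y

/-- A symmetric triple is a metric Lie algebra with involution `(g, θ, ⟨·,·⟩)` such that
`[g₋, g₋] = g₊` and `g₊` acts faithfully on `g₋`. -/
def MetricLieInv.IsSymmetricTriple (g : MetricLieInv.{u}) : Prop :=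
  g.toLieInv.BracketMinusEqPlus ∧ g.toLieInv.FaithfulOnMinus

/-- The (orthogonal) direct sum of metric Lie algebras with involution. -/
def MetricLieInv.prod (g₁ g₂ : MetricLieInv.{u}) : MetricLieInv.{u} where
  toLieInv := g₁.toLieInv.prod g₂.toLieInv
  form := g₁.form.compl₁₂ (LinearMap.fst ℝ g₁.carrier g₂.carrier)
      (LinearMap.fst ℝ g₁.carrier g₂.carrier) +
    g₂.form.compl₁₂ (LinearMap.snd ℝ g₁.carrier g₂.carrier)
      (LinearMap.snd ℝ g₁.carrier g₂.carrier)
  form_symm := fun x y => by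
    change g₁.form x.1 y.1 + g₂.form x.2 y.2 = g₁.form y.1 x.1 + g₂.form y.2 x.2
    rw [g₁.form_symm x.1 y.1, g₂.form_symm x.2 y.2]
  form_nondeg := fun x h => by
    refine Prod.ext (g₁.form_nondeg _ fun y => ?_) (g₂.form_nondeg _ fun y => ?_)
    · have h' : g₁.form x.1 y + g₂.form x.2 0 = 0 := h (y, 0)
      simpa using h'
    · have h' : g₁.form x.1 0 + g₂.form x.2 y = 0 := h (0, y)
      simpa using h'
  form_inv := fun x y z => by
    have h₁ := g₁.form_inv x.1 y.1 z.1
    have h₂ := g₂.form_inv x.2 y.2 z.2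
    change (g₁.form ⁅x.1, y.1⁆ z.1 + g₂.form ⁅x.2, y.2⁆ z.2) +
      (g₁.form y.1 ⁅x.1, z.1⁆ + g₂.form y.2 ⁅x.2, z.2⁆) = 0
    linarith
  θ_isom := fun x y => by
    change g₁.form (g₁.θ x.1) (g₁.θ y.1) + g₂.form (g₂.θ x.2) (g₂.θ y.2) =
      g₁.form x.1 y.1 + g₂.form x.2 y.2
    rw [g₁.θ_isom, g₂.θ_isom]

/-- Isomorphism of metric Lie algebras with involution: an isometric Lie algebra isomorphism that
commutes with the involutions. -/
def MetricLieInv.IsIsomorphic (g h : MetricLieInv.{u}) : Prop :=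
  ∃ Ψ : g.carrier ≃ₗ⁅ℝ⁆ h.carrier,
    (∀ x, Ψ (g.θ x) = h.θ (Ψ x)) ∧ ∀ x y, h.form (Ψ x) (Ψ y) = g.form x y

/-- A symmetric triple is indecomposable if it is not (isomorphic to) the direct sum of two
non-vanishing symmetric triples. -/
def MetricLieInv.IsIndecomposable (g : MetricLieInv.{u}) : Prop :=
  g.IsSymmetricTriple ∧
    ¬ ∃ g₁ g₂ : MetricLieInv.{u}, g₁.IsSymmetricTriple ∧ g₂.IsSymmetricTriple ∧
      Nontrivial g₁.carrier ∧ Nontrivial g₂.carrier ∧ g.IsIsomorphic (g₁.prod g₂)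

/-! ### The standard model -/

section StandardModel

variable {l : LieInv.{u}} {a : OrthMod.{u, v} l}

/-- The vector space `d = l^* ⊕ a ⊕ l` underlying `d_{α,γ}(l, θ, a)`; `⟨Z, A, L⟩` stands for
`Z + A + L`. The cocycle `c = (α, γ)` is recorded because the Lie bracket on `d` depends on it. -/
@[ext]
structure StdModel (c : QuadCocycle a) : Type (max u v) where
  Z : Module.Dual ℝ l
  A : a
  L : l

variable (c : QuadCocycle a)

/-- The identification of the standard model with `l^* × a × l`. -/
def StdModel.toProd : StdModel c ≃ Module.Dual ℝ l × a × l where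
  toFun X := (X.Z, X.A, X.L)
  invFun X := ⟨X.1, X.2.1, X.2.2⟩

instance : AddCommGroup (StdModel c) := (StdModel.toProd c).addCommGroup

instance : Module ℝ (StdModel c) := (StdModel.toProd c).module ℝ

instance : FiniteDimensional ℝ (StdModel c) :=
  Module.Finite.equiv ((StdModel.toProd c).linearEquiv ℝ).symm

namespace StdModel

variable {c}

@[simp] theorem add_Z (X Y : StdModel c) : (X + Y).Z = X.Z + Y.Z := rfl
@[simp] theorem add_A (X Y : StdModel c) : (X + Y).A = X.A + Y.A := rfl
@[simp] theorem add_L (X Y : StdModel c) : (X + Y).L = X.L + Y.L := rfl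
@[simp] theorem smul_Z (t : ℝ) (X : StdModel c) : (t • X).Z = t • X.Z := rfl
@[simp] theorem smul_A (t : ℝ) (X : StdModel c) : (t • X).A = t • X.A := rfl
@[simp] theorem smul_L (t : ℝ) (X : StdModel c) : (t • X).L = t • X.L := rfl
@[simp] theorem zero_Z : (0 : StdModel c).Z = 0 := rfl
@[simp] theorem zero_A : (0 : StdModel c).A = 0 := rfl
@[simp] theorem zero_L : (0 : StdModel c).L = 0 := rfl

/-- The bracket of the standard model, the bilinear extension of
`[l^*, l^* ⊕ a] = 0`, `[L₁, L₂] = γ(L₁, L₂, ·) + α(L₁, L₂) + [L₁, L₂]_l`,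
`[L, A] = ρ(L) A - ⟨A, α(L, ·)⟩`, `[L, Z] = ad^*(L) Z = - Z([L, ·])` and
`[A₁, A₂] = ⟨ρ(·) A₁, A₂⟩`. -/
instance : Bracket (StdModel c) (StdModel c) where
  bracket X Y :=
    { Z := c.γ X.L Y.L - a.form Y.A ∘ₗ c.α X.L + a.form X.A ∘ₗ c.α Y.L
        + a.form Y.A ∘ₗ (LieModule.toEnd ℝ l a : l →ₗ[ℝ] Module.End ℝ a).flip X.A
        - Y.Z ∘ₗ (LieAlgebra.ad ℝ l X.L : l →ₗ[ℝ] l)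
        + X.Z ∘ₗ (LieAlgebra.ad ℝ l Y.L : l →ₗ[ℝ] l)
      A := ⁅X.L, Y.A⁆ - ⁅Y.L, X.A⁆ + c.α X.L Y.L
      L := ⁅X.L, Y.L⁆ }

theorem lie_Z (X Y : StdModel c) (x : l) :
    ⁅X, Y⁆.Z x = c.γ X.L Y.L x - a.form Y.A (c.α X.L x) + a.form X.A (c.α Y.L x)
      + a.form Y.A ⁅x, X.A⁆ - Y.Z ⁅X.L, x⁆ + X.Z ⁅Y.L, x⁆ := rfl

theorem lie_A (X Y : StdModel c) : ⁅X, Y⁆.A = ⁅X.L, Y.A⁆ - ⁅Y.L, X.A⁆ + c.α X.L Y.L := rfl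

theorem lie_L (X Y : StdModel c) : ⁅X, Y⁆.L = ⁅X.L, Y.L⁆ := rfl

end StdModel

theorem QuadCocycle.α_swap (x y : l) : c.α x y = - c.α y x := by
  have h := c.α_self (x + y)
  simp only [map_add, LinearMap.add_apply, c.α_self, zero_add, add_zero] at h
  exact eq_neg_of_add_eq_zero_right h

theorem QuadCocycle.γ_swap_left (x y z : l) : c.γ x y z = - c.γ y x z := by
  have h := c.γ_self_left (x + y) z
  simp only [map_add, LinearMap.add_apply, c.γ_self_left, zero_add, add_zero] at h
  linarith

theorem QuadCocycle.γ_swap_right (x y z : l) : c.γ x y z = - c.γ x z y := by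
  have h := c.γ_self_right x (y + z)
  simp only [map_add, LinearMap.add_apply, c.γ_self_right, zero_add, add_zero] at h
  linarith

instance : LieRing (StdModel c) where
  add_lie := fun X Y W => by
    refine StdModel.ext (LinearMap.ext fun x => ?_) ?_ ?_
    · simp only [StdModel.lie_Z, StdModel.add_Z, StdModel.add_A, StdModel.add_L, map_add,
        LinearMap.add_apply, add_lie, lie_add]
      ring
    · simp only [StdModel.lie_A, StdModel.add_A, StdModel.add_L, map_add, LinearMap.add_apply,
        add_lie, lie_add]
      abel
    · exact add_lie X.L Y.L W.L
  lie_add := fun X Y W => by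
    refine StdModel.ext (LinearMap.ext fun x => ?_) ?_ ?_
    · simp only [StdModel.lie_Z, StdModel.add_Z, StdModel.add_A, StdModel.add_L, map_add,
        LinearMap.add_apply, add_lie]
      ring
    · simp only [StdModel.lie_A, StdModel.add_A, StdModel.add_L, map_add, add_lie, lie_add]
      abel
    · exact lie_add X.L Y.L W.L
  lie_self := fun X => by
    refine StdModel.ext (LinearMap.ext fun x => ?_) ?_ ?_
    · have h := a.form_inv x X.A X.A
      rw [a.form_symm ⁅x, X.A⁆] at h
      have h' : a.form X.A ⁅x, X.A⁆ = 0 := by linarith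
      rw [StdModel.lie_Z, c.γ_self_left, h', StdModel.zero_Z, LinearMap.zero_apply]
      ring
    · rw [StdModel.lie_A, c.α_self, sub_self, add_zero, StdModel.zero_A]
    · exact lie_self X.L
  leibniz_lie := fun X Y W => by
    obtain ⟨Z₁, A₁, x⟩ := X
    obtain ⟨Z₂, A₂, y⟩ := Y
    obtain ⟨Z₃, A₃, z⟩ := W
    refine StdModel.ext (LinearMap.ext fun w => ?_) ?_ ?_
    · have hs (A B : a) : a.form A B = a.form B A := a.form_symm A B
      have i (x : l) (A B : a) : a.form ⁅x, A⁆ B = - a.form A ⁅x, B⁆ := by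
        linarith [a.form_inv x A B]
      have j (p q r : l) (A : a) : a.form (c.α p q) ⁅r, A⁆ = - a.form A ⁅r, c.α p q⁆ := by
        rw [hs, i]
      have k (p q r s : l) : c.γ p q ⁅r, s⁆ = c.γ ⁅r, s⁆ p q := by
        rw [c.γ_swap_right, c.γ_swap_left, neg_neg]
      have k' (p q r s : l) : c.γ p ⁅q, r⁆ s = - c.γ ⁅q, r⁆ p s := c.γ_swap_left _ _ _
      have m (A : a) (p q r : l) : a.form A (c.α p ⁅q, r⁆) = - a.form A (c.α ⁅q, r⁆ p) := by
        rw [c.α_swap, map_neg]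
      have h₁ := congrArg (a.form A₁) (c.dα y z w)
      have h₂ := congrArg (a.form A₂) (c.dα x z w)
      have h₃ := congrArg (a.form A₃) (c.dα x y w)
      have h₄ := c.dγ x y z w
      simp only [dTwo, map_add, map_sub, map_zero] at h₁ h₂ h₃
      simp only [dThreeTriv, wedgeTwoTwo] at h₄
      simp only [StdModel.add_Z, StdModel.lie_Z, StdModel.lie_A, StdModel.lie_L, map_add, map_sub,
        LinearMap.add_apply, LinearMap.sub_apply, k, k', m, lie_lie, lie_add, lie_sub, i, j]
      rw [hs (c.α z w), hs (c.α y w), hs (c.α x w)] at h₄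
      have h₅ : a.form A₂ ⁅w, ⁅z, A₁⁆⁆ = a.form A₁ ⁅z, ⁅w, A₂⁆⁆ := by
        rw [hs, i, i, neg_neg]
      linear_combination h₄ - h₁ + h₂ - h₃ + h₅
    · have h := c.dα x y z
      rw [dTwo, c.α_swap ⁅x, z⁆ y, c.α_swap ⁅y, z⁆ x] at h
      simp only [StdModel.add_A, StdModel.lie_A, StdModel.lie_L, lie_add, lie_sub, lie_lie]
      rw [← sub_eq_zero, ← h]
      abel
    · exact leibniz_lie x y z

instance : LieAlgebra ℝ (StdModel c) where
  lie_smul := fun t X Y => by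
    refine StdModel.ext (LinearMap.ext fun x => ?_) ?_ ?_
    · simp only [StdModel.lie_Z, StdModel.smul_Z, StdModel.smul_A, StdModel.smul_L, map_smul,
        LinearMap.smul_apply, smul_lie, smul_eq_mul]
      ring
    · simp only [StdModel.lie_A, StdModel.smul_A, StdModel.smul_L, map_smul, smul_lie, lie_smul,
        smul_add, smul_sub]
    · exact lie_smul t X.L Y.L

/-- The inner product `⟨Z₁ + A₁ + L₁, Z₂ + A₂ + L₂⟩ = ⟨A₁, A₂⟩ + Z₁(L₂) + Z₂(L₁)`. -/
def StdModel.form : LinearMap.BilinForm ℝ (StdModel c) :=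
  LinearMap.mk₂ ℝ (fun X Y => a.form X.A Y.A + X.Z Y.L + Y.Z X.L)
    (fun X X' Y => by simp; ring) (fun t X Y => by simp; ring)
    (fun X Y Y' => by simp; ring) (fun t X Y => by simp; ring)

theorem StdModel.form_apply (X Y : StdModel c) :
    StdModel.form c X Y = a.form X.A Y.A + X.Z Y.L + Y.Z X.L := rfl

/-- The involution `θ(Z + A + L) = θ_l^*(Z) + θ_a(A) + θ_l(L)`. -/
def StdModel.θ : StdModel c →ₗ⁅ℝ⁆ StdModel c where
  toFun X := ⟨X.Z ∘ₗ (l.θ : l →ₗ[ℝ] l), a.θ X.A, l.θ X.L⟩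
  map_add' := fun X Y => StdModel.ext (by ext; simp) (by simp) (by simp)
  map_smul' := fun t X => StdModel.ext (by ext; simp) (by simp) (by simp)
  map_lie' := fun {X Y} => by
    have hl (x : l) : l.θ (l.θ x) = x := l.θ_θ x
    have hα (x y : l) : a.θ (c.α x y) = c.α (l.θ x) (l.θ y) := by
      rw [← c.α_θ (l.θ x) (l.θ y), hl, hl]
    have ha (x : l) (A : a) : a.θ ⁅x, A⁆ = ⁅l.θ x, a.θ A⁆ := by
      rw [← a.θ_lie, hl]
    have hf (A B : a) : a.form A (a.θ B) = a.form (a.θ A) B := by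
      rw [← a.θ_isom A, a.θ_θ]
    have hγ (x y z : l) : c.γ x y (l.θ z) = c.γ (l.θ x) (l.θ y) z := by
      rw [← c.γ_θ x y, hl]
    have hα' (x y : l) : c.α x (l.θ y) = a.θ (c.α (l.θ x) y) := by
      rw [hα, hl]
    refine StdModel.ext (LinearMap.ext fun x => ?_) ?_ (l.θ.map_lie X.L Y.L)
    · have h₁ (L : l) : l.θ ⁅L, l.θ x⁆ = ⁅l.θ L, x⁆ := by rw [LieHom.map_lie, hl]
      have h₁' (L : l) : ⁅L, l.θ x⁆ = l.θ ⁅l.θ L, x⁆ := by rw [LieHom.map_lie, hl]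
      have h₂ (A : a) : ⁅l.θ x, A⁆ = a.θ ⁅x, a.θ A⁆ := by rw [ha, a.θ_θ]
      rw [StdModel.lie_Z]
      change ⁅X, Y⁆.Z (l.θ x) = _
      rw [StdModel.lie_Z, hγ, hα', hα', hf, hf, h₂, hf, h₁', h₁']
      rfl
    · rw [StdModel.lie_A]
      change a.θ ⁅X, Y⁆.A = _
      rw [StdModel.lie_A, map_add, map_sub, ha, ha, hα]
      rfl

/-- The metric Lie algebra with involution `d_{α,γ}(l, θ, a)`. -/
def stdModel : MetricLieInv.{max u v} where
  carrier := StdModel c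
  θ := StdModel.θ c
  θ_θ := fun X => StdModel.ext (LinearMap.ext fun x => congrArg X.Z (l.θ_θ x)) (a.θ_θ X.A)
    (l.θ_θ X.L)
  form := StdModel.form c
  form_symm := fun X Y => by
    rw [StdModel.form_apply, StdModel.form_apply, a.form_symm]
    ring
  form_nondeg := fun X h => by
    have h' (Y : StdModel c) : a.form X.A Y.A + X.Z Y.L + Y.Z X.L = 0 := h Y
    refine StdModel.ext (LinearMap.ext fun x => ?_) (a.form_nondeg _ fun B => ?_) ?_
    · simpa using h' ⟨0, 0, x⟩
    · simpa using h' ⟨0, B, 0⟩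
    · exact (Module.forall_dual_apply_eq_zero_iff ℝ X.L).1 fun f => by simpa using h' ⟨f, 0, 0⟩
  form_inv := fun X Y W => by
    have h₁ := a.form_inv X.L Y.A W.A
    rw [StdModel.form_apply, StdModel.form_apply, StdModel.lie_Z, StdModel.lie_Z,
      StdModel.lie_A, StdModel.lie_A, StdModel.lie_L, StdModel.lie_L]
    simp only [map_add, map_sub, LinearMap.add_apply, LinearMap.sub_apply]
    rw [c.γ_swap_right X.L W.L Y.L, ← lie_skew W.L Y.L, map_neg, c.α_swap W.L Y.L, map_neg,
      a.form_symm (c.α X.L Y.L) W.A, a.form_symm ⁅Y.L, X.A⁆ W.A]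
    linear_combination h₁
  θ_isom := fun X Y => by
    have h (x : l) : l.θ (l.θ x) = x := l.θ_θ x
    change a.form (a.θ X.A) (a.θ Y.A) + X.Z (l.θ (l.θ Y.L)) + Y.Z (l.θ (l.θ X.L)) =
      a.form X.A Y.A + X.Z Y.L + Y.Z X.L
    rw [a.θ_isom, h, h]

end StandardModel

end SymTriple

namespace SymTriple

/-! ### The radical series -/

section RadSeries

variable {L : Type u} [LieRing L] [LieAlgebra ℝ L]

/-! Write g = l^* ⊕ a ⊕ l for the standard model.

Symmetric triple. In a metric Lie algebra with involution, the part of g₊ orthogonal to [g₋, g₋]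
annihilates g₋ by invariance, so faithfulness of g₊ on g₋ already gives [g₋, g₋] = g₊
(`MetricLieInv.isSymmetricTriple_of_faithful`). For the standard model, an element Z + A + K of g₊
annihilating g₋ loses K by (A_0), then A by (T_2), then Z by (T_1)
(`QuadCocycle.faithfulOnMinus_stdModel`). Equivalent cocycles have isomorphic standard models, so it
suffices to treat one admissible representative.

A decomposable class gives a decomposable algebra: the standard model of a sum of pulled back
cocycles is the orthogonal sum of the two standard models (`isIsomorphic_prod`), and faithfulness
passes to summands.

Conversely, an orthogonal decomposition of g amounts to a self-adjoint idempotent P that commutes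
with all ad X and with θ. The heart of the matter is that P preserves the flag l^* ⊂ l^* ⊕ a. The
l-components of P(l^*) are central, and they are shown to lie in R_k(l) by induction on k. If one of
them were outside [l, R_k(l)], a functional φ separating it from this span would have (Pφ)_l = 0 by
(A_k), and self-adjointness would contradict the choice of φ. A central element of [l, R_k(l)] lies
in R_{k+1}(l) (`mem_radSeries_succ`), and the series reaches 0, so (P l^*)_l = 0 (`ofZ_L`). The
blocks l^* → a and a → l of P are adjoint to each other; the same induction, now with (B_k) as well,
shows that both vanish (`ofZ_A`, `ofA_L`).

Hence P induces idempotents π on l and ϖ on a that split the triple (`tripleProj`). A section of g →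
l that is isotropic, θ-equivariant and intertwines π with P replaces the cocycle by an equivalent
one that is block diagonal (`exists_compatible`), so the class is decomposable. -/

theorem SemisimpleSection.refl (N : LieIdeal ℝ L) : SemisimpleSection N N :=
  ⟨le_rfl, fun Q h₁ h₂ => ⟨N, le_rfl, le_rfl, by rw [le_antisymm h₂ h₁, inf_idem],
    by rw [le_antisymm h₂ h₁, sup_idem]⟩⟩

/-- Given Q, let Q₁ be a complement of Q + J modulo J, and Q₂ a complement of (Q ∩ J) + J' modulo
J'. Then Q₁ ∩ Q₂ complements Q modulo J ∩ J'. -/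
theorem SemisimpleSection.inf {J J' N : LieIdeal ℝ L} (h : SemisimpleSection J N)
    (h' : SemisimpleSection J' N) : SemisimpleSection (J ⊓ J') N := by
  refine ⟨inf_le_left.trans h.1, fun Q hQ hQN => ?_⟩
  obtain ⟨Q₁, hJ₁, hN₁, hi₁, hs₁⟩ := h.2 (Q ⊔ J) le_sup_right (sup_le hQN h.1)
  obtain ⟨Q₂, hJ₂, hN₂, hi₂, hs₂⟩ := h'.2 ((Q ⊓ J) ⊔ J') le_sup_right
    (sup_le (inf_le_left.trans hQN) h'.1)
  refine ⟨Q₁ ⊓ Q₂, le_inf (inf_le_left.trans hJ₁) (inf_le_right.trans hJ₂),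
    inf_le_left.trans hN₁, le_antisymm ?_ ?_, le_antisymm ?_ ?_⟩
  · have hJ : Q ⊓ Q₁ ≤ J := (inf_le_inf_right _ le_sup_left).trans hi₁.le
    have h₁ : Q ⊓ (Q₁ ⊓ Q₂) ≤ J := (inf_le_inf_left _ inf_le_left).trans hJ
    refine le_inf h₁ (le_trans (le_inf ?_ (inf_le_right.trans inf_le_right)) hi₂.le)
    exact (le_inf inf_le_left h₁).trans le_sup_left
  · exact le_inf hQ (le_inf (inf_le_left.trans hJ₁) (inf_le_right.trans hJ₂))
  · exact sup_le hQN (inf_le_left.trans hN₁)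
  · intro x hx
    rw [← hs₁, LieSubmodule.mem_sup] at hx
    obtain ⟨y, hy, q₁, hq₁, rfl⟩ := hx
    have hq₁N := hN₁ hq₁
    rw [LieSubmodule.mem_sup] at hy
    obtain ⟨q, hq, j, hj, rfl⟩ := hy
    have hjq : j + q₁ ∈ Q₁ := add_mem (hJ₁ hj) hq₁
    have hjN := hN₁ hjq
    rw [← hs₂, LieSubmodule.mem_sup] at hjN
    obtain ⟨y, hy, q₂, hq₂, e⟩ := hjN
    rw [LieSubmodule.mem_sup] at hy
    obtain ⟨r, hr, j', hj', rfl⟩ := hy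
    rw [LieSubmodule.mem_inf] at hr
    rw [LieSubmodule.mem_sup]
    refine ⟨q + r, add_mem hq hr.1, j' + q₂, ?_, ?_⟩
    · rw [LieSubmodule.mem_inf]
      refine ⟨?_, add_mem (hJ₂ hj') hq₂⟩
      have : j' + q₂ = (j + q₁) - r := by rw [← e]; abel
      rw [this]
      exact sub_mem hjq (hJ₁ hr.2)
    · rw [add_assoc, add_assoc, ← e]; abel

theorem mem_radSeries_succ_iff {k : ℕ} {x : L} : x ∈ radSeries L (k + 1) ↔
    ∀ J, SemisimpleSection J (radSeries L k) → x ∈ J := by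
  change x ∈ (↑(sInf {J : LieIdeal ℝ L | SemisimpleSection J (radSeries L k)}) : Set L) ↔ _
  rw [LieSubmodule.coe_sInf]
  simp

/-- The infimum defining `radSeries` is attained: by the descending chain condition there is a
minimal candidate, and stability under intersections makes it the least one. -/
theorem semisimpleSection_radSeries [FiniteDimensional ℝ L] (k : ℕ) :
    SemisimpleSection (radSeries L (k + 1)) (radSeries L k) := by
  let s : Set (LieIdeal ℝ L) := {J | SemisimpleSection J (radSeries L k)}
  have hne : s.Nonempty := ⟨_, SemisimpleSection.refl _⟩
  obtain ⟨J, hJ, hmin⟩ := (LieSubmodule.wellFoundedLT_of_isArtinian ℝ L L).wf.has_min s hne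
  have hle : radSeries L (k + 1) = J := by
    refine le_antisymm (sInf_le hJ) (le_sInf fun J' hJ' => ?_)
    by_contra hn
    exact hmin (J ⊓ J') (SemisimpleSection.inf hJ hJ')
      (lt_of_le_of_ne inf_le_left fun e => hn (e ▸ inf_le_right))
  rw [hle]
  exact hJ

/-- A central element in the span of `[L, R_k(L)]` lies in `R_{k+1}(L)`. -/
theorem mem_radSeries_succ {k : ℕ} {K : L} (hc : ∀ x : L, ⁅x, K⁆ = 0)
    (hK : K ∈ Submodule.span ℝ {z : L | ∃ x : L, ∃ y ∈ radSeries L k, ⁅x, y⁆ = z}) :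
    K ∈ radSeries L (k + 1) := by
  refine mem_radSeries_succ_iff.2 fun J hJ => ?_
  have hKk : K ∈ radSeries L k := by
    have : Submodule.span ℝ {z : L | ∃ x : L, ∃ y ∈ radSeries L k, ⁅x, y⁆ = z} ≤
        (radSeries L k).toSubmodule := by
      rw [Submodule.span_le]
      rintro _ ⟨x, y, hy, rfl⟩
      exact lie_mem_right ℝ L _ x y hy
    exact this hK
  let I : LieIdeal ℝ L :=
    { Submodule.span ℝ {K} with
      lie_mem := by
        intro x y hy
        obtain ⟨t, rfl⟩ := Submodule.mem_span_singleton.1 hy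
        rw [lie_smul, hc, smul_zero]
        exact Submodule.zero_mem (Submodule.span ℝ {K}) }
  have hI : ∀ y, y ∈ I ↔ ∃ t : ℝ, t • K = y := fun y => Submodule.mem_span_singleton
  have hIk : I ≤ radSeries L k := by
    intro y hy
    obtain ⟨t, rfl⟩ := (hI y).1 hy
    exact (radSeries L k).smul_mem t hKk
  obtain ⟨Q', hJQ, -, hi, hs⟩ := hJ.2 (I ⊔ J) le_sup_right (sup_le hIk hJ.1)
  -- R_k = ℝK + J + Q' with J ≤ Q'. Bracketing kills the central K, so [L, R_k] ⊂ Q', and in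
  -- particular K ∈ Q'. Hence K ∈ (ℝK + J) ∩ Q' = J.
  have hKQ : K ∈ Q' := by
    have : Submodule.span ℝ {z : L | ∃ x : L, ∃ y ∈ radSeries L k, ⁅x, y⁆ = z} ≤
        Q'.toSubmodule := by
      rw [Submodule.span_le]
      rintro _ ⟨x, y, hy, rfl⟩
      rw [← hs, LieSubmodule.mem_sup] at hy
      obtain ⟨y, hy, q, hq, rfl⟩ := hy
      rw [LieSubmodule.mem_sup] at hy
      obtain ⟨i, hi, j, hj, rfl⟩ := hy
      obtain ⟨t, rfl⟩ := (hI i).1 hi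
      rw [lie_add, lie_add, lie_smul, hc, smul_zero, zero_add]
      exact add_mem (hJQ (lie_mem_right ℝ L _ x j hj)) (lie_mem_right ℝ L _ x q hq)
    exact this hK
  rw [← hi, LieSubmodule.mem_inf]
  exact ⟨le_sup_left (a := I) ((hI K).2 ⟨1, one_smul _ _⟩), hKQ⟩

variable {L' : Type v} [LieRing L'] [LieAlgebra ℝ L']

/-- The image of an ideal under a linear map that is equivariant over a surjective map. -/
def mapIdeal (φ : L →ₗ[ℝ] L') (ψ : L → L') (hψ : Function.Surjective ψ)
    (h : ∀ x y, φ ⁅x, y⁆ = ⁅ψ x, φ y⁆) (J : LieIdeal ℝ L) : LieIdeal ℝ L' :=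
  { J.toSubmodule.map φ with
    lie_mem := by
      rintro x _ ⟨y, hy, rfl⟩
      obtain ⟨x, rfl⟩ := hψ x
      exact ⟨⁅x, y⁆, lie_mem_right ℝ L J x y hy, h x y⟩ }

/-- The preimage of an ideal under an equivariant linear map. -/
def comapIdeal (φ : L →ₗ[ℝ] L') (ψ : L → L') (h : ∀ x y, φ ⁅x, y⁆ = ⁅ψ x, φ y⁆)
    (J : LieIdeal ℝ L') : LieIdeal ℝ L :=
  { J.toSubmodule.comap φ with
    lie_mem := by
      intro x y hy
      change φ ⁅x, y⁆ ∈ J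
      rw [h]
      exact lie_mem_right ℝ L' J _ _ hy }

/-- If R_k(L') / J is semi-simple, so is R_k(L) modulo the part of it mapped into J: push submodules
forward, complement them, and pull back. The twist ψ covers both uses, the projection of the
standard model onto l (ψ = φ) and a centroid element P of the standard model (ψ = id), where φ need
not be surjective. -/
theorem map_mem_radSeries (φ : L →ₗ[ℝ] L') (ψ : L → L') (hψ : Function.Surjective ψ)
    (h : ∀ x y, φ ⁅x, y⁆ = ⁅ψ x, φ y⁆) (k : ℕ) :
    ∀ x ∈ radSeries L k, φ x ∈ radSeries L' k := by
  induction k with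
  | zero => exact fun x _ => LieSubmodule.mem_top _
  | succ k ih =>
    intro x hx
    refine mem_radSeries_succ_iff.2 fun J hJ => ?_
    have key : SemisimpleSection (comapIdeal φ ψ h J ⊓ radSeries L k) (radSeries L k) := by
      refine ⟨inf_le_right, fun Q hQ hQk => ?_⟩
      obtain ⟨Q', hJQ, -, hi, hs⟩ := hJ.2 (mapIdeal φ ψ hψ h Q ⊔ J) le_sup_right
        (sup_le (by rintro _ ⟨y, hy, rfl⟩; exact ih y (hQk hy)) hJ.1)
      refine ⟨comapIdeal φ ψ h Q' ⊓ radSeries L k, ?_, inf_le_right, le_antisymm ?_ ?_,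
        le_antisymm (sup_le hQk inf_le_right) ?_⟩
      · rintro y ⟨hy, hyk⟩
        exact ⟨hJQ hy, hyk⟩
      · rintro y ⟨hy, hy', hyk⟩
        refine ⟨?_, hyk⟩
        change φ y ∈ J
        rw [← hi, LieSubmodule.mem_inf]
        exact ⟨le_sup_left (a := mapIdeal φ ψ hψ h Q) ⟨y, hy, rfl⟩, hy'⟩
      · rintro y ⟨hy, hyk⟩
        exact ⟨hQ ⟨hy, hyk⟩, hJQ hy, hyk⟩
      · intro y hy
        have := ih y hy
        rw [← hs, LieSubmodule.mem_sup] at this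
        obtain ⟨w, hw, q', hq', e⟩ := this
        rw [LieSubmodule.mem_sup] at hw
        obtain ⟨_, ⟨q, hq, rfl⟩, j, hj, rfl⟩ := hw
        rw [LieSubmodule.mem_sup]
        refine ⟨q, hq, y - q, ⟨?_, sub_mem hy (hQk hq)⟩, by abel⟩
        change φ (y - q) ∈ Q'
        rw [map_sub, ← e]
        have : φ q + j + q' - φ q = j + q' := by abel
        rw [this]
        exact add_mem (hJQ hj) hq'
    have hle : radSeries L (k + 1) ≤ comapIdeal φ ψ h J ⊓ radSeries L k := sInf_le key
    exact (hle hx).1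

/-- The image of R_{k+1}(L) has semi-simple quotient in R_k(L'): pull submodules back, complement
them modulo R_{k+1}(L), and push forward. So R_{k+1}(L') is contained in that image. -/
theorem exists_mem_radSeries [FiniteDimensional ℝ L] (φ : L →ₗ[ℝ] L') (ψ : L → L')
    (hψ : Function.Surjective ψ) (h : ∀ x y, φ ⁅x, y⁆ = ⁅ψ x, φ y⁆)
    (hφ : Function.Surjective φ) (k : ℕ) :
    ∀ y ∈ radSeries L' k, ∃ x ∈ radSeries L k, φ x = y := by
  induction k with
  | zero =>
    intro y _
    obtain ⟨x, rfl⟩ := hφ y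
    exact ⟨x, LieSubmodule.mem_top _, rfl⟩
  | succ k ih =>
    have key : SemisimpleSection (mapIdeal φ ψ hψ h (radSeries L (k + 1))) (radSeries L' k) := by
      have hss := semisimpleSection_radSeries (L := L) k
      refine ⟨?_, fun Q hQ hQk => ?_⟩
      · rintro _ ⟨y, hy, rfl⟩
        exact map_mem_radSeries φ ψ hψ h k y (hss.1 hy)
      · obtain ⟨Q', hJQ, hQ'k, hi, hs⟩ := hss.2 (comapIdeal φ ψ h Q ⊓ radSeries L k)
          (fun y hy => ⟨hQ ⟨y, hy, rfl⟩, hss.1 hy⟩) inf_le_right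
        refine ⟨mapIdeal φ ψ hψ h Q', ?_, ?_, le_antisymm ?_ (le_inf hQ ?_),
          le_antisymm (sup_le hQk ?_) ?_⟩
        · rintro _ ⟨y, hy, rfl⟩
          exact ⟨y, hJQ hy, rfl⟩
        · rintro _ ⟨y, hy, rfl⟩
          exact map_mem_radSeries φ ψ hψ h k y (hQ'k hy)
        · rintro _ ⟨hy, y, hy', rfl⟩
          have : y ∈ radSeries L (k + 1) := by
            rw [← hi, LieSubmodule.mem_inf]
            exact ⟨⟨hy, hQ'k hy'⟩, hy'⟩
          exact ⟨y, this, rfl⟩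
        · rintro _ ⟨y, hy, rfl⟩
          exact ⟨y, hJQ hy, rfl⟩
        · rintro _ ⟨y, hy, rfl⟩
          exact map_mem_radSeries φ ψ hψ h k y (hQ'k hy)
        · intro y hy
          obtain ⟨x, hx, rfl⟩ := ih y hy
          rw [← hs, LieSubmodule.mem_sup] at hx
          obtain ⟨q, ⟨hq, -⟩, q', hq', rfl⟩ := hx
          rw [LieSubmodule.mem_sup]
          exact ⟨φ q, hq, φ q', ⟨q', hq', rfl⟩, (map_add φ q q').symm⟩
    intro y hy
    exact (sInf_le key : radSeries L' (k + 1) ≤ _) hy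

/-- Every ideal of dimension at most one is contained in the socle. -/
theorem le_socle_of_forall_smul {K : L} (I : LieIdeal ℝ L)
    (hI : ∀ y ∈ I, ∃ t : ℝ, t • K = y) : I ≤ socle L := by
  refine le_sSup ⟨bot_le, fun Q _ hQI => ?_⟩
  by_cases hQ : Q = ⊥
  · exact ⟨I, bot_le, le_rfl, by rw [hQ, bot_inf_eq], by rw [hQ, bot_sup_eq]⟩
  · refine ⟨⊥, le_rfl, bot_le, inf_bot_eq _, ?_⟩
    rw [sup_bot_eq]
    refine le_antisymm hQI fun y hy => ?_
    obtain ⟨t, rfl⟩ := hI y hy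
    obtain ⟨z, hz, hz0⟩ : ∃ z ∈ Q, z ≠ 0 := by
      by_contra hn
      push Not at hn
      exact hQ ((LieSubmodule.eq_bot_iff _).2 hn)
    obtain ⟨s, rfl⟩ := hI z (hQI hz)
    have hs : s ≠ 0 := by rintro rfl; exact hz0 (zero_smul _ _)
    have : t • K = (t * s⁻¹) • s • K := by rw [smul_smul, mul_assoc, inv_mul_cancel₀ hs, mul_one]
    rw [this]
    exact Q.smul_mem _ hz

end RadSeries

/-! ### Symmetric triples -/

section Metric

theorem LieInv.mem_plus {l : LieInv.{u}} {x : l} : x ∈ l.plus ↔ l.θ x = x := Iff.rfl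

theorem LieInv.mem_minus {l : LieInv.{u}} {x : l} : x ∈ l.minus ↔ l.θ x = -x := Iff.rfl

theorem LieInv.half_add_mem_plus (l : LieInv.{u}) (x : l) : (1 / 2 : ℝ) • (x + l.θ x) ∈ l.plus := by
  rw [LieInv.mem_plus, map_smul, map_add, l.θ_θ, add_comm]

theorem LieInv.half_sub_mem_minus (l : LieInv.{u}) (x : l) :
    (1 / 2 : ℝ) • (x - l.θ x) ∈ l.minus := by
  rw [LieInv.mem_minus, map_smul, map_sub, l.θ_θ, ← smul_neg, neg_sub]

theorem LieInv.half_add_half (l : LieInv.{u}) (x : l) :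
    (1 / 2 : ℝ) • (x + l.θ x) + (1 / 2 : ℝ) • (x - l.θ x) = x := by
  module

theorem LieInv.exists_plus_minus (l : LieInv.{u}) (x : l) :
    ∃ y ∈ l.plus, ∃ z ∈ l.minus, x = y + z :=
  ⟨_, l.half_add_mem_plus x, _, l.half_sub_mem_minus x, (l.half_add_half x).symm⟩

theorem LieInv.lie_mem_plus {l : LieInv.{u}} {x y : l} (hx : x ∈ l.minus) (hy : y ∈ l.minus) :
    ⁅x, y⁆ ∈ l.plus := by
  rw [LieInv.mem_minus] at hx hy
  rw [LieInv.mem_plus, LieHom.map_lie, hx, hy, neg_lie, lie_neg, neg_neg]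

theorem LieInv.lie_mem_minus {l : LieInv.{u}} {x y : l} (hx : x ∈ l.minus) (hy : y ∈ l.plus) :
    ⁅x, y⁆ ∈ l.minus := by
  rw [LieInv.mem_minus] at hx ⊢
  rw [LieInv.mem_plus] at hy
  rw [LieHom.map_lie, hx, hy, neg_lie]

/-- The eigenspaces of the involution are orthogonal. -/
theorem MetricLieInv.form_plus_minus (g : MetricLieInv.{u}) {x y : g.carrier}
    (hx : x ∈ g.toLieInv.plus) (hy : y ∈ g.toLieInv.minus) : g.form x y = 0 := by
  have h := g.θ_isom x y
  rw [LieInv.mem_plus.1 hx, LieInv.mem_minus.1 hy, map_neg] at h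
  linarith

/-- In a metric Lie algebra with involution, faithfulness of `g₊` on `g₋` implies
`[g₋, g₋] = g₊`. -/
theorem MetricLieInv.isSymmetricTriple_of_faithful (g : MetricLieInv.{u})
    (hf : g.toLieInv.FaithfulOnMinus) : g.IsSymmetricTriple := by
  refine ⟨le_antisymm ?_ ?_, hf⟩
  · rw [Submodule.span_le]
    rintro _ ⟨x, hx, y, hy, rfl⟩
    exact LieInv.lie_mem_plus hx hy
  · intro v hv
    by_contra hn
    obtain ⟨φ, hφv, hφ⟩ := Submodule.exists_le_ker_of_notMem hn
    have hnd : g.form.Nondegenerate := by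
      refine LinearMap.BilinForm.nondegenerate_iff_ker_eq_bot.2 ?_
      refine LinearMap.ker_eq_bot'.2 fun x hx => g.form_nondeg x fun y => ?_
      rw [hx, LinearMap.zero_apply]
    obtain ⟨w, rfl⟩ := (LinearMap.BilinForm.toDual g.form hnd).surjective φ
    have hw (y : g.carrier) : LinearMap.BilinForm.toDual g.form hnd w y = g.form w y :=
      LinearMap.BilinForm.toDual_def hnd
    obtain ⟨w₁, hw₁, w₂, hw₂, rfl⟩ := g.toLieInv.exists_plus_minus w
    have h₂ (y : g.carrier) (hy : y ∈ g.toLieInv.plus) : g.form w₂ y = 0 := by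
      rw [g.form_symm, g.form_plus_minus hy hw₂]
    -- The separating functional is ⟨w, ·⟩, and w₁ is the part of w in g₊. It is orthogonal to [g₋,
    -- g₋], so invariance makes [x, w₁] orthogonal to everything for x ∈ g₋, and faithfulness
    -- applies.
    have h0 : w₁ = 0 := by
      refine hf w₁ hw₁ fun x hx => ?_
      rw [← neg_eq_zero, lie_skew]
      refine g.form_nondeg _ fun y => ?_
      obtain ⟨y₁, hy₁, y₂, hy₂, rfl⟩ := g.toLieInv.exists_plus_minus y
      have e₁ : g.form ⁅x, w₁⁆ y₁ = 0 := by
        rw [g.form_symm]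
        exact g.form_plus_minus hy₁ (LieInv.lie_mem_minus hx hw₁)
      have e₂ : g.form w₁ ⁅x, y₂⁆ = 0 := by
        have := LinearMap.mem_ker.1 (hφ (Submodule.subset_span ⟨x, hx, y₂, hy₂, rfl⟩))
        rw [hw, map_add, LinearMap.add_apply, h₂ _ (LieInv.lie_mem_plus hx hy₂), add_zero] at this
        exact this
      have := g.form_inv x w₁ y₂
      rw [map_add, e₁]
      linarith
    apply hφv
    rw [hw, map_add, h0, map_zero, LinearMap.add_apply, h₂ v hv, LinearMap.zero_apply, add_zero]

theorem MetricLieInv.IsIsomorphic.symm {g h : MetricLieInv.{u}} (e : g.IsIsomorphic h) :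
    h.IsIsomorphic g := by
  obtain ⟨Ψ, hθ, hf⟩ := e
  refine ⟨Ψ.symm, fun x => ?_, fun x y => ?_⟩
  · apply Ψ.injective
    change Ψ _ = Ψ _
    rw [hθ, LieEquiv.apply_symm_apply, LieEquiv.apply_symm_apply]
  · rw [← hf, LieEquiv.apply_symm_apply, LieEquiv.apply_symm_apply]

theorem MetricLieInv.IsIsomorphic.trans {g h k : MetricLieInv.{u}} (e : g.IsIsomorphic h)
    (e' : h.IsIsomorphic k) : g.IsIsomorphic k := by
  obtain ⟨Ψ, hθ, hf⟩ := e
  obtain ⟨Ψ', hθ', hf'⟩ := e'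
  exact ⟨Ψ.trans Ψ', fun x => by simp [hθ, hθ'], fun x y => by simp [hf, hf']⟩

theorem MetricLieInv.IsIsomorphic.isSymmetricTriple {g h : MetricLieInv.{u}}
    (e : g.IsIsomorphic h) (hg : g.IsSymmetricTriple) : h.IsSymmetricTriple := by
  obtain ⟨Ψ, hθ, hf⟩ := e.symm
  refine h.isSymmetricTriple_of_faithful fun x hx hxy => ?_
  have h0 : Ψ x = 0 := by
    refine hg.2 _ ?_ fun y hy => ?_
    · rw [LieInv.mem_plus, ← hθ, LieInv.mem_plus.1 hx]
    · obtain ⟨y, rfl⟩ := Ψ.surjective y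
      change Ψ y ∈ _ at hy
      change ⁅Ψ x, Ψ y⁆ = 0
      rw [← LieEquiv.map_lie, hxy y, map_zero]
      rw [LieInv.mem_minus, ← hθ, ← map_neg] at hy
      exact Ψ.injective hy
  exact Ψ.injective (h0.trans (map_zero Ψ).symm)

/-- Only faithfulness has to be restricted to the summands; the bracket condition follows from it.
-/
theorem MetricLieInv.isSymmetricTriple_of_prod {g₁ g₂ : MetricLieInv.{u}}
    (h : (g₁.prod g₂).IsSymmetricTriple) : g₁.IsSymmetricTriple ∧ g₂.IsSymmetricTriple := by
  constructor
  · refine g₁.isSymmetricTriple_of_faithful fun x hx hxy => ?_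
    have h0 := h.2 ((x, 0) : g₁.carrier × g₂.carrier) (Prod.ext hx (map_zero g₂.θ))
      fun y hy => Prod.ext (hxy y.1 (congrArg Prod.fst hy)) (zero_lie y.2)
    exact congrArg Prod.fst h0
  · refine g₂.isSymmetricTriple_of_faithful fun x hx hxy => ?_
    have h0 := h.2 ((0, x) : g₁.carrier × g₂.carrier) (Prod.ext (map_zero g₁.θ) hx)
      fun y hy => Prod.ext (zero_lie y.1) (hxy y.2 (congrArg Prod.snd hy))
    exact congrArg Prod.snd h0

end Metric

/-! ### Equivalent cocycles -/

section Equivalence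

variable {l : LieInv.{u}} {a : OrthMod.{u, v} l}

theorem OrthMod.form_lie (a : OrthMod.{u, v} l) (x : l) (A B : a) :
    a.form ⁅x, A⁆ B = - a.form A ⁅x, B⁆ := by
  linarith [a.form_inv x A B]

theorem alternating_swap {l : LieInv.{u}} {σ : l →ₗ[ℝ] l →ₗ[ℝ] ℝ} (h : ∀ x, σ x x = 0) (x y : l) :
    σ x y = - σ y x := by
  have h' := h (x + y)
  simp only [map_add, LinearMap.add_apply, h, zero_add, add_zero] at h'
  linarith

/-- The map `Z + A + L ↦ (Z - ⟨A, τ⟩ + σ(L, ·) - ½ ⟨τ(L), τ⟩) + (A + τ(L)) + L` between standard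
models. -/
noncomputable def shear (c c' : QuadCocycle a) (τ : l →ₗ[ℝ] a) (σ : l →ₗ[ℝ] l →ₗ[ℝ] ℝ) :
    StdModel c' →ₗ[ℝ] StdModel c where
  toFun X := ⟨X.Z - a.form X.A ∘ₗ τ + σ X.L - (1 / 2 : ℝ) • a.form (τ X.L) ∘ₗ τ, X.A + τ X.L, X.L⟩
  map_add' X Y := StdModel.ext (by ext x; simp; ring) (by simp; abel) rfl
  map_smul' t X := StdModel.ext (by ext x; simp; ring) (by simp) rfl

theorem shear_Z (c c' : QuadCocycle a) (τ : l →ₗ[ℝ] a) (σ : l →ₗ[ℝ] l →ₗ[ℝ] ℝ) (X : StdModel c')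
    (x : l) : (shear c c' τ σ X).Z x =
      X.Z x - a.form X.A (τ x) + σ X.L x - (1 / 2) * a.form (τ X.L) (τ x) := rfl

theorem shear_A (c c' : QuadCocycle a) (τ : l →ₗ[ℝ] a) (σ : l →ₗ[ℝ] l →ₗ[ℝ] ℝ) (X : StdModel c') :
    (shear c c' τ σ X).A = X.A + τ X.L := rfl

theorem shear_L (c c' : QuadCocycle a) (τ : l →ₗ[ℝ] a) (σ : l →ₗ[ℝ] l →ₗ[ℝ] ℝ) (X : StdModel c') :
    (shear c c' τ σ X).L = X.L := rfl

/-- The cross term ⟨τ(L), τ⟩ of the composition absorbs the two quadratic terms ½ ⟨τ(L), τ⟩. -/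
theorem shear_shear_neg (c c' : QuadCocycle a) (τ : l →ₗ[ℝ] a) (σ : l →ₗ[ℝ] l →ₗ[ℝ] ℝ)
    (X : StdModel c) : shear c c' τ σ (shear c' c (-τ) (-σ) X) = X := by
  refine StdModel.ext (LinearMap.ext fun x => ?_) ?_ ?_
  · simp only [shear_Z, shear_A, shear_L, LinearMap.neg_apply, map_neg, map_add,
      LinearMap.add_apply]
    ring
  · simp only [shear_A, shear_L, LinearMap.neg_apply]
    abel
  · rfl

theorem shear_neg_shear (c c' : QuadCocycle a) (τ : l →ₗ[ℝ] a) (σ : l →ₗ[ℝ] l →ₗ[ℝ] ℝ)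
    (X : StdModel c') : shear c' c (-τ) (-σ) (shear c c' τ σ X) = X := by
  have := shear_shear_neg c' c (-τ) (-σ) X
  rwa [neg_neg τ, neg_neg σ] at this

/-- The term -⟨A, τ⟩ cancels the mixed products of A with τ(L), the two halves -½ ⟨τ(L), τ⟩ cancel
⟨τ(L₁), τ(L₂)⟩, and σ cancels because it is alternating. -/
theorem form_shear {c c' : QuadCocycle a} {τ : l →ₗ[ℝ] a} {σ : l →ₗ[ℝ] l →ₗ[ℝ] ℝ}
    (hσ : ∀ x, σ x x = 0) (X Y : StdModel c') :
    StdModel.form c (shear c c' τ σ X) (shear c c' τ σ Y) = StdModel.form c' X Y := by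
  simp only [StdModel.form_apply, shear_Z, shear_A, shear_L, map_add, LinearMap.add_apply]
  rw [alternating_swap hσ X.L Y.L, a.form_symm (τ X.L) Y.A, a.form_symm (τ X.L) (τ Y.L)]
  ring

theorem shear_θ {c c' : QuadCocycle a} {τ : l →ₗ[ℝ] a} {σ : l →ₗ[ℝ] l →ₗ[ℝ] ℝ}
    (hτθ : ∀ x, a.θ (τ (l.θ x)) = τ x) (hσθ : ∀ x y, σ (l.θ x) (l.θ y) = σ x y)
    (X : StdModel c') :
    shear c c' τ σ (StdModel.θ c' X) = StdModel.θ c (shear c c' τ σ X) := by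
  have hτ (x : l) : τ (l.θ x) = a.θ (τ x) := by rw [← hτθ x, a.θ_θ]
  refine StdModel.ext (LinearMap.ext fun x => ?_) ?_ rfl
  · change X.Z (l.θ x) - a.form (a.θ X.A) (τ x) + σ (l.θ X.L) x -
      (1 / 2) * a.form (τ (l.θ X.L)) (τ x) = X.Z (l.θ x) - a.form X.A (τ (l.θ x)) + σ X.L (l.θ x) -
      (1 / 2) * a.form (τ X.L) (τ (l.θ x))
    rw [← hσθ X.L, l.θ_θ, hτ, hτ, ← a.θ_isom X.A, ← a.θ_isom (τ X.L), a.θ_θ]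
  · change a.θ X.A + τ (l.θ X.L) = a.θ (X.A + τ X.L)
    rw [map_add, hτ]

theorem shear_lie {c c' : QuadCocycle a} {τ : l →ₗ[ℝ] a} {σ : l →ₗ[ℝ] l →ₗ[ℝ] ℝ}
    (hσ : ∀ x, σ x x = 0)
    (hα : ∀ x y, c'.α x y = c.α x y + dOne a τ x y)
    (hγ : ∀ x y z, c'.γ x y z = c.γ x y z + dTwoTriv σ x y z +
      wedgeTwoOne a (fun x y => c.α x y + (1 / 2 : ℝ) • dOne a τ x y) τ x y z)
    (X Y : StdModel c') :
    shear c c' τ σ ⁅X, Y⁆ = ⁅shear c c' τ σ X, shear c c' τ σ Y⁆ := by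
  obtain ⟨Z₁, A₁, x⟩ := X
  obtain ⟨Z₂, A₂, y⟩ := Y
  refine StdModel.ext (LinearMap.ext fun z => ?_) ?_ rfl
  · simp only [shear_Z, shear_A, shear_L, StdModel.lie_Z, StdModel.lie_A, StdModel.lie_L, hα, hγ,
      dTwoTriv, wedgeTwoOne, dOne, map_add, map_sub, map_smul, LinearMap.add_apply,
      LinearMap.sub_apply, LinearMap.smul_apply, smul_eq_mul, lie_add, a.form_lie]
    have hs := a.form_symm
    rw [alternating_swap hσ ⁅x, z⁆ y, alternating_swap hσ ⁅y, z⁆ x]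
    have j (u v : a) (w : l) : a.form u ⁅w, v⁆ + a.form v ⁅w, u⁆ = 0 := by
      rw [hs v, a.form_lie]; ring
    rw [hs (c.α x z), hs (c.α y z), hs (τ ⁅x, z⁆), hs (τ ⁅y, z⁆)]
    linear_combination -j A₁ (τ y) z + (1 / 2) * j (τ z) (τ y) x - (1 / 2) * j (τ x) (τ z) y -
      (1 / 2) * j (τ x) (τ y) z
  · simp only [shear_A, shear_L, StdModel.lie_A, StdModel.lie_L, hα, dOne, lie_add]
    abel

end Equivalence

/-! ### The action of quadratic 1-cochains on cocycles -/

section Action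

variable {l : LieInv.{u}} {a : OrthMod.{u, v} l}

theorem QuadCocycle.Equiv.isIsomorphic {c c' : QuadCocycle a} (h : c.Equiv c') :
    (stdModel c').IsIsomorphic (stdModel c) := by
  obtain ⟨τ, σ, hτθ, hσ, hσθ, hα, hγ⟩ := h
  let Ψ : StdModel c' ≃ₗ⁅ℝ⁆ StdModel c :=
    { shear c c' τ σ with
      map_lie' := fun {X Y} => shear_lie hσ hα hγ X Y
      invFun := shear c' c (-τ) (-σ)
      left_inv := shear_neg_shear c c' τ σ
      right_inv := shear_shear_neg c c' τ σ }
  exact ⟨Ψ, fun X => shear_θ hτθ hσθ X, fun X Y => form_shear hσ X Y⟩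

theorem lie_lie_sub_add {L : Type u} [LieRing L] (x y z : L) :
    ⁅⁅x, y⁆, z⁆ - ⁅⁅x, z⁆, y⁆ + ⁅⁅y, z⁆, x⁆ = 0 := by
  rw [lie_lie x y z, ← lie_skew ⁅x, z⁆ y, ← lie_skew ⁅y, z⁆ x]
  abel

/-- The differential of a 1-cochain as a bilinear map. -/
def dOneBilin (τ : l →ₗ[ℝ] a) : l →ₗ[ℝ] l →ₗ[ℝ] a :=
  LinearMap.mk₂ ℝ (dOne a τ)
    (fun x y z => by simp only [dOne, add_lie, lie_add, map_add]; abel)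
    (fun t x y => by simp only [dOne, smul_lie, lie_smul, map_smul, smul_sub])
    (fun x y z => by simp only [dOne, add_lie, lie_add, map_add]; abel)
    (fun t x y => by simp only [dOne, smul_lie, lie_smul, map_smul, smul_sub])

theorem dOneBilin_apply (τ : l →ₗ[ℝ] a) (x y : l) : dOneBilin τ x y = dOne a τ x y := rfl

theorem dOne_self (τ : l →ₗ[ℝ] a) (x : l) : dOne a τ x x = 0 := by
  simp [dOne]

theorem dTwo_dOneBilin (τ : l →ₗ[ℝ] a) (x y z : l) : dTwo a (dOneBilin τ) x y z = 0 := by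
  have h := congrArg τ (lie_lie_sub_add x y z)
  simp only [map_add, map_sub, map_zero] at h
  simp only [dTwo, dOneBilin_apply, dOne, lie_sub]
  refine Eq.trans ?_ h
  simp only [lie_lie x y (τ z), lie_lie x z (τ y), lie_lie y z (τ x)]
  abel

theorem dTwo_add (β β' : l →ₗ[ℝ] l →ₗ[ℝ] a) (x y z : l) :
    dTwo a (β + β') x y z = dTwo a β x y z + dTwo a β' x y z := by
  simp only [dTwo, LinearMap.add_apply, lie_add]; abel

theorem dTwo_smul (t : ℝ) (β : l →ₗ[ℝ] l →ₗ[ℝ] a) (x y z : l) :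
    dTwo a (t • β) x y z = t • dTwo a β x y z := by
  simp only [dTwo, LinearMap.smul_apply, lie_smul, smul_add, smul_sub]

/-- The differential of `⟨β ∧ τ⟩` for a closed 2-form `β` is `⟨β ∧ dτ⟩`. -/
theorem d_wedgeTwoOne {β : l →ₗ[ℝ] l →ₗ[ℝ] a} (hβ : ∀ x y z, dTwo a β x y z = 0)
    (τ : l →ₗ[ℝ] a) (x y z w : l) :
    - wedgeTwoOne a (fun x y => β x y) τ ⁅x, y⁆ z w + wedgeTwoOne a (fun x y => β x y) τ ⁅x, z⁆ y w
      - wedgeTwoOne a (fun x y => β x y) τ ⁅x, w⁆ y z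
      - wedgeTwoOne a (fun x y => β x y) τ ⁅y, z⁆ x w
      + wedgeTwoOne a (fun x y => β x y) τ ⁅y, w⁆ x z
      - wedgeTwoOne a (fun x y => β x y) τ ⁅z, w⁆ x y =
    wedgeTwoTwo a (fun x y => β x y) (dOne a τ) x y z w := by
  have h₁ := congrArg (a.form (τ w)) (hβ x y z)
  have h₂ := congrArg (a.form (τ z)) (hβ x y w)
  have h₃ := congrArg (a.form (τ y)) (hβ x z w)
  have h₄ := congrArg (a.form (τ x)) (hβ y z w)
  simp only [dTwo, map_add, map_sub, map_zero] at h₁ h₂ h₃ h₄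
  have j (u v : a) (w : l) : a.form u ⁅w, v⁆ = - a.form v ⁅w, u⁆ := by
    rw [a.form_symm v, a.form_lie]; ring
  simp only [wedgeTwoOne, wedgeTwoTwo, dOne, map_sub]
  simp only [j (β _ _), a.form_symm (β _ _)]
  linear_combination h₁ - h₂ + h₃ - h₄

theorem wedgeTwoTwo_comm {β β' : l → l → a} (x y z w : l) :
    wedgeTwoTwo a β β' x y z w = wedgeTwoTwo a β' β x y z w := by
  simp only [wedgeTwoTwo, a.form_symm (β _ _)]
  ring

/-- The section `L ↦ L + τ(L) + (σ(L, ·) - ½ ⟨τ(L), τ⟩)`. -/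
noncomputable def shearSection (c : QuadCocycle a) (τ : l →ₗ[ℝ] a) (σ : l →ₗ[ℝ] l →ₗ[ℝ] ℝ) :
    l →ₗ[ℝ] StdModel c where
  toFun x := ⟨σ x - (1 / 2 : ℝ) • a.form (τ x) ∘ₗ τ, τ x, x⟩
  map_add' X Y := StdModel.ext (by ext x; simp; ring) (by simp) rfl
  map_smul' t X := StdModel.ext (by ext x; simp; ring) (by simp) rfl

/-- This expresses the transformed 3-form as ⟨[s(x), s(y)], s(z)⟩ for the section s. Its
trilinearity, alternation and θ-invariance then come from the metric Lie algebra, and compatibility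
of the new form with a centroid element can be read off. -/
theorem form_lie_shearSection (c : QuadCocycle a) (τ : l →ₗ[ℝ] a) {σ : l →ₗ[ℝ] l →ₗ[ℝ] ℝ}
    (hσ : ∀ x, σ x x = 0) (x y z : l) :
    StdModel.form c ⁅shearSection c τ σ x, shearSection c τ σ y⁆ (shearSection c τ σ z) =
      c.γ x y z + dTwoTriv σ x y z +
      wedgeTwoOne a (fun x y => c.α x y + (1 / 2 : ℝ) • dOne a τ x y) τ x y z := by
  change StdModel.form c ⁅(⟨_, τ x, x⟩ : StdModel c), (⟨_, τ y, y⟩ : StdModel c)⁆ ⟨_, τ z, z⟩ = _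
  simp only [StdModel.form_apply, StdModel.lie_Z, StdModel.lie_A, StdModel.lie_L, dTwoTriv,
    wedgeTwoOne, dOne, map_add, map_sub, map_smul, LinearMap.add_apply, LinearMap.sub_apply,
    LinearMap.smul_apply, smul_eq_mul, LinearMap.comp_apply, a.form_lie]
  have hs := a.form_symm
  have j (u v : a) (w : l) : a.form u ⁅w, v⁆ + a.form v ⁅w, u⁆ = 0 := by
    rw [hs v, a.form_lie]; ring
  rw [alternating_swap hσ z, alternating_swap hσ ⁅x, z⁆ y, alternating_swap hσ ⁅y, z⁆ x,
    hs (c.α x z), hs (c.α y z), hs (τ ⁅x, y⁆), hs (τ ⁅x, z⁆), hs (τ ⁅y, z⁆)]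
  linear_combination -(1 / 2) * j (τ z) (τ y) x + (1 / 2) * j (τ x) (τ z) y +
      (1 / 2) * j (τ x) (τ y) z

/-- The action of the invariant quadratic 1-cochain `(τ, σ)` on a cocycle. -/
noncomputable def QuadCocycle.act (c : QuadCocycle a) (τ : l →ₗ[ℝ] a) (σ : l →ₗ[ℝ] l →ₗ[ℝ] ℝ)
    (hτθ : ∀ x, a.θ (τ (l.θ x)) = τ x) (hσ : ∀ x, σ x x = 0)
    (hσθ : ∀ x y, σ (l.θ x) (l.θ y) = σ x y) : QuadCocycle a where
  α := c.α + dOneBilin τ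
  γ := LinearMap.mk₂ ℝ (fun x y => StdModel.form c
      ⁅shearSection c τ σ x, shearSection c τ σ y⁆ ∘ₗ shearSection c τ σ)
    (fun x y z => by ext; simp) (fun t x y => by ext; simp)
    (fun x y z => by ext; simp) (fun t x y => by ext; simp)
  α_self := fun x => by simp [c.α_self, dOneBilin_apply, dOne_self]
  γ_self_left := fun x y => by simp
  γ_self_right := fun x y => by
    -- By invariance ⟨[X, Y], Y⟩ equals its own negative.
    have h := (stdModel c).form_inv (shearSection c τ σ x) (shearSection c τ σ y)
      (shearSection c τ σ y)
    rw [(stdModel c).form_symm (shearSection c τ σ y)] at h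
    have h' : StdModel.form c ⁅shearSection c τ σ x, shearSection c τ σ y⁆ (shearSection c τ σ y) +
      StdModel.form c ⁅shearSection c τ σ x, shearSection c τ σ y⁆ (shearSection c τ σ y) = 0 := h
    rw [LinearMap.mk₂_apply, LinearMap.comp_apply]
    linarith
  dα := fun x y z => by rw [dTwo_add, c.dα, dTwo_dOneBilin, add_zero]
  dγ := fun x y z w => by
    -- With the closed form β = α + ½ dτ one has d⟨β ∧ τ⟩ = ⟨β ∧ dτ⟩ = ⟨α ∧ dτ⟩ + ½ ⟨dτ ∧ dτ⟩. This
    -- is exactly the increment of ½ ⟨α ∧ α⟩ when α is replaced by α + dτ, and d(dσ) = 0.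
    have hβ : ∀ x y z, dTwo a (c.α + (1 / 2 : ℝ) • dOneBilin τ) x y z = 0 := fun x y z => by
      rw [dTwo_add, dTwo_smul, c.dα, dTwo_dOneBilin, smul_zero, add_zero]
    have h₁ := d_wedgeTwoOne hβ τ x y z w
    have h₂ := c.dγ x y z w
    have h₃ : wedgeTwoTwo a (fun x y => (c.α + (1 / 2 : ℝ) • dOneBilin τ) x y) (dOne a τ) x y z w =
        wedgeTwoTwo a (fun x y => c.α x y) (dOne a τ) x y z w +
          (1 / 2) * wedgeTwoTwo a (dOne a τ) (dOne a τ) x y z w := by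
      simp only [wedgeTwoTwo, LinearMap.add_apply, LinearMap.smul_apply, dOneBilin_apply, map_add,
        map_smul, smul_eq_mul]
      ring
    have h₄ : wedgeTwoTwo a (fun x y => (c.α + dOneBilin τ) x y)
        (fun x y => (c.α + dOneBilin τ) x y) x y z w =
        wedgeTwoTwo a (fun x y => c.α x y) (fun x y => c.α x y) x y z w +
        2 * wedgeTwoTwo a (fun x y => c.α x y) (dOne a τ) x y z w +
        wedgeTwoTwo a (dOne a τ) (dOne a τ) x y z w := by
      have := wedgeTwoTwo_comm (β := fun x y => c.α x y) (β' := dOne a τ) x y z w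
      rw [two_mul]
      nth_rw 2 [this]
      simp only [wedgeTwoTwo, LinearMap.add_apply, dOneBilin_apply, map_add]
      ring
    have h₅ : - dTwoTriv σ ⁅x, y⁆ z w + dTwoTriv σ ⁅x, z⁆ y w - dTwoTriv σ ⁅x, w⁆ y z
        - dTwoTriv σ ⁅y, z⁆ x w + dTwoTriv σ ⁅y, w⁆ x z - dTwoTriv σ ⁅z, w⁆ x y = 0 := by
      have J (p q r s : l) : σ ⁅⁅p, q⁆, r⁆ s - σ ⁅⁅p, r⁆, q⁆ s + σ ⁅⁅q, r⁆, p⁆ s = 0 := by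
        rw [← LinearMap.sub_apply, ← LinearMap.add_apply, ← map_sub, ← map_add, lie_lie_sub_add,
          map_zero, LinearMap.zero_apply]
      simp only [dTwoTriv]
      rw [alternating_swap hσ ⁅z, w⁆ ⁅x, y⁆, alternating_swap hσ ⁅y, w⁆ ⁅x, z⁆,
        alternating_swap hσ ⁅y, z⁆ ⁅x, w⁆]
      linear_combination J x y z w - J x y w z + J x z w y - J y z w x
    rw [h₄]
    rw [h₃] at h₁
    simp only [dThreeTriv, LinearMap.mk₂_apply, LinearMap.comp_apply,
      form_lie_shearSection c τ hσ] at h₂ ⊢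
    simp only [LinearMap.add_apply, LinearMap.smul_apply, dOneBilin_apply] at h₁
    linear_combination h₁ + h₂ + h₅
  α_θ := fun x y => by
    have hτ (x : l) : τ (l.θ x) = a.θ (τ x) := by rw [← hτθ x, a.θ_θ]
    have hl (x : l) (A : a) : a.θ ⁅l.θ x, a.θ A⁆ = ⁅x, A⁆ := by rw [a.θ_lie, a.θ_θ]
    simp only [LinearMap.add_apply, dOneBilin_apply, dOne, map_add, map_sub, c.α_θ, hτ, hl,
      ← LieHom.map_lie, a.θ_θ]
  γ_θ := fun x y z => by
    have hθ (x : l) : shearSection c τ σ (l.θ x) = StdModel.θ c (shearSection c τ σ x) := by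
      have hτ (x : l) : τ (l.θ x) = a.θ (τ x) := by rw [← hτθ x, a.θ_θ]
      refine StdModel.ext (LinearMap.ext fun y => ?_) (hτ x) rfl
      change σ (l.θ x) y - (1 / 2) * a.form (τ (l.θ x)) (τ y) =
        σ x (l.θ y) - (1 / 2) * a.form (τ x) (τ (l.θ y))
      rw [← hσθ x, l.θ_θ, hτ, hτ, ← a.θ_isom (τ x), a.θ_θ]
    simp only [LinearMap.mk₂_apply, LinearMap.comp_apply, hθ, ← LieHom.map_lie]
    exact (stdModel c).θ_isom _ _

theorem QuadCocycle.equiv_act (c : QuadCocycle a) (τ : l →ₗ[ℝ] a) (σ : l →ₗ[ℝ] l →ₗ[ℝ] ℝ)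
    (hτθ : ∀ x, a.θ (τ (l.θ x)) = τ x) (hσ : ∀ x, σ x x = 0)
    (hσθ : ∀ x y, σ (l.θ x) (l.θ y) = σ x y) : c.Equiv (c.act τ σ hτθ hσ hσθ) :=
  ⟨τ, σ, hτθ, hσ, hσθ, fun _ _ => rfl, fun x y z => form_lie_shearSection c τ hσ x y z⟩

end Action

/-! ### Semi-simple orthogonal modules -/

section Semisimple

variable {l : LieInv.{u}} {a : OrthMod.{u, v} l}

theorem OrthMod.mem_invariants {A : a} : A ∈ a.invariants ↔ ∀ x : l, ⁅x, A⁆ = 0 :=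
  LieModule.mem_maxTrivSubmodule ℝ l a A

theorem OrthMod.form_eq_zero_of_mem_actionSpan {A B : a} (hA : ∀ x : l, ⁅x, A⁆ = 0)
    (hB : B ∈ a.actionSpan) : a.form A B = 0 := by
  have : a.actionSpan ≤ LinearMap.ker (a.form A) := by
    refine Submodule.span_le.2 ?_
    rintro _ ⟨x, B, rfl⟩
    have h := a.form_inv x A B
    rw [hA, map_zero, LinearMap.zero_apply, zero_add] at h
    exact h
  exact this hB

/-- A submodule `b` of a semi-simple module is the sum of its invariants and `ρ(l) b`. -/
theorem OrthMod.IsSemisimple.exists_add (ha : a.IsSemisimple) (b : LieSubmodule ℝ l a) {B : a}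
    (hB : B ∈ b) : ∃ B₀ ∈ b, (∀ x : l, ⁅x, B₀⁆ = 0) ∧ ∃ B₁ ∈ a.actionSpan, B = B₀ + B₁ := by
  let N : LieSubmodule ℝ l a :=
    { Submodule.span ℝ {C : a | ∃ (x : l), ∃ A ∈ b, ⁅x, A⁆ = C} with
      lie_mem := by
        intro x m hm
        refine Submodule.subset_span ⟨x, m, ?_, rfl⟩
        refine (Submodule.span_le (p := b.toSubmodule)).2 ?_ hm
        rintro _ ⟨x, A, hA, rfl⟩
        exact b.lie_mem hA }
  have hN (x : l) {A : a} (hA : A ∈ b) : ⁅x, A⁆ ∈ N := Submodule.subset_span ⟨x, A, hA, rfl⟩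
  have hNb : N ≤ b := by
    refine (Submodule.span_le (p := b.toSubmodule)).2 ?_
    rintro _ ⟨x, A, hA, rfl⟩
    exact b.lie_mem hA
  have hNa : ∀ C ∈ N, C ∈ a.actionSpan := by
    refine Submodule.span_mono ?_
    rintro _ ⟨x, A, hA, rfl⟩
    exact ⟨x, A, rfl⟩
  -- N is the span of [l, b] and Q a complement. The Q-component B₀ of an element of b is still in
  -- b, so [x, B₀] lies in N ∩ Q = 0.
  obtain ⟨Q, -, -, hi, hs⟩ := ha.2 N bot_le le_top
  have hBt : B ∈ N ⊔ Q := hs ▸ LieSubmodule.mem_top B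
  rw [LieSubmodule.mem_sup] at hBt
  obtain ⟨B₁, hB₁, B₀, hB₀, rfl⟩ := hBt
  have hB₀b : B₀ ∈ b := by
    have := sub_mem hB (hNb hB₁)
    rwa [add_sub_cancel_left] at this
  refine ⟨B₀, hB₀b, fun x => ?_, B₁, hNa B₁ hB₁, add_comm _ _⟩
  have : ⁅x, B₀⁆ ∈ N ⊓ Q := by
    rw [LieSubmodule.mem_inf]
    exact ⟨hN x hB₀b, Q.lie_mem hB₀⟩
  rwa [hi, LieSubmodule.mem_bot] at this

end Semisimple

/-! ### Standard models of admissible cocycles are symmetric triples -/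

section Faithful

variable {l : LieInv.{u}} {a : OrthMod.{u, v} l} {c : QuadCocycle a}

/-- If a functional on `V ⊗ V` given by `⟨A, α⟩` factors through the bracket, then `A` is orthogonal
to `α(ker [·,·]_V)`. -/
theorem QuadCocycle.form_eq_zero_of_mem_alphaKer {V : Submodule ℝ l} {A : a} {Ψ : Module.Dual ℝ l}
    (h : ∀ x ∈ V, ∀ y ∈ V, a.form A (c.α x y) = Ψ ⁅x, y⁆) {B : a} (hB : B ∈ c.alphaKer V) :
    a.form A B = 0 := by
  obtain ⟨t, ht, rfl⟩ := hB
  have e : a.form A ∘ₗ TensorProduct.lift (c.α.domRestrict₁₂ V V) =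
      Ψ ∘ₗ TensorProduct.lift
        ((LieModule.toEnd ℝ l l : l →ₗ[ℝ] Module.End ℝ l).domRestrict₁₂ V V) :=
    TensorProduct.ext' fun x y => h x x.2 y y.2
  have e' := LinearMap.congr_fun e t
  rw [LinearMap.comp_apply, LinearMap.comp_apply, LinearMap.mem_ker.1 ht, map_zero] at e'
  exact e'

/-- If `A` is orthogonal to `α(ker [·,·]_l)`, then `⟨A, α⟩` factors through the bracket. -/
theorem QuadCocycle.exists_dual_of_forall_alphaKer {A : a}
    (h : ∀ B ∈ c.alphaKer ⊤, a.form A B = 0) :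
    ∃ Ψ : Module.Dual ℝ l, ∀ x y : l, a.form A (c.α x y) = Ψ ⁅x, y⁆ := by
  let f := TensorProduct.lift ((LieModule.toEnd ℝ l l : l →ₗ[ℝ] Module.End ℝ l).domRestrict₁₂
    (⊤ : Submodule ℝ l) (⊤ : Submodule ℝ l))
  let g := a.form A ∘ₗ TensorProduct.lift (c.α.domRestrict₁₂ (⊤ : Submodule ℝ l) ⊤)
  have hg : g ∈ (LinearMap.ker f).dualAnnihilator := by
    rw [Submodule.mem_dualAnnihilator]
    exact fun t ht => h _ ⟨t, ht, rfl⟩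
  rw [← LinearMap.range_dualMap_eq_dualAnnihilator_ker] at hg
  obtain ⟨Ψ, hΨ⟩ := hg
  refine ⟨Ψ, fun x y => ?_⟩
  exact (LinearMap.congr_fun hΨ ((⟨x, trivial⟩ : (⊤ : Submodule ℝ l)) ⊗ₜ
    (⟨y, trivial⟩ : (⊤ : Submodule ℝ l)))).symm

/-- Since l = l₊ ⊕ l₋ and l₊ is spanned by brackets of elements of l₋, a linear condition need only
be tested on l₋ and on such brackets. -/
theorem LieInv.BracketMinusEqPlus.induction {l : LieInv.{u}} (h : l.BracketMinusEqPlus)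
    {p : l → Prop} (hadd : ∀ x y, p x → p y → p (x + y)) (hsmul : ∀ (t : ℝ) x, p x → p (t • x))
    (hminus : ∀ x ∈ l.minus, p x) (hlie : ∀ x ∈ l.minus, ∀ y ∈ l.minus, p ⁅x, y⁆) (x : l) : p x := by
  let W : Submodule ℝ l :=
    { carrier := {x | p x}
      add_mem' := fun {x y} => hadd x y
      zero_mem' := hminus 0 (zero_mem _)
      smul_mem' := hsmul }
  have hW : l.plus ≤ W := by
    rw [← h, Submodule.span_le]
    rintro _ ⟨x, hx, y, hy, rfl⟩
    exact hlie x hx y hy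
  obtain ⟨y, hy, z, hz, rfl⟩ := l.exists_plus_minus x
  exact hadd y z (hW hy) (hminus z hz)

theorem OrthMod.θ_lie_apply (a : OrthMod.{u, v} l) (x : l) (A : a) :
    a.θ ⁅x, A⁆ = ⁅l.θ x, a.θ A⁆ := by
  rw [← a.θ_lie, l.θ_θ]

theorem OrthMod.exists_plus_minus (a : OrthMod.{u, v} l) (A : a) :
    ∃ B C, a.θ B = B ∧ a.θ C = -C ∧ A = B + C :=
  ⟨(1 / 2 : ℝ) • (A + a.θ A), (1 / 2 : ℝ) • (A - a.θ A),
    by rw [map_smul, map_add, a.θ_θ, add_comm],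
    by rw [map_smul, map_sub, a.θ_θ, ← smul_neg, neg_sub], by module⟩

namespace StdModel

@[simp] theorem neg_Z (X : StdModel c) : (-X).Z = -X.Z := rfl
@[simp] theorem neg_A (X : StdModel c) : (-X).A = -X.A := rfl
@[simp] theorem neg_L (X : StdModel c) : (-X).L = -X.L := rfl
@[simp] theorem θ_Z (X : StdModel c) (x : l) : (StdModel.θ c X).Z x = X.Z (l.θ x) := rfl
@[simp] theorem θ_A (X : StdModel c) : (StdModel.θ c X).A = a.θ X.A := rfl
@[simp] theorem θ_L (X : StdModel c) : (StdModel.θ c X).L = l.θ X.L := rfl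

end StdModel

/-- Let X = Z + A + K ∈ g₊ annihilate g₋. Then X also annihilates [g₋, g₋], and by (T_1) the
components of [X, ·] = 0 hold along all of l: K is central, ρ(K) = 0, and K satisfies the equations
of (A_0). Once K = 0, A is invariant and ⟨A, α⟩ = -Z([·, ·]), which is what (T_2) needs; then Z
vanishes on l₋ and on brackets. -/
theorem QuadCocycle.faithfulOnMinus_stdModel (hT₁ : l.BracketMinusEqPlus) (ha : a.IsSemisimple)
    (hT₂ : c.CondT2) (hA₀ : c.CondA0) : (stdModel c).toLieInv.FaithfulOnMinus := by
  intro X hX hXY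
  obtain ⟨Z, A, K⟩ : StdModel c := X
  have hZθ (x : l) : Z (l.θ x) = Z x := LinearMap.congr_fun (congrArg StdModel.Z hX) x
  have hAθ : a.θ A = A := congrArg StdModel.A hX
  replace hXY (Y : StdModel c) (hY : StdModel.θ c Y = -Y) : ⁅(⟨Z, A, K⟩ : StdModel c), Y⁆ = 0 :=
    hXY Y hY
  have hL {x : l} (hx : x ∈ l.minus) : ⁅(⟨Z, A, K⟩ : StdModel c), (⟨0, 0, x⟩ : StdModel c)⁆ = 0 :=
    hXY _ (StdModel.ext (by ext; simp) (by simp) hx)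
  have hKm {x : l} (hx : x ∈ l.minus) : ⁅K, x⁆ = 0 := congrArg StdModel.L (hL hx)
  have hK : ∀ x : l, ⁅K, x⁆ = 0 := by
    refine hT₁.induction (fun x y hx hy => by rw [lie_add, hx, hy, add_zero])
      (fun t x hx => by rw [lie_smul, hx, smul_zero]) (fun x hx => hKm hx) fun x hx y hy => ?_
    rw [leibniz_lie, hKm hx, hKm hy, zero_lie, lie_zero, add_zero]
  have hKA {B : a} (hB : a.θ B = -B) : ⁅K, B⁆ = 0 := by
    have h := congrArg StdModel.A (hXY ⟨0, B, 0⟩ (StdModel.ext (by ext; simp) hB (by simp)))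
    simpa [StdModel.lie_A] using h
  have hcomm (x : l) (B : a) : ⁅K, ⁅x, B⁆⁆ = ⁅x, ⁅K, B⁆⁆ := by
    rw [leibniz_lie, hK, zero_lie, zero_add]
  have hKx {B : a} (hB : a.θ B = B) {x : l} (hx : x ∈ l.minus) : ⁅K, ⁅x, B⁆⁆ = 0 :=
    hKA (by rw [a.θ_lie_apply, LieInv.mem_minus.1 hx, hB, neg_lie])
  -- ρ(K) vanishes on a₋ and commutes with ρ(l). For B ∈ a₊ and x ∈ l₋ one has ρ(x)B ∈ a₋; brackets
  -- in l₊ are reduced to this case. Semi-simplicity then extends ρ(K) = 0 from ρ(l)a to a, as ρ(K)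
  -- kills the invariants anyway.
  have hKxB (x : l) (B : a) : ⁅K, ⁅x, B⁆⁆ = 0 := by
    obtain ⟨B, C, hB, hC, rfl⟩ := a.exists_plus_minus B
    rw [lie_add, lie_add, hcomm x C, hKA hC, lie_zero, add_zero]
    refine hT₁.induction (fun x y hx hy => by rw [add_lie, lie_add, hx, hy, add_zero])
      (fun t x hx => by rw [smul_lie, lie_smul, hx, smul_zero]) (fun x hx => hKx hB hx)
      (fun x hx y hy => ?_) x
    rw [lie_lie, lie_sub, hcomm x ⁅y, B⁆, hcomm y ⁅x, B⁆, hKx hB hx, hKx hB hy, lie_zero, lie_zero, sub_zero]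
  have hKρ (B : a) : ⁅K, B⁆ = 0 := by
    obtain ⟨B₀, -, hB₀, B₁, hB₁, rfl⟩ := ha.exists_add ⊤ (LieSubmodule.mem_top B)
    rw [lie_add, hB₀, zero_add]
    have : a.actionSpan ≤ LinearMap.ker (LieModule.toEnd ℝ l a K) := by
      refine Submodule.span_le.2 ?_
      rintro _ ⟨x, B, rfl⟩
      exact hKxB x B
    exact this hB₁
  -- The second entry is the bracket of x and y taken in g, so X annihilates it by the Jacobi
  -- identity. Its l-component ranges over generators of l₊.
  have hLie {x y : l} (hx : x ∈ l.minus) (hy : y ∈ l.minus) :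
      ⁅(⟨Z, A, K⟩ : StdModel c), (⟨c.γ x y, c.α x y, ⁅x, y⁆⟩ : StdModel c)⁆ = 0 := by
    have e : (⟨c.γ x y, c.α x y, ⁅x, y⁆⟩ : StdModel c) =
        ⁅(⟨0, 0, x⟩ : StdModel c), (⟨0, 0, y⟩ : StdModel c)⁆ := by
      refine StdModel.ext (LinearMap.ext fun z => ?_) ?_ ?_
      · simp [StdModel.lie_Z]
      · simp [StdModel.lie_A]
      · simp [StdModel.lie_L]
    rw [e, leibniz_lie, hL hx, hL hy, zero_lie, lie_zero, add_zero]
  have hα : ∀ x : l, c.α K x = ⁅x, A⁆ := by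
    refine hT₁.induction (fun x y hx hy => by rw [map_add, hx, hy, add_lie])
      (fun t x hx => by rw [map_smul, hx, smul_lie]) (fun x hx => ?_) (fun x hx y hy => ?_)
    · have h := congrArg StdModel.A (hL hx)
      simp only [StdModel.lie_A, lie_zero, zero_sub, StdModel.zero_A] at h
      rwa [neg_add_eq_zero, eq_comm] at h
    · have h := congrArg StdModel.A (hLie hx hy)
      simp only [StdModel.lie_A, hKρ, zero_sub, StdModel.zero_A] at h
      rwa [neg_add_eq_zero, eq_comm] at h
  have hγ : ∀ x y : l, c.γ K x y + a.form A (c.α x y) + Z ⁅x, y⁆ = 0 := by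
    refine hT₁.induction (fun x y hx hy z => ?_) (fun t x hx z => ?_) (fun x hx z => ?_)
      (fun x hx y hy z => ?_)
    · simp only [map_add, LinearMap.add_apply, add_lie]
      linarith [hx z, hy z]
    · simp only [map_smul, LinearMap.smul_apply, smul_lie, smul_eq_mul]
      linear_combination t * hx z
    · have h := LinearMap.congr_fun (congrArg StdModel.Z (hL hx)) z
      simpa [StdModel.lie_Z] using h
    · have h := LinearMap.congr_fun (congrArg StdModel.Z (hLie hx hy)) z
      simp only [StdModel.lie_Z, hα, hK, map_zero, sub_zero, StdModel.zero_Z,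
        LinearMap.zero_apply] at h
      linarith
  have hK0 : K = 0 := by
    refine hA₀ K (fun x => by rw [← lie_skew, hK, neg_zero]) hKρ ⟨-A, Z, fun x => ?_, fun x y => ?_⟩
    · rw [c.α_swap, hα, lie_neg]
    · rw [c.γ_swap_left, map_neg, LinearMap.neg_apply]
      linarith [hγ x y]
  subst hK0
  have hAinv (x : l) : ⁅x, A⁆ = 0 := by rw [← hα, map_zero, LinearMap.zero_apply]
  have hAZ (x y : l) : a.form A (c.α x y) = (-Z) ⁅x, y⁆ := by
    have := hγ x y
    rw [map_zero, LinearMap.zero_apply, LinearMap.zero_apply] at this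
    rw [LinearMap.neg_apply]
    linarith
  have hA0 : A = 0 := by
    refine a.form_nondeg A fun B => ?_
    obtain ⟨B₀, -, hB₀, B₁, hB₁, rfl⟩ := ha.exists_add ⊤ (LieSubmodule.mem_top B)
    rw [map_add, a.form_eq_zero_of_mem_actionSpan hAinv hB₁, add_zero]
    have hθB (x : l) : ⁅x, a.θ B₀⁆ = 0 := by rw [← a.θ_lie, hB₀, map_zero]
    -- As A is fixed by θ, ⟨A, B₀⟩ depends only on the symmetrization of B₀. That lies in (a^l)₊,
    -- which by (T_2) comes from α on ker [·,·] modulo ρ(l)a, and A is orthogonal to both.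
    have hC : (1 / 2 : ℝ) • (B₀ + a.θ B₀) ∈ a.invariants ⊓ a.plus := by
      refine ⟨OrthMod.mem_invariants.2 fun x => ?_, ?_⟩
      · rw [lie_smul, lie_add, hB₀, hθB, add_zero, smul_zero]
      · change a.θ _ = _
        rw [map_smul, map_add, a.θ_θ, add_comm]
        rfl
    rw [hT₂] at hC
    obtain ⟨-, hC⟩ := hC
    obtain ⟨C, hC, D, hD, e⟩ := Submodule.mem_sup.1 hC
    have h := congrArg (a.form A) e
    rw [map_add, c.form_eq_zero_of_mem_alphaKer (fun x _ y _ => hAZ x y) hC,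
      a.form_eq_zero_of_mem_actionSpan hAinv hD, map_smul, map_add, smul_eq_mul] at h
    have h' := a.θ_isom A B₀
    rw [hAθ] at h'
    linarith
  subst hA0
  have hZ0 : Z = 0 := by
    refine LinearMap.ext (hT₁.induction (fun x y hx hy => ?_) (fun t x hx => ?_) (fun x hx => ?_)
      fun x hx y hy => ?_)
    · rw [map_add, hx, hy]; simp
    · rw [map_smul, hx]; simp
    · have := hZθ x
      rw [LieInv.mem_minus.1 hx, map_neg] at this
      rw [LinearMap.zero_apply]
      linarith
    · have := hAZ x y
      rw [map_zero, LinearMap.zero_apply, LinearMap.neg_apply] at this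
      rw [LinearMap.zero_apply]
      linarith
  rw [hZ0]
  rfl

end Faithful

/-! ### The maximal submodule of (B_k) and orthogonal complements -/

section Orthogonal

variable {l : LieInv.{u}} {a : OrthMod.{u, v} l} {c : QuadCocycle a}

theorem OrthMod.form_nondegenerate (a : OrthMod.{u, v} l) : a.form.Nondegenerate := by
  refine LinearMap.BilinForm.nondegenerate_iff_ker_eq_bot.2 ?_
  refine LinearMap.ker_eq_bot'.2 fun x hx => a.form_nondeg x fun y => ?_
  rw [hx, LinearMap.zero_apply]

/-- The system of equations `(B_k)` is solvable on the sum of two submodules on which it is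
solvable. -/
theorem QuadCocycle.SolvableOn.sup (ha : a.IsSemisimple) {k : ℕ} {b b' : LieSubmodule ℝ l a}
    (h : c.SolvableOn k b) (h' : c.SolvableOn k b') : c.SolvableOn k (b ⊔ b') := by
  obtain ⟨Φ, hΦ⟩ := h
  obtain ⟨Φ', hΦ'⟩ := h'
  -- T turns b + b' into the direct sum of submodules b ⊕ (b' ∩ T), so solutions on the two summands
  -- can be glued.
  obtain ⟨T, -, -, hi, hs⟩ := ha.2 (b ⊓ b') bot_le le_top
  have hdisj : Disjoint (b' ⊓ T).toSubmodule b.toSubmodule := by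
    rw [Submodule.disjoint_def]
    intro x hx hxb
    have hx' : x ∈ b ⊓ b' ⊓ T := by
      rw [LieSubmodule.mem_inf, LieSubmodule.mem_inf]
      exact ⟨⟨hxb, hx.1⟩, hx.2⟩
    rwa [hi, LieSubmodule.mem_bot] at hx'
  obtain ⟨W, hW, hWb⟩ := hdisj.exists_isCompl
  let π := b.toSubmodule.projection W hWb.symm
  have hπb {B : a} (hB : B ∈ b) : π B = B :=
    Submodule.projection_apply_of_mem_left hWb.symm hB
  have hπT {B : a} (hB : B ∈ b' ⊓ T) : π B = 0 :=
    (Submodule.projection_apply_eq_zero_iff hWb.symm).2 (hW hB)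
  let e := LinearMap.BilinForm.toDual a.form a.form_nondegenerate
  -- Φ₀(K) represents the functional that is ⟨Φ(K), ·⟩ on b and ⟨Φ'(K), ·⟩ on b' ∩ T. The projection
  -- π need not be equivariant: moving x onto B by invariance, the equation involves only pairings
  -- with the submodule containing B.
  let Φ₀ : radSeries l k →ₗ[ℝ] a := e.symm.toLinearMap ∘ₗ
    (π.dualMap ∘ₗ a.form ∘ₗ Φ + (LinearMap.id - π).dualMap ∘ₗ a.form ∘ₗ Φ')
  have hΦ₀ (K : radSeries l k) (B : a) :
      a.form (Φ₀ K) B = a.form (Φ K) (π B) + a.form (Φ' K) (B - π B) :=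
    LinearMap.BilinForm.apply_toDual_symm_apply (hB := a.form_nondegenerate) _ B
  have hb {K : radSeries l k} {B : a} (hB : B ∈ b) : a.form (Φ₀ K) B = a.form (Φ K) B := by
    rw [hΦ₀, hπb hB, sub_self, map_zero, add_zero]
  have hT {K : radSeries l k} {B : a} (hB : B ∈ b' ⊓ T) : a.form (Φ₀ K) B = a.form (Φ' K) B := by
    rw [hΦ₀, hπT hB, map_zero, zero_add, sub_zero]
  refine ⟨Φ₀, fun x K B hB => ?_⟩
  rw [LieSubmodule.mem_sup] at hB
  obtain ⟨B, hB, B', hB', rfl⟩ := hB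
  have hBt : B' ∈ b ⊓ b' ⊔ T := hs ▸ LieSubmodule.mem_top B'
  rw [LieSubmodule.mem_sup] at hBt
  obtain ⟨B₁, hB₁, B₂, hB₂, rfl⟩ := hBt
  rw [LieSubmodule.mem_inf] at hB₁
  have hB₂' : B₂ ∈ b' ⊓ T := by
    rw [LieSubmodule.mem_inf]
    refine ⟨?_, hB₂⟩
    have := sub_mem hB' hB₁.2
    rwa [add_sub_cancel_left] at this
  have key {B : a} (hB : B ∈ b) :
      a.form (c.α x K) B = a.form (⁅x, Φ₀ K⁆ - Φ₀ ⁅x, K⁆) B := by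
    rw [hΦ x K B hB, map_sub, map_sub, LinearMap.sub_apply, LinearMap.sub_apply, hb hB, a.form_lie,
      a.form_lie, hb (b.lie_mem hB)]
  have key' : a.form (c.α x K) B₂ = a.form (⁅x, Φ₀ K⁆ - Φ₀ ⁅x, K⁆) B₂ := by
    rw [hΦ' x K B₂ (hB₂'.1), map_sub, map_sub, LinearMap.sub_apply, LinearMap.sub_apply,
      hT hB₂', a.form_lie, a.form_lie, hT ((b' ⊓ T).lie_mem hB₂')]
  rw [map_add, map_add, map_add, map_add, key hB, key hB₁.1, key']

/-- The ascending chain condition gives a maximal solvable submodule, and closure under sums makes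
it the greatest. This is the submodule b_k to which (B_k) refers. -/
theorem QuadCocycle.exists_isGreatest_solvableOn (c : QuadCocycle a) (ha : a.IsSemisimple) (k : ℕ) :
    ∃ b, IsGreatest {b | c.SolvableOn k b} b := by
  have hne : {b | c.SolvableOn k b}.Nonempty := by
    refine ⟨⊥, 0, fun x K B hB => ?_⟩
    rw [(LieSubmodule.mem_bot B).1 hB, map_zero, map_zero]
  obtain ⟨b, hb, hmax⟩ :=
    (LieSubmodule.wellFoundedGT_of_noetherian ℝ l a).wf.has_min _ hne
  refine ⟨b, hb, fun b' hb' => ?_⟩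
  by_contra hn
  exact hmax (b ⊔ b') (QuadCocycle.SolvableOn.sup ha hb hb')
    (lt_of_le_of_ne le_sup_left fun e => hn (e ▸ le_sup_right))

/-- A non-degenerate subspace is complemented by its orthogonal complement. -/
theorem OrthMod.IsNondegenerateOn.exists_add {W : Submodule ℝ a} (hW : a.IsNondegenerateOn W)
    (A : a) : ∃ B ∈ W, ∃ C, (∀ D ∈ W, a.form C D = 0) ∧ A = B + C := by
  have hr : a.form.IsRefl := fun x y h => by rw [a.form_symm, h]
  have hc : IsCompl W (a.form.orthogonal W) := by
    refine (LinearMap.BilinForm.isCompl_orthogonal_iff_disjoint hr).2 ?_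
    rw [Submodule.disjoint_def]
    intro x hx hx'
    exact hW x hx fun y hy => by rw [a.form_symm]; exact hx' y hy
  have hA : A ∈ W ⊔ a.form.orthogonal W := by rw [hc.sup_eq_top]; trivial
  obtain ⟨B, hB, C, hC, rfl⟩ := Submodule.mem_sup.1 hA
  exact ⟨B, hB, C, fun D hD => by rw [a.form_symm]; exact hC D hD, rfl⟩

end Orthogonal

/-! ### Self-adjoint elements of the centroid -/

section Centroid

variable {l : LieInv.{u}} {a : OrthMod.{u, v} l} {c : QuadCocycle a}

/-- The linear map `P` is a self-adjoint element of the centroid of the standard model. -/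
structure IsSelfAdjointCentroid (P : StdModel c →ₗ[ℝ] StdModel c) : Prop where
  lie : ∀ X Y : StdModel c, P ⁅X, Y⁆ = ⁅X, P Y⁆
  symm : ∀ X Y : StdModel c, StdModel.form c (P X) Y = StdModel.form c X (P Y)

/-- The inclusion of `l^*` into the standard model. -/
def StdModel.ofZ (c : QuadCocycle a) (Z : Module.Dual ℝ l) : StdModel c := ⟨Z, 0, 0⟩

/-- The inclusion of `a` into the standard model. -/
def StdModel.ofA (c : QuadCocycle a) (A : a) : StdModel c := ⟨0, A, 0⟩

/-- The inclusion of `l` into the standard model. -/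
def StdModel.ofL (c : QuadCocycle a) (x : l) : StdModel c := ⟨0, 0, x⟩

/-- The projection of the standard model onto `l`. -/
def StdModel.projL (c : QuadCocycle a) : StdModel c →ₗ[ℝ] l where
  toFun X := X.L
  map_add' _ _ := rfl
  map_smul' _ _ := rfl

theorem StdModel.form_ofZ (Z : Module.Dual ℝ l) (X : StdModel c) :
    StdModel.form c (StdModel.ofZ c Z) X = Z X.L := by
  simp [StdModel.form_apply, StdModel.ofZ]

theorem StdModel.form_ofA (A : a) (X : StdModel c) :
    StdModel.form c (StdModel.ofA c A) X = a.form A X.A := by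
  simp [StdModel.form_apply, StdModel.ofA]

theorem StdModel.form_ofL (x : l) (X : StdModel c) :
    StdModel.form c (StdModel.ofL c x) X = X.Z x := by
  simp [StdModel.form_apply, StdModel.ofL]

theorem StdModel.form_comm (X Y : StdModel c) : StdModel.form c X Y = StdModel.form c Y X :=
  (stdModel c).form_symm X Y

theorem StdModel.lie_ofL_Z (x : l) (X : StdModel c) (y : l) :
    ⁅StdModel.ofL c x, X⁆.Z y = c.γ x X.L y - a.form X.A (c.α x y) - X.Z ⁅x, y⁆ := by
  simp [StdModel.lie_Z, StdModel.ofL]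

theorem StdModel.lie_ofL_A (x : l) (X : StdModel c) :
    ⁅StdModel.ofL c x, X⁆.A = ⁅x, X.A⁆ + c.α x X.L := by
  simp [StdModel.lie_A, StdModel.ofL]

/-- `X` centralizes `l^* ⊕ a`. -/
def StdModel.CentralizesPerp (X : StdModel c) : Prop :=
  (∀ Z, ⁅StdModel.ofZ c Z, X⁆ = 0) ∧ ∀ A, ⁅StdModel.ofA c A, X⁆ = 0

namespace StdModel.CentralizesPerp

variable {X : StdModel c}

theorem lie_L (h : X.CentralizesPerp) (x : l) : ⁅x, X.L⁆ = 0 := by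
  rw [← neg_eq_zero, lie_skew]
  refine (Module.forall_dual_apply_eq_zero_iff ℝ _).1 fun f => ?_
  have := LinearMap.congr_fun (congrArg StdModel.Z (h.1 f)) x
  simpa [StdModel.lie_Z, StdModel.ofZ] using this

theorem L_lie (h : X.CentralizesPerp) (A : a) : ⁅X.L, A⁆ = 0 := by
  have := congrArg StdModel.A (h.2 A)
  simpa [StdModel.lie_A, StdModel.ofA] using this

theorem α_apply (h : X.CentralizesPerp) (x : l) : c.α x X.L = - ⁅x, X.A⁆ := by
  rw [c.α_swap, neg_inj, ← sub_eq_zero]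
  refine a.form_nondeg _ fun A => ?_
  have := LinearMap.congr_fun (congrArg StdModel.Z (h.2 A)) x
  simp only [StdModel.lie_Z, StdModel.ofA, StdModel.zero_Z, LinearMap.zero_apply, map_zero,
    zero_lie, sub_zero, zero_add, add_zero] at this
  rw [map_sub, LinearMap.sub_apply, a.form_lie, a.form_symm (c.α _ _)]
  linarith

/-- Conceptually, X centralizes l^* ⊕ a, so by invariance [g, X] is orthogonal to l^* ⊕ a, whose
orthogonal complement is l^*. -/
theorem lie_ofL (h : X.CentralizesPerp) (x : l) :
    ⁅StdModel.ofL c x, X⁆ = StdModel.ofZ c ⁅StdModel.ofL c x, X⁆.Z :=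
  StdModel.ext rfl (by rw [lie_ofL_A, h.α_apply, add_neg_cancel]; rfl) (h.lie_L x)

theorem map (h : X.CentralizesPerp) {P : StdModel c →ₗ[ℝ] StdModel c}
    (hP : IsSelfAdjointCentroid P) : (P X).CentralizesPerp :=
  ⟨fun Z => by rw [← hP.lie, h.1, map_zero], fun A => by rw [← hP.lie, h.2, map_zero]⟩

/-- The conditions `(A_0)` and `(A_k)` in terms of elements of the standard model. -/
theorem L_eq_zero (h : X.CentralizesPerp) {k : ℕ} (hA₀ : c.CondA0) (hAk : 1 ≤ k → c.CondA k)
    (hX : X.L ∈ radSeries l k)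
    (hZ : ∀ x, ∀ y ∈ radSeries l k, ⁅StdModel.ofL c x, X⁆.Z y = 0) : X.L = 0 := by
  simp only [lie_ofL_Z] at hZ
  rcases Nat.eq_zero_or_pos k with rfl | hk
  · refine hA₀ X.L h.lie_L h.L_lie ⟨-X.A, X.Z, fun x => by rw [h.α_apply, lie_neg], fun x y => ?_⟩
    have := hZ x y (LieSubmodule.mem_top y)
    rw [map_neg, LinearMap.neg_apply]
    linarith
  · by_contra hne
    obtain ⟨φ, hφ⟩ : ∃ φ : Module.Dual ℝ l, φ X.L = 1 := by
      obtain ⟨φ, hφ, -⟩ := Submodule.exists_le_ker_of_notMem (p := (⊥ : Submodule ℝ l))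
        (v := X.L) (by simpa using hne)
      exact ⟨(φ X.L)⁻¹ • φ, by simp [hφ]⟩
    -- X.L is central, so its line is an ideal; being at most one-dimensional, it lies in the socle.
    let I : LieIdeal ℝ l :=
      { Submodule.span ℝ {X.L} with
        lie_mem := by
          intro x y hy
          obtain ⟨t, rfl⟩ := Submodule.mem_span_singleton.1 hy
          rw [lie_smul, h.lie_L, smul_zero]
          exact Submodule.zero_mem (Submodule.span ℝ {X.L}) }
    have hI : ∀ y ∈ I, ∃ t : ℝ, t • X.L = y := fun y => Submodule.mem_span_singleton.1
    have hXI : X.L ∈ I := Submodule.mem_span_singleton_self X.L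
    have hIk : I ≤ radSeries l k := by
      intro y hy
      obtain ⟨t, rfl⟩ := hI y hy
      exact (radSeries l k).smul_mem t hX
    have hφI (K : I) : (K : l) = φ K • X.L := by
      obtain ⟨t, ht⟩ := hI K K.2
      rw [← ht, map_smul, hφ, smul_eq_mul, mul_one]
    have hxK (x : l) (K : I) : ⁅x, K⁆ = 0 :=
      Subtype.ext (by rw [LieSubmodule.coe_bracket, hφI, lie_smul, h.lie_L, smul_zero]; rfl)
    -- On the line ℝ X.L, with coordinate φ, take Φ₁ = -φ ⊗ X.A and Φ₂ = φ ⊗ X.Z restricted to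
    -- R_k(l). The terms containing [L, K] drop out because K is central.
    have hbot := hAk hk I (le_inf (le_socle_of_forall_smul I hI) hIk)
      ⟨-(φ ∘ₗ I.toSubmodule.subtype).smulRight X.A, (φ ∘ₗ I.toSubmodule.subtype).smulRight
        (X.Z ∘ₗ (radSeries l k).toSubmodule.subtype), fun x K => ?_, fun x K y => ?_⟩
    · rw [hbot, LieSubmodule.mem_bot] at hXI
      exact hne hXI
    · rw [hxK, map_zero, sub_zero, hφI, map_smul, h.α_apply]
      change _ = ⁅x, -(φ K • X.A)⁆
      rw [lie_neg, lie_smul, smul_neg]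
    · rw [hxK, map_zero, hφI, map_smul, LinearMap.smul_apply]
      change φ K • _ = -a.form (-(φ K • X.A)) _ + φ K • X.Z ⁅x, (y : l)⁆ + 0
      have := hZ x y y.2
      simp only [map_neg, map_smul, LinearMap.neg_apply, LinearMap.smul_apply, smul_eq_mul]
      linear_combination φ K * this

end StdModel.CentralizesPerp

theorem StdModel.centralizesPerp_ofZ (Z : Module.Dual ℝ l) : (StdModel.ofZ c Z).CentralizesPerp := by
  refine ⟨fun Z' => ?_, fun A => ?_⟩ <;>
    refine StdModel.ext (LinearMap.ext fun y => ?_) ?_ ?_ <;>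
    simp [StdModel.lie_Z, StdModel.lie_A, StdModel.lie_L, StdModel.ofZ, StdModel.ofA]

theorem StdModel.centralizesPerp_of_invariant (Z : Module.Dual ℝ l) {B : a}
    (hB : ∀ x : l, ⁅x, B⁆ = 0) : (⟨Z, B, 0⟩ : StdModel c).CentralizesPerp := by
  refine ⟨fun Z' => ?_, fun A => ?_⟩ <;>
    refine StdModel.ext (LinearMap.ext fun y => ?_) ?_ ?_ <;>
    simp [StdModel.lie_Z, StdModel.lie_A, StdModel.lie_L, StdModel.ofZ, StdModel.ofA,
      a.form_symm B, a.form_lie, hB]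

namespace IsSelfAdjointCentroid

variable {P : StdModel c →ₗ[ℝ] StdModel c}

/-- R_k(l) is the image of R_k(g), and P, an endomorphism of the adjoint module, preserves R_k(g).
So a lift X taken in R_k(g) works. -/
theorem exists_mem_radSeries (hP : IsSelfAdjointCentroid P) {k : ℕ} {y : l} (hy : y ∈ radSeries l k) :
    ∃ X : StdModel c, X.L = y ∧ (P X).L ∈ radSeries l k := by
  have hs : Function.Surjective (StdModel.projL c) := fun x => ⟨StdModel.ofL c x, rfl⟩
  obtain ⟨X, hX, rfl⟩ := SymTriple.exists_mem_radSeries (StdModel.projL c) (StdModel.projL c) hs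
    (fun _ _ => rfl) hs k y hy
  exact ⟨X, rfl, map_mem_radSeries (StdModel.projL c) (StdModel.projL c) hs (fun _ _ => rfl) k _
    (map_mem_radSeries P id Function.surjective_id hP.lie k X hX)⟩

/-- With a lift X of y as above, Z(y) = ⟨Pξ, X⟩ = ξ((PX)_l) = 0. Thus P respects the annihilator of
R_k(l) in l^*. -/
theorem Z_apply_eq_zero (hP : IsSelfAdjointCentroid P) {k : ℕ} {ξ : Module.Dual ℝ l} (hξ : ∀ y ∈ radSeries l k, ξ y = 0)
    {Z : Module.Dual ℝ l} (hZ : P (StdModel.ofZ c ξ) = StdModel.ofZ c Z) {y : l}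
    (hy : y ∈ radSeries l k) : Z y = 0 := by
  obtain ⟨X, rfl, hX⟩ := hP.exists_mem_radSeries hy
  rw [← StdModel.form_ofZ, ← hZ, hP.symm, StdModel.form_ofZ, hξ _ hX]

end IsSelfAdjointCentroid

end Centroid

/-! ### Invariance of the flag l^* ⊂ l^* ⊕ a under the centroid -/

section Invariance

variable {l : LieInv.{u}} {a : OrthMod.{u, v} l} {c : QuadCocycle a}

/-- An element outside the span of `[l, R_k(l)]` is separated from it by a functional. -/
theorem exists_dual_of_notMem_span {k : ℕ} {K : l}
    (hK : K ∉ Submodule.span ℝ {z : l | ∃ x : l, ∃ y ∈ radSeries l k, ⁅x, y⁆ = z}) :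
    ∃ φ : Module.Dual ℝ l, φ K ≠ 0 ∧ ∀ x : l, ∀ y ∈ radSeries l k, φ ⁅x, y⁆ = 0 := by
  obtain ⟨φ, hφ, hle⟩ := Submodule.exists_le_ker_of_notMem hK
  exact ⟨φ, hφ, fun x y hy => hle (Submodule.subset_span ⟨x, y, hy, rfl⟩)⟩

namespace IsSelfAdjointCentroid

variable {P : StdModel c →ₗ[ℝ] StdModel c}

/-- P sends [x, X] ∈ l^* to [x, PX], again in l^*, and preserves vanishing on R_k(l). This feeds PX
into `L_eq_zero`. -/
theorem lie_ofL_Z_eq_zero (hP : IsSelfAdjointCentroid P) {X : StdModel c} (hX : X.CentralizesPerp)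
    {k : ℕ} (hξ : ∀ x, ∀ y ∈ radSeries l k, ⁅StdModel.ofL c x, X⁆.Z y = 0) (x : l) :
    ∀ y ∈ radSeries l k, ⁅StdModel.ofL c x, P X⁆.Z y = 0 := by
  intro y hy
  refine hP.Z_apply_eq_zero (ξ := ⁅StdModel.ofL c x, X⁆.Z) (hξ x) ?_ hy
  rw [← hX.lie_ofL, hP.lie]
  exact (hX.map hP).lie_ofL x

theorem lie_ofL_ofZ (x : l) (ζ : Module.Dual ℝ l) (y : l) :
    ⁅StdModel.ofL c x, StdModel.ofZ c ζ⁆.Z y = - ζ ⁅x, y⁆ := by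
  simp [StdModel.lie_ofL_Z, StdModel.ofZ]

theorem apply_L (hP : IsSelfAdjointCentroid P) (ζ : Module.Dual ℝ l) (X : StdModel c) :
    ζ (P X).L = StdModel.form c (P (StdModel.ofZ c ζ)) X := by
  rw [hP.symm, StdModel.form_ofZ]

/-- The `l`-component of `P` vanishes on `l^*`. -/
theorem ofZ_L (hP : IsSelfAdjointCentroid P) (hc : c.IsAdmissible) (ζ : Module.Dual ℝ l) :
    (P (StdModel.ofZ c ζ)).L = 0 := by
  obtain ⟨-, hA₀, -, m, hm, hAB⟩ := hc
  have key : ∀ k ≤ m + 1, ∀ ζ, (P (StdModel.ofZ c ζ)).L ∈ radSeries l k := by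
    intro k
    induction k with
    | zero => exact fun _ ζ => LieSubmodule.mem_top _
    | succ k ih =>
      intro hk ζ
      specialize ih (by omega)
      refine mem_radSeries_succ
        ((StdModel.centralizesPerp_ofZ ζ).map hP).lie_L ?_
      by_contra hn
      obtain ⟨φ, hφ, hφk⟩ := exists_dual_of_notMem_span hn
      -- As φ kills [l, R_k(l)], the functional [x, φ] vanishes on R_k(l), hence so does [x, Pφ].
      -- With the induction hypothesis, (A_k) applies to Pφ.
      have h0 : (P (StdModel.ofZ c φ)).L = 0 := by
        refine ((StdModel.centralizesPerp_ofZ φ).map hP).L_eq_zero hA₀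
          (fun h1 => (hAB k h1 (by omega)).1) (ih φ) ?_
        refine hP.lie_ofL_Z_eq_zero (StdModel.centralizesPerp_ofZ φ) fun x y hy => ?_
        rw [lie_ofL_ofZ, hφk x y hy, neg_zero]
      apply hφ
      -- Self-adjointness: φ((Pζ)_l) = ⟨Pζ, φ⟩ = ζ((Pφ)_l) = 0.
      rw [hP.apply_L, StdModel.form_comm, StdModel.form_ofZ, h0, map_zero]
  have := key (m + 1) le_rfl ζ
  rwa [hm, LieSubmodule.mem_bot] at this

theorem lie_ofZ_A (hP : IsSelfAdjointCentroid P) (hc : c.IsAdmissible) (ζ : Module.Dual ℝ l)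
    (x : l) : ⁅x, (P (StdModel.ofZ c ζ)).A⁆ = 0 := by
  have := ((StdModel.centralizesPerp_ofZ ζ).map hP).α_apply x
  rw [hP.ofZ_L hc, map_zero, zero_eq_neg] at this
  exact this

/-- The blocks a → l and l^* → a of P are adjoint to each other, so information passes between them.
-/
theorem apply_ofA_L (hP : IsSelfAdjointCentroid P) (ζ : Module.Dual ℝ l) (A : a) :
    ζ (P (StdModel.ofA c A)).L = a.form (P (StdModel.ofZ c ζ)).A A := by
  rw [hP.apply_L, StdModel.form_comm, StdModel.form_ofA, a.form_symm]

theorem apply_mk_L (hP : IsSelfAdjointCentroid P) (hc : c.IsAdmissible) (ζ : Module.Dual ℝ l)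
    (A : a) : (P ⟨ζ, A, 0⟩).L = (P (StdModel.ofA c A)).L := by
  have : (⟨ζ, A, 0⟩ : StdModel c) = StdModel.ofZ c ζ + StdModel.ofA c A :=
    StdModel.ext (by simp [StdModel.ofZ, StdModel.ofA]) (by simp [StdModel.ofZ, StdModel.ofA])
      (by simp [StdModel.ofZ, StdModel.ofA])
  rw [this, map_add, StdModel.add_L, hP.ofZ_L hc, zero_add]

/-- Pairing with ζ gives ⟨(Pζ)_a, ρ(x)A⟩, which is zero since (Pζ)_a is invariant. -/
theorem lie_ofA_L (hP : IsSelfAdjointCentroid P) (hc : c.IsAdmissible) (A : a) (x : l) :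
    ⁅x, (P (StdModel.ofA c A)).L⁆ = 0 := by
  have h : ⁅x, (P (StdModel.ofA c A)).L⁆ = (P ⁅StdModel.ofL c x, StdModel.ofA c A⁆).L := by
    rw [hP.lie]; rfl
  have h' : ⁅StdModel.ofL c x, StdModel.ofA c A⁆ =
      ⟨⁅StdModel.ofL c x, StdModel.ofA c A⁆.Z, ⁅x, A⁆, 0⟩ :=
    StdModel.ext rfl (by simp [StdModel.lie_ofL_A, StdModel.ofA])
      (by simp [StdModel.lie_L, StdModel.ofA])
  rw [h, h', hP.apply_mk_L hc]
  refine (Module.forall_dual_apply_eq_zero_iff ℝ _).1 fun ζ => ?_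
  have := a.form_inv x (P (StdModel.ofZ c ζ)).A A
  rw [hP.lie_ofZ_A hc, map_zero, LinearMap.zero_apply, zero_add] at this
  rw [hP.apply_ofA_L, this]

/-- If the `l`-components of `P(a)` lie in `R_k(l)` and the form `⟨B, α⟩` on `l × R_k(l)` is exact
for an invariant `B`, then `P(B)` has vanishing `l`-component. -/
theorem ofA_L_eq_zero (hP : IsSelfAdjointCentroid P) (hc : c.IsAdmissible) {k : ℕ}
    (hAk : 1 ≤ k → c.CondA k) (hk : ∀ A, (P (StdModel.ofA c A)).L ∈ radSeries l k) {B : a}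
    (hB : ∀ x : l, ⁅x, B⁆ = 0) {Ψ : Module.Dual ℝ l}
    (hΨ : ∀ x : l, ∀ y ∈ radSeries l k, a.form B (c.α x y) = - Ψ ⁅x, y⁆) :
    (P (StdModel.ofA c B)).L = 0 := by
  rw [← hP.apply_mk_L hc Ψ]
  have hX := StdModel.centralizesPerp_of_invariant (c := c) Ψ hB
  refine (hX.map hP).L_eq_zero hc.2.1 hAk (by rw [hP.apply_mk_L hc]; exact hk B)
    (hP.lie_ofL_Z_eq_zero hX fun x y hy => ?_)
  rw [StdModel.lie_ofL_Z, map_zero, LinearMap.zero_apply, hΨ x y hy]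
  ring

/-- If `ζ ∈ l^*` vanishes on `[l, R_k(l)]`, then `⟨(Pζ)_a, α⟩` is exact on `l × R_k(l)`. -/
theorem form_ofZ_A (hP : IsSelfAdjointCentroid P) (hc : c.IsAdmissible) {k : ℕ}
    {ζ : Module.Dual ℝ l} (hζ : ∀ x : l, ∀ y ∈ radSeries l k, ζ ⁅x, y⁆ = 0) (x : l) :
    ∀ y ∈ radSeries l k, a.form (P (StdModel.ofZ c ζ)).A (c.α x y) =
      - (P (StdModel.ofZ c ζ)).Z ⁅x, y⁆ := by
  intro y hy
  have h := hP.lie_ofL_Z_eq_zero (StdModel.centralizesPerp_ofZ ζ) (k := k)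
    (fun x y hy => by rw [lie_ofL_ofZ, hζ x y hy, neg_zero]) x y hy
  rw [StdModel.lie_ofL_Z, hP.ofZ_L hc, map_zero, LinearMap.zero_apply] at h
  linarith

theorem form_ofZ_A_eq_zero (hP : IsSelfAdjointCentroid P) (hc : c.IsAdmissible) (ζ : Module.Dual ℝ l)
    {A : a} (hA : A ∈ a.actionSpan) : a.form (P (StdModel.ofZ c ζ)).A A = 0 :=
  a.form_eq_zero_of_mem_actionSpan (hP.lie_ofZ_A hc ζ) hA

/-- Put B = (Pζ)_a. It is invariant, so it is orthogonal to ρ(l)a and only invariants need testing.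
By (B_0) an invariant is C + D with C ∈ W = α₀(ker [·,·]) and D ⟂ W. As ⟨B, α⟩ factors through the
bracket, B ⟂ C. As ⟨D, α⟩ does too, (PD)_l = 0 by (A_0), and ⟨B, D⟩ = ζ((PD)_l) = 0. -/
theorem ofZ_A_eq_zero_of_condB0 (hP : IsSelfAdjointCentroid P) (ha : a.IsSemisimple)
    (hc : c.IsAdmissible) {ζ : Module.Dual ℝ l} (hζ : ∀ x y : l, ζ ⁅x, y⁆ = 0) :
    (P (StdModel.ofZ c ζ)).A = 0 := by
  have hB₀ := hc.2.2.1
  have hB := hP.form_ofZ_A hc (k := 0) fun x y _ => hζ x y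
  have hinv := hP.lie_ofZ_A hc ζ
  have hact := fun A hA => hP.form_ofZ_A_eq_zero hc (A := A) ζ hA
  refine a.form_nondeg _ fun A => ?_
  obtain ⟨A, -, hA, A', hA', rfl⟩ := ha.exists_add ⊤ (LieSubmodule.mem_top A)
  rw [map_add, hact _ hA', add_zero]
  obtain ⟨C, ⟨hCinv, hC⟩, D, hD, rfl⟩ := hB₀.exists_add A
  have hDinv (x : l) : ⁅x, D⁆ = 0 := by
    have := hA x
    rwa [lie_add, OrthMod.mem_invariants.1 hCinv, zero_add] at this
  obtain ⟨C, hCα, E, hE, rfl⟩ := Submodule.mem_sup.1 hC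
  rw [map_add, map_add, hact _ hE, add_zero,
    c.form_eq_zero_of_mem_alphaKer (V := ⊤) (Ψ := -(P (StdModel.ofZ c ζ)).Z)
      (fun x _ y _ => hB x y (LieSubmodule.mem_top y)) hCα, zero_add]
  obtain ⟨Ψ, hΨ⟩ := c.exists_dual_of_forall_alphaKer (A := D) fun C hC => by
    obtain ⟨C₀, -, hC₀, C₁, hC₁, rfl⟩ := ha.exists_add ⊤ (LieSubmodule.mem_top C)
    rw [map_add, a.form_eq_zero_of_mem_actionSpan hDinv hC₁, add_zero]
    refine hD C₀ ⟨OrthMod.mem_invariants.2 hC₀, Submodule.mem_sup.2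
      ⟨_, hC, -C₁, neg_mem hC₁, by abel⟩⟩
  rw [← hP.apply_ofA_L, hP.ofA_L_eq_zero hc (k := 0) (fun h => absurd h (by norm_num))
    (fun A => LieSubmodule.mem_top _) hDinv (Ψ := -Ψ)
    (fun x y _ => by rw [hΨ, LinearMap.neg_apply, neg_neg]), map_zero]

/-- The invariant vector B = (Pζ)_a lies in b_k, because the system is solvable on its line. It is
also orthogonal to b_k: for an invariant C ∈ b_k, (A_k) gives (PC)_l = 0, so ⟨B, C⟩ = ζ((PC)_l) = 0,
and the rest of b_k lies in ρ(l)a up to invariants. Non-degeneracy of b_k forces B = 0. -/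
theorem ofZ_A_eq_zero_of_condB (hP : IsSelfAdjointCentroid P) (ha : a.IsSemisimple)
    (hc : c.IsAdmissible) {k : ℕ} (hAk : c.CondA k) (hBk : c.CondB k)
    (hk : ∀ A, (P (StdModel.ofA c A)).L ∈ radSeries l k) {ζ : Module.Dual ℝ l}
    (hζ : ∀ x : l, ∀ y ∈ radSeries l k, ζ ⁅x, y⁆ = 0) : (P (StdModel.ofZ c ζ)).A = 0 := by
  set B := (P (StdModel.ofZ c ζ)).A with hBdef
  have hB := hP.form_ofZ_A hc hζ
  have hinv := hP.lie_ofZ_A hc ζ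
  rw [← hBdef] at hB hinv
  by_contra hne
  obtain ⟨b, hb⟩ := c.exists_isGreatest_solvableOn ha k
  obtain ⟨φ, hφ⟩ : ∃ A, a.form A B = 1 := by
    have : ∃ A, a.form B A ≠ 0 := by
      by_contra hn
      push Not at hn
      exact hne (a.form_nondeg B hn)
    obtain ⟨A, hA⟩ := this
    exact ⟨(a.form B A)⁻¹ • A, by
      rw [a.form_symm, map_smul, smul_eq_mul, inv_mul_cancel₀ hA]⟩
  let I : LieSubmodule ℝ l a :=
    { Submodule.span ℝ {B} with
      lie_mem := by
        intro x y hy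
        obtain ⟨t, rfl⟩ := Submodule.mem_span_singleton.1 hy
        rw [lie_smul, hinv, smul_zero]
        exact Submodule.zero_mem (Submodule.span ℝ {B}) }
  have hI : c.SolvableOn k I := by
    -- The solution on ℝB is Φ(K) = (Pζ)_{l^*}(K) φ with ⟨φ, B⟩ = 1. Invariance of B leaves only the
    -- term -Φ([L, K]).
    refine ⟨((P (StdModel.ofZ c ζ)).Z ∘ₗ (radSeries l k).toSubmodule.subtype).smulRight φ,
      fun x K B' hB' => ?_⟩
    obtain ⟨t, rfl⟩ := Submodule.mem_span_singleton.1 hB'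
    rw [map_smul, map_smul, map_sub, LinearMap.sub_apply, a.form_lie, hinv, map_zero,
      a.form_symm (c.α x K), hB x K K.2]
    change t • _ = t • (-0 - a.form ((P (StdModel.ofZ c ζ)).Z ⁅x, (K : l)⁆ • φ) B)
    rw [map_smul, LinearMap.smul_apply, hφ, smul_eq_mul (a := (_ : ℝ)) (b := 1), mul_one, neg_zero, zero_sub]
  have hBb : B ∈ b := hb.2 hI (Submodule.mem_span_singleton_self B)
  refine hne (hBk b hb B hBb fun B' hB' => ?_)
  obtain ⟨C, hC, hCinv, D, hD, rfl⟩ := ha.exists_add b hB'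
  rw [map_add, hP.form_ofZ_A_eq_zero hc ζ hD, add_zero]
  obtain ⟨Φ, hΦ⟩ := hb.1
  -- ⟨C, Φ(·)⟩ is defined on R_k(l) only, whereas `ofA_L_eq_zero` needs an element of l^*; any
  -- linear extension serves.
  obtain ⟨Ψ, hΨ⟩ := LinearMap.exists_extend (p := (radSeries l k).toSubmodule)
    (a.form C ∘ₗ Φ)
  have hΨ' (K : radSeries l k) : Ψ K = a.form C (Φ K) := LinearMap.congr_fun hΨ K
  rw [← hP.apply_ofA_L, hP.ofA_L_eq_zero hc (fun _ => hAk) hk hCinv (Ψ := Ψ) ?_, map_zero]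
  intro x y hy
  have h := hΦ x ⟨y, hy⟩ C hC
  rw [map_sub, LinearMap.sub_apply, a.form_lie, hCinv, map_zero, neg_zero, zero_sub,
    a.form_symm, a.form_symm (Φ _), ← hΨ'] at h
  exact h

/-- The `a`-component of `P` vanishes on `l^*`. -/
theorem ofZ_A (hP : IsSelfAdjointCentroid P) (ha : a.IsSemisimple) (hc : c.IsAdmissible)
    (ζ : Module.Dual ℝ l) : (P (StdModel.ofZ c ζ)).A = 0 := by
  obtain ⟨-, -, -, m, hm, hAB⟩ := id hc
  have key : ∀ k ≤ m + 1, ∀ A, (P (StdModel.ofA c A)).L ∈ radSeries l k := by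
    intro k
    induction k with
    | zero => exact fun _ A => LieSubmodule.mem_top _
    | succ k ih =>
      intro hk A
      specialize ih (by omega)
      refine mem_radSeries_succ (hP.lie_ofA_L hc A) ?_
      by_contra hn
      obtain ⟨φ, hφ, hφk⟩ := exists_dual_of_notMem_span hn
      have h0 : (P (StdModel.ofZ c φ)).A = 0 := by
        -- The level k = 0 rests on (A_0) and (B_0); each level 1 ≤ k ≤ m on (A_k) and (B_k).
        rcases Nat.eq_zero_or_pos k with rfl | hk'
        · exact hP.ofZ_A_eq_zero_of_condB0 ha hc fun x y => hφk x y (LieSubmodule.mem_top y)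
        · obtain ⟨h₁, h₂⟩ := hAB k hk' (by omega)
          exact hP.ofZ_A_eq_zero_of_condB ha hc h₁ h₂ ih hφk
      apply hφ
      rw [hP.apply_ofA_L, h0, map_zero, LinearMap.zero_apply]
  refine a.form_nondeg _ fun A => ?_
  have := key (m + 1) le_rfl A
  rw [hm, LieSubmodule.mem_bot] at this
  rw [← hP.apply_ofA_L, this, map_zero]

theorem ofA_L (hP : IsSelfAdjointCentroid P) (ha : a.IsSemisimple) (hc : c.IsAdmissible)
    (A : a) : (P (StdModel.ofA c A)).L = 0 :=
  (Module.forall_dual_apply_eq_zero_iff ℝ _).1 fun ζ => by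
    rw [hP.apply_ofA_L, hP.ofZ_A ha hc, map_zero, LinearMap.zero_apply]

end IsSelfAdjointCentroid

end Invariance

/-! ### Splitting triples by projections -/

section Splitting

variable {l : LieInv.{u}}

/-- A pair of idempotents of `l` and `a` that splits the triple `(l, θ, a)` as a direct sum. -/
structure TripleProj (a : OrthMod.{u, v} l) where
  π : l →ₗ[ℝ] l
  ϖ : a →ₗ[ℝ] a
  π_π : ∀ x, π (π x) = π x
  ϖ_ϖ : ∀ A, ϖ (ϖ A) = ϖ A
  π_lie : ∀ x y : l, π ⁅x, y⁆ = ⁅x, π y⁆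
  π_θ : ∀ x, π (l.θ x) = l.θ (π x)
  ϖ_θ : ∀ A, ϖ (a.θ A) = a.θ (ϖ A)
  ϖ_symm : ∀ A B, a.form (ϖ A) B = a.form A (ϖ B)
  ϖ_lie : ∀ (x : l) (A : a), ϖ ⁅x, A⁆ = ⁅x, ϖ A⁆
  π_lie_mod : ∀ (x : l) (A : a), ⁅π x, A⁆ = ϖ ⁅x, A⁆

namespace TripleProj

variable {a : OrthMod.{u, v} l} (p : TripleProj a)

/-- The complementary pair of idempotents. -/
def compl : TripleProj a where
  π := LinearMap.id - p.π
  ϖ := LinearMap.id - p.ϖ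
  π_π x := by simp [p.π_π]
  ϖ_ϖ A := by simp [p.ϖ_ϖ]
  π_lie x y := by simp [p.π_lie]
  π_θ x := by simp [p.π_θ]
  ϖ_θ A := by simp [p.ϖ_θ]
  ϖ_symm A B := by simp [p.ϖ_symm]
  ϖ_lie x A := by simp [p.ϖ_lie]
  π_lie_mod x A := by simp [p.π_lie_mod]

theorem compl_π (x : l) : p.compl.π x = x - p.π x := rfl

theorem compl_ϖ (A : a) : p.compl.ϖ A = A - p.ϖ A := rfl

/-- The image of `π` as a Lie subalgebra. -/
def subalgebra : LieSubalgebra ℝ l :=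
  { LinearMap.range p.π with
    lie_mem' := by
      rintro x _ - ⟨y, rfl⟩
      exact ⟨⁅x, y⁆, p.π_lie x y⟩ }

theorem π_mem (x : l) : p.π x ∈ p.subalgebra := ⟨x, rfl⟩

theorem π_coe (x : p.subalgebra) : p.π x = x := by
  obtain ⟨_, x, rfl⟩ := x
  exact p.π_π x

theorem ϖ_coe (A : LinearMap.range p.ϖ) : p.ϖ A = A := by
  obtain ⟨_, A, rfl⟩ := A
  exact p.ϖ_ϖ A

theorem lie_mem_range (x : l) (A : LinearMap.range p.ϖ) : ⁅x, (A : a)⁆ ∈ LinearMap.range p.ϖ :=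
  ⟨⁅x, (A : a)⁆, by rw [p.ϖ_lie, p.ϖ_coe]⟩

/-- The image of `π` as a Lie algebra with involution. -/
def lieInv : LieInv.{u} where
  carrier := p.subalgebra
  finDim := inferInstanceAs (FiniteDimensional ℝ p.subalgebra.toSubmodule)
  θ :=
    { toFun := fun x => ⟨l.θ x, l.θ x, by rw [p.π_θ, p.π_coe]⟩
      map_add' := fun x y => Subtype.ext (map_add l.θ (x : l) y)
      map_smul' := fun t x => Subtype.ext (map_smul l.θ t (x : l))
      map_lie' := fun {x y} => Subtype.ext (LieHom.map_lie l.θ (x : l) y) }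
  θ_θ := fun x => Subtype.ext (l.θ_θ x)

/-- The image of `ϖ` as an orthogonal module over the image of `π`. -/
def orthMod : OrthMod.{u, v} p.lieInv :=
  letI i₁ : LieRingModule p.lieInv (LinearMap.range p.ϖ) :=
    { bracket := fun (x : p.subalgebra) A => ⟨⁅(x : l), (A : a)⁆, p.lie_mem_range x A⟩
      add_lie := fun (x y : p.subalgebra) A => Subtype.ext (add_lie (x : l) (y : l) (A : a))
      lie_add := fun (x : p.subalgebra) A B => Subtype.ext (lie_add (x : l) (A : a) (B : a))
      leibniz_lie := fun (x y : p.subalgebra) A =>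
        Subtype.ext (leibniz_lie (x : l) (y : l) (A : a)) }
  letI i₂ : LieModule ℝ p.lieInv (LinearMap.range p.ϖ) :=
    { smul_lie := fun t (x : p.subalgebra) A => Subtype.ext (smul_lie t (x : l) (A : a))
      lie_smul := fun t (x : p.subalgebra) A => Subtype.ext (lie_smul t (x : l) (A : a)) }
  { carrier := LinearMap.range p.ϖ
    form := a.form.domRestrict₁₂ _ _
    form_symm := fun (A B : LinearMap.range p.ϖ) => a.form_symm A B
    form_nondeg := fun A h => by
      refine Subtype.ext (a.form_nondeg _ fun B => ?_)
      rw [← p.ϖ_coe A, p.ϖ_symm]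
      exact h ⟨p.ϖ B, B, rfl⟩
    form_inv := fun (x : p.subalgebra) (A B : LinearMap.range p.ϖ) => a.form_inv x A B
    θ := a.θ.restrict (p := LinearMap.range p.ϖ) (q := LinearMap.range p.ϖ) fun A hA => by
      obtain ⟨A, rfl⟩ := hA
      exact ⟨a.θ A, p.ϖ_θ A⟩
    θ_θ := fun A => Subtype.ext (a.θ_θ A)
    θ_isom := fun (A B : LinearMap.range p.ϖ) => a.θ_isom A B
    θ_lie := fun (x : p.subalgebra) A => Subtype.ext (a.θ_lie (x : l) (A : a)) }

/-- The projection of `(l, θ, a)` onto the image of `(π, ϖ)`. -/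
def hom : TripleHom a p.orthMod where
  S :=
    { toFun := fun x => (⟨p.π x, p.π_mem x⟩ : p.subalgebra)
      map_add' := fun x y => Subtype.ext (map_add p.π x y)
      map_smul' := fun t x => Subtype.ext (map_smul p.π t x)
      map_lie' := fun {x y} => Subtype.ext (by
        change p.π ⁅x, y⁆ = ⁅p.π x, p.π y⁆
        rw [← p.π_lie, ← lie_skew (p.π x) y, ← p.π_lie, map_neg, p.π_π, ← map_neg, lie_skew]) }
  U := (LinearMap.range p.ϖ).subtype
  U_isom A B := rfl
  U_lie x (A : LinearMap.range p.ϖ) := by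
    change ⁅p.π x, (A : a)⁆ = ⁅x, (A : a)⁆
    rw [p.π_lie_mod, p.ϖ_lie, p.ϖ_coe]
  S_θ x := Subtype.ext (p.π_θ x)
  U_θ A := rfl

theorem hom_isNonzero (h : p.π ≠ 0 ∨ p.ϖ ≠ 0) : p.hom.IsNonzero := by
  refine h.imp (fun h e => h (LinearMap.ext fun x => ?_)) (fun h e => h (LinearMap.ext fun A => ?_))
  · exact congrArg Subtype.val (LieHom.congr_fun e x)
  · exact LinearMap.congr_fun e (⟨p.ϖ A, A, rfl⟩ : LinearMap.range p.ϖ)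

/-- A self-adjoint idempotent has range orthogonal to that of its complement, which makes the sum of
the two inclusions isometric. -/
theorem isNontrivialDecomposition (h : p.π ≠ 0 ∨ p.ϖ ≠ 0) (h' : p.compl.π ≠ 0 ∨ p.compl.ϖ ≠ 0) :
    IsNontrivialDecomposition p.hom p.compl.hom := by
  let S : l →ₗ⁅ℝ⁆ p.lieInv.prod p.compl.lieInv := LieHom.prod p.hom.S p.compl.hom.S
  let U : p.orthMod.prod p.compl.orthMod →ₗ[ℝ] a := LinearMap.coprod p.hom.U p.compl.hom.U
  have horth (A : LinearMap.range p.ϖ) (B : LinearMap.range p.compl.ϖ) :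
      a.form (A : a) (B : a) = 0 := by
    rw [← p.ϖ_coe A, p.ϖ_symm, ← p.compl.ϖ_coe B, compl_ϖ, map_sub, p.ϖ_ϖ, sub_self, map_zero]
  refine ⟨p.hom_isNonzero h, p.compl.hom_isNonzero h',
    { S := S
      U := U
      U_isom := ?_
      U_lie := ?_
      S_θ := fun x => Prod.ext (p.hom.S_θ x) (p.compl.hom.S_θ x)
      U_θ := ?_ }, ⟨⟨?_, ?_⟩, ⟨?_, ?_⟩⟩, fun x => rfl, fun A B => rfl⟩
  · rintro ⟨A₁, A₂⟩ ⟨B₁, B₂⟩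
    change a.form (p.hom.U A₁ + p.compl.hom.U A₂) (p.hom.U B₁ + p.compl.hom.U B₂) =
      p.orthMod.form A₁ B₁ + p.compl.orthMod.form A₂ B₂
    rw [map_add, map_add, LinearMap.add_apply, LinearMap.add_apply, p.hom.U_isom,
      p.compl.hom.U_isom]
    have e₁ : a.form (p.hom.U A₁) (p.compl.hom.U B₂) = 0 := horth A₁ B₂
    have e₂ : a.form (p.compl.hom.U A₂) (p.hom.U B₁) = 0 := by
      rw [a.form_symm]; exact horth B₁ A₂
    rw [e₁, e₂, zero_add, add_zero]
  · rintro x ⟨A₁, A₂⟩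
    change p.hom.U ⁅p.hom.S x, A₁⁆ + p.compl.hom.U ⁅p.compl.hom.S x, A₂⁆ =
      ⁅x, p.hom.U A₁ + p.compl.hom.U A₂⁆
    rw [p.hom.U_lie, p.compl.hom.U_lie, lie_add]
  · rintro ⟨A₁, A₂⟩
    change p.hom.U (p.orthMod.θ A₁) + p.compl.hom.U (p.compl.orthMod.θ A₂) =
      a.θ (p.hom.U A₁ + p.compl.hom.U A₂)
    rw [p.hom.U_θ, p.compl.hom.U_θ, map_add]
  · intro x y hxy
    have h₁ : p.π x = p.π y := congrArg Subtype.val (congrArg Prod.fst hxy)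
    have h₂ : x - p.π x = y - p.π y := congrArg Subtype.val (congrArg Prod.snd hxy)
    rwa [h₁, sub_left_inj] at h₂
  · rintro ⟨⟨_, x, rfl⟩, ⟨_, y, rfl⟩⟩
    refine ⟨p.π x + p.compl.π y, Prod.ext (Subtype.ext ?_) (Subtype.ext ?_)⟩
    · change p.π (p.π x + (y - p.π y)) = p.π x
      rw [map_add, map_sub, p.π_π, p.π_π, sub_self, add_zero]
    · change p.π x + (y - p.π y) - p.π (p.π x + (y - p.π y)) = y - p.π y
      rw [map_add, map_sub, p.π_π, p.π_π, sub_self, add_zero, add_sub_cancel_left]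
  · rw [injective_iff_map_eq_zero]
    rintro ⟨A₁, A₂⟩ hA
    change LinearMap.range p.ϖ at A₁
    change LinearMap.range p.compl.ϖ at A₂
    have hA' : (A₁ : a) + (A₂ : a) = 0 := hA
    have h₂ : p.ϖ (A₂ : a) = 0 := by
      rw [← p.compl.ϖ_coe A₂, compl_ϖ, map_sub, p.ϖ_ϖ, sub_self]
    have h₁ := congrArg p.ϖ hA'
    rw [map_add, p.ϖ_coe, h₂, add_zero, map_zero] at h₁
    rw [h₁, zero_add] at hA'
    exact Prod.ext (Subtype.ext h₁) (Subtype.ext hA')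
  · intro A
    refine ⟨((⟨p.ϖ A, A, rfl⟩ : LinearMap.range p.ϖ),
      (⟨p.compl.ϖ A, A, rfl⟩ : LinearMap.range p.compl.ϖ)), ?_⟩
    change p.ϖ A + (A - p.ϖ A) = A
    abel

/-- A cocycle is compatible with the idempotents `(π, ϖ)`. -/
structure Compatible (c : QuadCocycle a) : Prop where
  α_π : ∀ x y, c.α (p.π x) y = p.ϖ (c.α x y)
  γ_π : ∀ x y z, c.γ (p.π x) y z = c.γ x y (p.π z)

variable {p} {c : QuadCocycle a}

theorem Compatible.compl (h : p.Compatible c) : p.compl.Compatible c where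
  α_π x y := by rw [compl_π, compl_ϖ, map_sub, LinearMap.sub_apply, h.α_π]
  γ_π x y z := by
    rw [compl_π, compl_π, map_sub, LinearMap.sub_apply, LinearMap.sub_apply, map_sub, h.γ_π]

theorem Compatible.α_mem (h : p.Compatible c) (x y : p.subalgebra) :
    c.α x y ∈ LinearMap.range p.ϖ :=
  ⟨c.α x y, by rw [← h.α_π, p.π_coe]⟩

variable (p) in
/-- The inclusion of the image of `π`. -/
def incl : p.lieInv →ₗ[ℝ] l := p.subalgebra.toSubmodule.subtype

/-- The restriction of a compatible cocycle to the image of `(π, ϖ)`. -/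
def restrict (h : p.Compatible c) : QuadCocycle p.orthMod where
  α := LinearMap.mk₂ ℝ (fun x y => (⟨c.α (p.incl x) (p.incl y), h.α_mem x y⟩ :
      LinearMap.range p.ϖ))
    (fun x y z => Subtype.ext (LinearMap.map_add₂ c.α (p.incl x) (p.incl y) (p.incl z)))
    (fun t x y => Subtype.ext (LinearMap.map_smul₂ c.α t (p.incl x) (p.incl y)))
    (fun x y z => Subtype.ext (map_add (c.α (p.incl x)) (p.incl y) (p.incl z)))
    (fun t x y => Subtype.ext (map_smul (c.α (p.incl x)) t (p.incl y)))
  γ := LinearMap.mk₂ ℝ (fun x y => c.γ (p.incl x) (p.incl y) ∘ₗ p.incl)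
    (fun x y z => by ext; simp) (fun t x y => by ext; simp)
    (fun x y z => by ext; simp) (fun t x y => by ext; simp)
  α_self (x : p.subalgebra) := Subtype.ext (c.α_self x)
  γ_self_left (x y : p.subalgebra) := c.γ_self_left x y
  γ_self_right (x y : p.subalgebra) := c.γ_self_right x y
  dα (x y z : p.subalgebra) := Subtype.ext (c.dα x y z)
  dγ (x y z w : p.subalgebra) := c.dγ x y z w
  α_θ (x y : p.subalgebra) := Subtype.ext (c.α_θ x y)
  γ_θ (x y z : p.subalgebra) := c.γ_θ x y z

/-- Alternation lets π move between any two slots of γ, and then idempotency merges the copies. -/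
theorem Compatible.γ_π_π (h : p.Compatible c) (x y z : l) :
    c.γ (p.π x) (p.π y) (p.π z) = c.γ (p.π x) y z := by
  have hs (x y z : l) : c.γ x (p.π y) z = c.γ (p.π x) y z := by
    rw [c.γ_swap_left, h.γ_π, c.γ_swap_left, neg_neg, ← h.γ_π]
  rw [← h.γ_π, p.π_π, hs, p.π_π]

/-- All mixed terms of α and γ between the images of π and 1 - π vanish, so the cocycle itself is
the sum of the pullbacks of its two restrictions. -/
theorem Compatible.isDecomposable (h : p.Compatible c) (h₁ : p.π ≠ 0 ∨ p.ϖ ≠ 0)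
    (h₂ : p.compl.π ≠ 0 ∨ p.compl.ϖ ≠ 0) : c.toClass.IsDecomposable := by
  refine ⟨p.lieInv, p.compl.lieInv, p.orthMod, p.compl.orthMod, p.hom, p.compl.hom,
    p.isNontrivialDecomposition h₁ h₂, restrict h, restrict h.compl, c, rfl, ?_, ?_⟩
  · refine LinearMap.ext fun x => LinearMap.ext fun y => ?_
    change c.α x y = c.α (p.π x) (p.π y) + c.α (p.compl.π x) (p.compl.π y)
    rw [h.α_π, h.compl.α_π, c.α_swap x (p.π y), c.α_swap x (p.compl.π y), h.α_π, h.compl.α_π,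
      map_neg, map_neg, p.ϖ_ϖ, p.compl.ϖ_ϖ, compl_ϖ, c.α_swap x y]
    abel
  · refine LinearMap.ext fun x => LinearMap.ext fun y => LinearMap.ext fun z => ?_
    change c.γ x y z =
      c.γ (p.π x) (p.π y) (p.π z) + c.γ (p.compl.π x) (p.compl.π y) (p.compl.π z)
    rw [h.γ_π_π, h.compl.γ_π_π, compl_π, map_sub, LinearMap.sub_apply, LinearMap.sub_apply]
    ring

end TripleProj

end Splitting

/-! ### Decompositions of the standard model -/

section Decomposition

variable {l : LieInv.{u}} {a : OrthMod.{u, v} l} {c : QuadCocycle a}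

/-- A self-adjoint idempotent of the centroid of the standard model that commutes with the
involution; these correspond to the orthogonal decompositions of the standard model. -/
structure IsSplitting (P : StdModel c →ₗ[ℝ] StdModel c) : Prop extends IsSelfAdjointCentroid P where
  idem : ∀ X, P (P X) = P X
  map_θ : ∀ X, P (StdModel.θ c X) = StdModel.θ c (P X)

theorem IsSplitting.id_sub {P : StdModel c →ₗ[ℝ] StdModel c} (hP : IsSplitting P) :
    IsSplitting (LinearMap.id - P) where
  lie X Y := by simp [hP.lie]
  symm X Y := by simp [hP.symm]
  idem X := by simp [hP.idem]
  map_θ X := by simp [hP.map_θ]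

/-- The linear inclusion of `l` into the standard model. -/
def StdModel.inclL (c : QuadCocycle a) : l →ₗ[ℝ] StdModel c where
  toFun x := StdModel.ofL c x
  map_add' x y := StdModel.ext (by simp [ofL]) (by simp [ofL]) rfl
  map_smul' t x := StdModel.ext (by simp [ofL]) (by simp [ofL]) rfl

/-- The linear inclusion of `a` into the standard model. -/
def StdModel.inclA (c : QuadCocycle a) : a →ₗ[ℝ] StdModel c where
  toFun A := StdModel.ofA c A
  map_add' A B := StdModel.ext (by simp [ofA]) rfl (by simp [ofA])
  map_smul' t A := StdModel.ext (by simp [ofA]) rfl (by simp [ofA])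

/-- The projection of the standard model onto `a`. -/
def StdModel.projA (c : QuadCocycle a) : StdModel c →ₗ[ℝ] a where
  toFun X := X.A
  map_add' _ _ := rfl
  map_smul' _ _ := rfl

/-- The projection of the standard model onto `l^*`. -/
def StdModel.projZ (c : QuadCocycle a) : StdModel c →ₗ[ℝ] Module.Dual ℝ l where
  toFun X := X.Z
  map_add' _ _ := rfl
  map_smul' _ _ := rfl

theorem StdModel.eq_add (X : StdModel c) :
    X = StdModel.ofZ c X.Z + StdModel.ofA c X.A + StdModel.ofL c X.L :=
  StdModel.ext (by simp [ofZ, ofA, ofL]) (by simp [ofZ, ofA, ofL]) (by simp [ofZ, ofA, ofL])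

namespace IsSplitting

variable {P : StdModel c →ₗ[ℝ] StdModel c}

/-- P preserves l^* ⊕ a, hence descends to the quotient l. -/
theorem L_eq (hP : IsSplitting P) (ha : a.IsSemisimple) (hc : c.IsAdmissible) (X : StdModel c) :
    (P X).L = (P (StdModel.ofL c X.L)).L := by
  conv_lhs => rw [X.eq_add]
  rw [map_add, map_add, StdModel.add_L, StdModel.add_L, hP.ofZ_L hc, hP.ofA_L ha hc, zero_add,
    zero_add]

theorem A_eq (hP : IsSplitting P) (ha : a.IsSemisimple) (hc : c.IsAdmissible) (X : StdModel c) :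
    (P X).A = (P (StdModel.ofA c X.A)).A + (P (StdModel.ofL c X.L)).A := by
  conv_lhs => rw [X.eq_add]
  rw [map_add, map_add, StdModel.add_A, StdModel.add_A, hP.ofZ_A ha hc, zero_add]

/-- P acts on the subquotient (l^* ⊕ a) / l^*, which is a. -/
theorem A_eq_of_L (hP : IsSplitting P) (ha : a.IsSemisimple) (hc : c.IsAdmissible) {X : StdModel c}
    (hX : X.L = 0) : (P X).A = (P (StdModel.ofA c X.A)).A := by
  have : StdModel.ofL c (0 : l) = 0 := rfl
  rw [hP.A_eq ha hc, hX, this, map_zero, StdModel.zero_A, add_zero]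

/-- The idempotents induced by a splitting on `l` and `a`. -/
def tripleProj (hP : IsSplitting P) (ha : a.IsSemisimple) (hc : c.IsAdmissible) :
    TripleProj a where
  π := StdModel.projL c ∘ₗ P ∘ₗ StdModel.inclL c
  ϖ := StdModel.projA c ∘ₗ P ∘ₗ StdModel.inclA c
  π_π x := by
    change (P (StdModel.ofL c (P (StdModel.ofL c x)).L)).L = (P (StdModel.ofL c x)).L
    rw [← hP.L_eq ha hc, hP.idem]
  ϖ_ϖ A := by
    change (P (StdModel.ofA c (P (StdModel.ofA c A)).A)).A = (P (StdModel.ofA c A)).A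
    rw [← hP.A_eq_of_L ha hc (hP.ofA_L ha hc A), hP.idem]
  π_lie x y := by
    change (P (StdModel.ofL c ⁅x, y⁆)).L = ⁅x, (P (StdModel.ofL c y)).L⁆
    have := hP.L_eq ha hc ⁅StdModel.ofL c x, StdModel.ofL c y⁆
    rw [hP.lie] at this
    exact this.symm
  π_θ x := by
    change (P (StdModel.ofL c (l.θ x))).L = l.θ (P (StdModel.ofL c x)).L
    have h := hP.map_θ (StdModel.ofL c x)
    have h' := hP.L_eq ha hc (StdModel.θ c (StdModel.ofL c x))
    rw [h] at h'
    exact h'.symm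
  ϖ_θ A := by
    change (P (StdModel.ofA c (a.θ A))).A = a.θ (P (StdModel.ofA c A)).A
    have h := hP.map_θ (StdModel.ofA c A)
    have h' := hP.A_eq_of_L ha hc (X := StdModel.θ c (StdModel.ofA c A)) (map_zero l.θ)
    rw [h] at h'
    exact h'.symm
  ϖ_symm A B := by
    have h := hP.symm (StdModel.ofA c A) (StdModel.ofA c B)
    rwa [StdModel.form_ofA, StdModel.form_comm, StdModel.form_ofA, a.form_symm] at h
  ϖ_lie x A := by
    change (P (StdModel.ofA c ⁅x, A⁆)).A = ⁅x, (P (StdModel.ofA c A)).A⁆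
    have h := hP.A_eq_of_L ha hc (X := ⁅StdModel.ofL c x, StdModel.ofA c A⁆) (lie_zero x)
    rw [hP.lie, StdModel.lie_ofL_A, StdModel.lie_ofL_A, hP.ofA_L ha hc, map_zero, add_zero] at h
    simpa [StdModel.ofA] using h.symm
  π_lie_mod x A := by
    change ⁅(P (StdModel.ofL c x)).L, A⁆ = (P (StdModel.ofA c ⁅x, A⁆)).A
    -- Bracketing with A on the left places P on the l-argument: P[A, x] = [A, Px], whose
    -- a-component is -ρ(πx)A.
    have h := hP.A_eq_of_L ha hc (X := ⁅StdModel.ofA c A, StdModel.ofL c x⁆) (zero_lie x)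
    rw [hP.lie] at h
    have e : StdModel.ofA c ⁅StdModel.ofA c A, StdModel.ofL c x⁆.A = -StdModel.ofA c ⁅x, A⁆ :=
      StdModel.ext (by simp [StdModel.ofA]) (by simp [StdModel.ofA, StdModel.ofL, StdModel.lie_A])
        (by simp [StdModel.ofA])
    rw [e, map_neg, StdModel.neg_A] at h
    simpa [StdModel.ofA, StdModel.lie_A] using h

theorem π_apply (hP : IsSplitting P) (ha : a.IsSemisimple) (hc : c.IsAdmissible) (x : l) :
    (hP.tripleProj ha hc).π x = (P (StdModel.ofL c x)).L := rfl

theorem ϖ_apply (hP : IsSplitting P) (ha : a.IsSemisimple) (hc : c.IsAdmissible) (A : a) :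
    (hP.tripleProj ha hc).ϖ A = (P (StdModel.ofA c A)).A := rfl

theorem ofZ_Z (hP : IsSplitting P) (ha : a.IsSemisimple) (hc : c.IsAdmissible)
    (ζ : Module.Dual ℝ l) (x : l) :
    (P (StdModel.ofZ c ζ)).Z x = ζ ((hP.tripleProj ha hc).π x) := by
  rw [π_apply, hP.apply_L, StdModel.form_comm, StdModel.form_ofL]

/-- If π = 0 and ϖ = 0, then P is zero on each graded piece of the flag, the piece l^* carrying the
transpose of π. So P is nilpotent, and an idempotent nilpotent map is zero. -/
theorem π_ne_zero_or (hP : IsSplitting P) (ha : a.IsSemisimple) (hc : c.IsAdmissible)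
    (h : P ≠ 0) : (hP.tripleProj ha hc).π ≠ 0 ∨ (hP.tripleProj ha hc).ϖ ≠ 0 := by
  by_contra hn
  push Not at hn
  obtain ⟨hπ, hϖ⟩ := hn
  apply h
  refine LinearMap.ext fun X => ?_
  have hL (X : StdModel c) : (P X).L = 0 := by
    rw [hP.L_eq ha hc, ← hP.π_apply ha hc, hπ, LinearMap.zero_apply]
  have hA (X : StdModel c) : (P X).A = 0 := by
    rw [← hP.idem, hP.A_eq_of_L ha hc (hL X), ← hP.ϖ_apply ha hc, hϖ, LinearMap.zero_apply]
  have hX : P X = StdModel.ofZ c (P X).Z := StdModel.ext rfl (hA X) (hL X)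
  refine StdModel.ext (LinearMap.ext fun x => ?_) (hA X) (hL X)
  rw [← hP.idem, hX, hP.ofZ_Z ha hc, hπ, LinearMap.zero_apply, map_zero]
  rfl

theorem compl_π_ne_zero_or (hP : IsSplitting P) (ha : a.IsSemisimple) (hc : c.IsAdmissible)
    (h : LinearMap.id - P ≠ 0) :
    (hP.tripleProj ha hc).compl.π ≠ 0 ∨ (hP.tripleProj ha hc).compl.ϖ ≠ 0 :=
  hP.id_sub.π_ne_zero_or ha hc h

/-- A section of `StdModel c → l` that intertwines `π` and `P`. -/
def sectionAux (hP : IsSplitting P) (ha : a.IsSemisimple) (hc : c.IsAdmissible) :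
    l →ₗ[ℝ] StdModel c :=
  P ∘ₗ StdModel.inclL c ∘ₗ (hP.tripleProj ha hc).π +
    (LinearMap.id - P) ∘ₗ StdModel.inclL c ∘ₗ (hP.tripleProj ha hc).compl.π

theorem sectionAux_L (hP : IsSplitting P) (ha : a.IsSemisimple) (hc : c.IsAdmissible) (x : l) :
    (hP.sectionAux ha hc x).L = x := by
  set p := hP.tripleProj ha hc with hp
  have h : (hP.sectionAux ha hc x).L = p.π (p.π x) + (p.compl.π x - p.π (p.compl.π x)) := rfl
  rw [h, p.compl_π, map_sub, p.π_π]
  abel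

theorem apply_sectionAux (hP : IsSplitting P) (ha : a.IsSemisimple) (hc : c.IsAdmissible) (x : l) :
    P (hP.sectionAux ha hc x) = hP.sectionAux ha hc ((hP.tripleProj ha hc).π x) := by
  set p := hP.tripleProj ha hc with hp
  have h (x : l) : hP.sectionAux ha hc x =
      P (StdModel.inclL c (p.π x)) + (StdModel.inclL c (p.compl.π x) -
        P (StdModel.inclL c (p.compl.π x))) := rfl
  rw [h, h, map_add, map_sub, hP.idem, hP.idem, sub_self, p.π_π, p.compl_π (p.π x), p.π_π, sub_self,
    map_zero, map_zero, sub_zero]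

theorem sectionAux_θ (hP : IsSplitting P) (ha : a.IsSemisimple) (hc : c.IsAdmissible) (x : l) :
    hP.sectionAux ha hc (l.θ x) = StdModel.θ c (hP.sectionAux ha hc x) := by
  set p := hP.tripleProj ha hc with hp
  have h (x : l) : hP.sectionAux ha hc x =
      P (StdModel.inclL c (p.π x)) + (StdModel.inclL c (p.compl.π x) -
        P (StdModel.inclL c (p.compl.π x))) := rfl
  have hi (x : l) : StdModel.inclL c (l.θ x) = StdModel.θ c (StdModel.inclL c x) :=
    StdModel.ext (by ext; simp [StdModel.inclL, StdModel.ofL])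
      (by simp [StdModel.inclL, StdModel.ofL]) rfl
  rw [h, h, p.π_θ, p.compl.π_θ, hi, hi, hP.map_θ, hP.map_θ, map_add, map_sub]

/-- A splitting of the standard model of an admissible cocycle is block diagonal with respect to an
equivalent cocycle. -/
theorem exists_compatible (hP : IsSplitting P) (ha : a.IsSemisimple) (hc : c.IsAdmissible) :
    ∃ c', c.Equiv c' ∧ (hP.tripleProj ha hc).Compatible c' := by
  let p := hP.tripleProj ha hc
  let s₁ := hP.sectionAux ha hc
  let τ : l →ₗ[ℝ] a := StdModel.projA c ∘ₗ s₁
  let ζ : l →ₗ[ℝ] l →ₗ[ℝ] ℝ := StdModel.projZ c ∘ₗ s₁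
  -- A 2-cochain must be alternating, so only the skew part of the l^*-component of s₁ is used; the
  -- symmetric part is accounted for by ω below.
  let σ : l →ₗ[ℝ] l →ₗ[ℝ] ℝ := (1 / 2 : ℝ) • (ζ - ζ.flip)
  have hσ_apply (x y : l) : σ x y = 1 / 2 * ((s₁ x).Z y - (s₁ y).Z x) := rfl
  have hL (x : l) : (s₁ x).L = x := hP.sectionAux_L ha hc x
  have hτθ (x : l) : a.θ (τ (l.θ x)) = τ x := by
    change a.θ (s₁ (l.θ x)).A = (s₁ x).A
    rw [hP.sectionAux_θ ha hc x, StdModel.θ_A, a.θ_θ]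
  have hσ (x : l) : σ x x = 0 := by rw [hσ_apply, sub_self, mul_zero]
  have hσθ (x y : l) : σ (l.θ x) (l.θ y) = σ x y := by
    rw [hσ_apply, hσ_apply, hP.sectionAux_θ ha hc x, hP.sectionAux_θ ha hc y, StdModel.θ_Z,
      StdModel.θ_Z, l.θ_θ, l.θ_θ]
  let ω : l →ₗ[ℝ] l →ₗ[ℝ] ℝ := (StdModel.form c).compl₁₂ s₁ s₁
  have hω (x y : l) : ω x y = StdModel.form c (s₁ x) (s₁ y) := rfl
  let s := shearSection c τ σ
  -- The sheared section is s₁ made isotropic: half of its Gram form ω is subtracted in l^*.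
  have hs (x : l) : s x = s₁ x - (1 / 2 : ℝ) • StdModel.ofZ c (ω x) := by
    refine StdModel.ext (LinearMap.ext fun y => ?_) ?_ ?_
    · change σ x y - (1 / 2) * a.form (s₁ x).A (s₁ y).A = (s₁ x).Z y - (1 / 2) * ω x y
      rw [hσ_apply, hω, StdModel.form_apply, hL, hL]
      ring
    · change (s₁ x).A = (s₁ x).A - (1 / 2 : ℝ) • 0
      rw [smul_zero, sub_zero]
    · change x = (s₁ x).L - (1 / 2 : ℝ) • 0
      rw [smul_zero, sub_zero, hL]
  have hPs (x : l) : P (s x) = s (p.π x) := by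
    -- P acts on l^* as the transpose of π, and ω(x, πy) = ω(πx, y) because s₁ intertwines π with
    -- the self-adjoint P. So the isotropic correction keeps the intertwining property.
    have e : P (StdModel.ofZ c (ω x)) = StdModel.ofZ c (ω (p.π x)) := by
      refine StdModel.ext (LinearMap.ext fun y => ?_) (hP.ofZ_A ha hc _) (hP.ofZ_L hc _)
      rw [hP.ofZ_Z ha hc, hω]
      change _ = ω (p.π x) y
      rw [hω, ← hP.apply_sectionAux ha hc x, hP.symm, hP.apply_sectionAux ha hc y]
    rw [hs, hs, map_sub, map_smul, e, hP.apply_sectionAux ha hc x]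
  have hsL (x : l) : (s x).L = x := rfl
  refine ⟨c.act τ σ hτθ hσ hσθ, c.equiv_act τ σ hτθ hσ hσθ, fun x y => ?_, fun x y z => ?_⟩
  -- The new α is the a-component of the curvature [s(x), s(y)] - s([x, y]). That has no
  -- l-component, so P acts on its a-component through ϖ.
  · have hW (x y : l) : (c.act τ σ hτθ hσ hσθ).α x y = (⁅s x, s y⁆ - s ⁅x, y⁆).A := by
      change c.α x y + (⁅x, τ y⁆ - ⁅y, τ x⁆ - τ ⁅x, y⁆) =
        ⁅x, τ y⁆ - ⁅y, τ x⁆ + c.α x y - τ ⁅x, y⁆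
      abel
    have hπ : ⁅p.π x, y⁆ = p.π ⁅x, y⁆ := by
      rw [← lie_skew, ← p.π_lie, ← map_neg, lie_skew]
    have hPlie : P ⁅s x, s y⁆ = ⁅P (s x), s y⁆ := by
      rw [← lie_skew, map_neg, hP.lie, lie_skew]
    have h0 : (⁅s x, s y⁆ - s ⁅x, y⁆).L = 0 := sub_self ⁅x, y⁆
    change (c.act τ σ hτθ hσ hσθ).α (p.π x) y = p.ϖ _
    rw [hW, hW, ← hPs, hπ, ← hPs, ← hPlie, ← map_sub, hP.A_eq_of_L ha hc h0]
    rfl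
  · change StdModel.form c ⁅s (p.π x), s y⁆ (s z) = StdModel.form c ⁅s x, s y⁆ (s (p.π z))
    rw [← hPs, ← hPs, ← hP.symm, ← lie_skew (P (s x)), ← hP.lie, ← map_neg, lie_skew]

theorem isDecomposable (hP : IsSplitting P) (ha : a.IsSemisimple) (hc : c.IsAdmissible)
    (h : P ≠ 0) (h' : LinearMap.id - P ≠ 0) : c.toClass.IsDecomposable := by
  obtain ⟨c', hcc', hc'⟩ := hP.exists_compatible ha hc
  have e : c.toClass = c'.toClass := Quotient.sound hcc'
  rw [e]
  exact hc'.isDecomposable (hP.π_ne_zero_or ha hc h) (hP.compl_π_ne_zero_or ha hc h')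

end IsSplitting

/-- If the standard model of an admissible cocycle is a non-trivial direct sum, then its class is
decomposable. -/
theorem QuadCocycle.isDecomposable_of_isIsomorphic (ha : a.IsSemisimple) (hc : c.IsAdmissible)
    {g₁ g₂ : MetricLieInv.{max u v}} (h₁ : Nontrivial g₁.carrier) (h₂ : Nontrivial g₂.carrier)
    (h : (stdModel c).IsIsomorphic (g₁.prod g₂)) : c.toClass.IsDecomposable := by
  obtain ⟨Ψ₀, hθ, hf⟩ := h
  let Ψ : StdModel c ≃ₗ⁅ℝ⁆ g₁.carrier × g₂.carrier := Ψ₀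
  have hΨθ (X : StdModel c) : Ψ (StdModel.θ c X) = (g₁.θ (Ψ X).1, g₂.θ (Ψ X).2) := hθ X
  have hΨf (X Y : StdModel c) :
      g₁.form (Ψ X).1 (Ψ Y).1 + g₂.form (Ψ X).2 (Ψ Y).2 = StdModel.form c X Y := hf X Y
  -- P is the projection onto the first summand, transported to the standard model.
  let P : StdModel c →ₗ[ℝ] StdModel c := (Ψ.symm : _ →ₗ[ℝ] StdModel c) ∘ₗ
    LinearMap.inl ℝ g₁.carrier g₂.carrier ∘ₗ LinearMap.fst ℝ g₁.carrier g₂.carrier ∘ₗ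
    (Ψ : StdModel c →ₗ[ℝ] g₁.carrier × g₂.carrier)
  have hP (X : StdModel c) : Ψ (P X) = ((Ψ X).1, 0) := Ψ.apply_symm_apply _
  have hsplit : IsSplitting P :=
    { lie := fun X Y => by
        apply Ψ.injective
        change Ψ _ = Ψ _
        rw [hP, LieEquiv.map_lie, LieEquiv.map_lie, hP]
        exact Prod.ext rfl (lie_zero _).symm
      symm := fun X Y => by
        rw [← hΨf, ← hΨf, hP, hP, map_zero, map_zero, LinearMap.zero_apply]
      idem := fun X => by
        apply Ψ.injective
        change Ψ _ = Ψ _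
        rw [hP, hP]
      map_θ := fun X => by
        apply Ψ.injective
        change Ψ _ = Ψ _
        rw [hP, hΨθ, hΨθ, hP, map_zero] }
  obtain ⟨y₁, hy₁⟩ := exists_ne (0 : g₁.carrier)
  obtain ⟨y₂, hy₂⟩ := exists_ne (0 : g₂.carrier)
  refine hsplit.isDecomposable ha hc (fun h0 => hy₁ ?_) (fun h0 => hy₂ ?_)
  · have := hP (Ψ.symm (y₁, 0))
    rw [h0, LinearMap.zero_apply, map_zero, LieEquiv.apply_symm_apply] at this
    exact (congrArg Prod.fst this).symm
  · have e : Ψ.symm (0, y₂) = P (Ψ.symm (0, y₂)) :=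
      sub_eq_zero.1 (LinearMap.congr_fun h0 (Ψ.symm (0, y₂)))
    have := hP (Ψ.symm (0, y₂))
    rw [← e, LieEquiv.apply_symm_apply] at this
    exact congrArg Prod.snd this

end Decomposition

/-! ### Decomposable classes -/

section Decomposable

variable {l l₁ l₂ : LieInv.{u}} {a : OrthMod.{u, v} l} {a₁ : OrthMod.{u, v} l₁}
  {a₂ : OrthMod.{u, v} l₂} {T₁ : TripleHom a a₁} {T₂ : TripleHom a a₂}

namespace IsNontrivialDecomposition

theorem S_injective (hT : IsNontrivialDecomposition T₁ T₂) {x y : l} (h₁ : T₁.S x = T₁.S y)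
    (h₂ : T₂.S x = T₂.S y) : x = y := by
  obtain ⟨-, -, T, ⟨hS, -⟩, hTS, -⟩ := hT
  refine hS.1 ?_
  rw [hTS, hTS, h₁, h₂]

/-- The isomorphism `l ≃ l₁ ⊕ l₂` of a decomposition. -/
noncomputable def equivL (hT : IsNontrivialDecomposition T₁ T₂) : l ≃ₗ[ℝ] l₁ × l₂ :=
  LinearEquiv.ofBijective (LinearMap.prod (T₁.S : l →ₗ[ℝ] l₁) (T₂.S : l →ₗ[ℝ] l₂)) <| by
    obtain ⟨-, -, T, ⟨hS, -⟩, hTS, -⟩ := hT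
    have e : ⇑T.S = fun x => ((T₁.S x, T₂.S x) : l₁ × l₂) := funext hTS
    rw [e] at hS
    exact hS

theorem S_equivL_symm_left (hT : IsNontrivialDecomposition T₁ T₂) (x : l₁ × l₂) :
    T₁.S (hT.equivL.symm x) = x.1 :=
  congrArg Prod.fst (hT.equivL.apply_symm_apply x)

theorem S_equivL_symm_right (hT : IsNontrivialDecomposition T₁ T₂) (x : l₁ × l₂) :
    T₂.S (hT.equivL.symm x) = x.2 :=
  congrArg Prod.snd (hT.equivL.apply_symm_apply x)

theorem exists_U_add_U (hT : IsNontrivialDecomposition T₁ T₂) (A : a) :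
    ∃ A₁ A₂, A = T₁.U A₁ + T₂.U A₂ := by
  obtain ⟨-, -, T, ⟨-, hU⟩, -, hTU⟩ := hT
  obtain ⟨⟨A₁, A₂⟩, rfl⟩ := hU.2 A
  exact ⟨A₁, A₂, hTU A₁ A₂⟩

theorem form_U_U (hT : IsNontrivialDecomposition T₁ T₂) (A₁ : a₁) (A₂ : a₂) :
    a.form (T₁.U A₁) (T₂.U A₂) = 0 := by
  obtain ⟨-, -, T, -, -, hTU⟩ := hT
  have h := T.U_isom ((A₁, 0) : a₁ × a₂) ((0, A₂) : a₁ × a₂)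
  rw [hTU, hTU, map_zero, map_zero, add_zero, zero_add] at h
  rw [h]
  change a₁.form A₁ 0 + a₂.form 0 A₂ = 0
  rw [map_zero, map_zero, LinearMap.zero_apply, add_zero]

theorem form_U_U' (hT : IsNontrivialDecomposition T₁ T₂) (A₁ : a₁) (A₂ : a₂) :
    a.form (T₂.U A₂) (T₁.U A₁) = 0 := by
  rw [a.form_symm, hT.form_U_U]

/-- The linear map from the direct sum of the standard models of the summands to the standard
model. -/
noncomputable def stdModelMap (hT : IsNontrivialDecomposition T₁ T₂) (c₁ : QuadCocycle a₁)
    (c₂ : QuadCocycle a₂) (c : QuadCocycle a) : StdModel c₁ × StdModel c₂ →ₗ[ℝ] StdModel c where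
  toFun X := ⟨X.1.Z ∘ₗ (T₁.S : l →ₗ[ℝ] l₁) + X.2.Z ∘ₗ (T₂.S : l →ₗ[ℝ] l₂),
    T₁.U X.1.A + T₂.U X.2.A, hT.equivL.symm (X.1.L, X.2.L)⟩
  map_add' X Y := StdModel.ext (by ext; simp; ring) (by simp; abel)
    (map_add hT.equivL.symm (X.1.L, X.2.L) (Y.1.L, Y.2.L))
  map_smul' t X := StdModel.ext (by ext; simp) (by simp)
    (map_smul hT.equivL.symm t (X.1.L, X.2.L))

variable {c₁ : QuadCocycle a₁} {c₂ : QuadCocycle a₂} {c : QuadCocycle a}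

theorem stdModelMap_Z (hT : IsNontrivialDecomposition T₁ T₂) (X : StdModel c₁ × StdModel c₂)
    (x : l) : (hT.stdModelMap c₁ c₂ c X).Z x = X.1.Z (T₁.S x) + X.2.Z (T₂.S x) := rfl

theorem stdModelMap_A (hT : IsNontrivialDecomposition T₁ T₂) (X : StdModel c₁ × StdModel c₂) :
    (hT.stdModelMap c₁ c₂ c X).A = T₁.U X.1.A + T₂.U X.2.A := rfl

theorem S_stdModelMap_L (hT : IsNontrivialDecomposition T₁ T₂) (X : StdModel c₁ × StdModel c₂) :
    T₁.S (hT.stdModelMap c₁ c₂ c X).L = X.1.L :=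
  hT.S_equivL_symm_left (X.1.L, X.2.L)

theorem S_stdModelMap_L' (hT : IsNontrivialDecomposition T₁ T₂) (X : StdModel c₁ × StdModel c₂) :
    T₂.S (hT.stdModelMap c₁ c₂ c X).L = X.2.L :=
  hT.S_equivL_symm_right (X.1.L, X.2.L)

theorem form_stdModelMap (hT : IsNontrivialDecomposition T₁ T₂) (X Y : StdModel c₁ × StdModel c₂) :
    StdModel.form c (hT.stdModelMap c₁ c₂ c X) (hT.stdModelMap c₁ c₂ c Y) =
      StdModel.form c₁ X.1 Y.1 + StdModel.form c₂ X.2 Y.2 := by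
  simp only [StdModel.form_apply, stdModelMap_Z, stdModelMap_A, S_stdModelMap_L, S_stdModelMap_L',
    map_add, LinearMap.add_apply, T₁.U_isom, T₂.U_isom, hT.form_U_U, hT.form_U_U']
  ring

theorem stdModelMap_bijective (hT : IsNontrivialDecomposition T₁ T₂) :
    Function.Bijective (hT.stdModelMap c₁ c₂ c) := by
  constructor
  · rw [injective_iff_map_eq_zero]
    intro X hX
    -- An isometric map out of a non-degenerate space is injective.
    refine ((stdModel c₁).prod (stdModel c₂)).form_nondeg X fun Y => ?_
    have h := hT.form_stdModelMap (c := c) X Y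
    rw [hX, map_zero, LinearMap.zero_apply] at h
    exact h.symm
  · rintro ⟨Z, A, x⟩
    obtain ⟨A₁, A₂, rfl⟩ := hT.exists_U_add_U A
    refine ⟨(⟨Z ∘ₗ hT.equivL.symm.toLinearMap ∘ₗ LinearMap.inl ℝ l₁ l₂, A₁, T₁.S x⟩,
      ⟨Z ∘ₗ hT.equivL.symm.toLinearMap ∘ₗ LinearMap.inr ℝ l₁ l₂, A₂, T₂.S x⟩),
      StdModel.ext (LinearMap.ext fun y => ?_) rfl (hT.equivL.symm_apply_apply x)⟩
    change Z (hT.equivL.symm (T₁.S y, 0)) + Z (hT.equivL.symm (0, T₂.S y)) = Z y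
    rw [← map_add, ← map_add, Prod.mk_add_mk, add_zero, zero_add]
    exact congrArg Z (hT.equivL.symm_apply_apply y)

theorem stdModelMap_θ (hT : IsNontrivialDecomposition T₁ T₂) (X : StdModel c₁ × StdModel c₂) :
    hT.stdModelMap c₁ c₂ c (StdModel.θ c₁ X.1, StdModel.θ c₂ X.2) =
      StdModel.θ c (hT.stdModelMap c₁ c₂ c X) := by
  refine StdModel.ext (LinearMap.ext fun x => ?_) ?_ (hT.S_injective ?_ ?_)
  · simp only [stdModelMap_Z, StdModel.θ_Z, T₁.S_θ, T₂.S_θ]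
  · simp only [stdModelMap_A, StdModel.θ_A, map_add, T₁.U_θ, T₂.U_θ]
  · rw [StdModel.θ_L, T₁.S_θ, S_stdModelMap_L, S_stdModelMap_L, StdModel.θ_L]
  · rw [StdModel.θ_L, T₂.S_θ, S_stdModelMap_L', S_stdModelMap_L', StdModel.θ_L]

theorem stdModelMap_lie (hT : IsNontrivialDecomposition T₁ T₂)
    (hα : c.α = (T₁.pullback c₁).α + (T₂.pullback c₂).α)
    (hγ : c.γ = (T₁.pullback c₁).γ + (T₂.pullback c₂).γ) (X Y : StdModel c₁ × StdModel c₂) :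
    hT.stdModelMap c₁ c₂ c (⁅X.1, Y.1⁆, ⁅X.2, Y.2⁆) =
      ⁅hT.stdModelMap c₁ c₂ c X, hT.stdModelMap c₁ c₂ c Y⁆ := by
  have hα' (x y : l) : c.α x y = T₁.U (c₁.α (T₁.S x) (T₁.S y)) + T₂.U (c₂.α (T₂.S x) (T₂.S y)) := by
    rw [hα]; rfl
  have hγ' (x y z : l) : c.γ x y z =
      c₁.γ (T₁.S x) (T₁.S y) (T₁.S z) + c₂.γ (T₂.S x) (T₂.S y) (T₂.S z) := by
    rw [hγ]; rfl
  refine StdModel.ext (LinearMap.ext fun x => ?_) ?_ (hT.S_injective ?_ ?_)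
  · simp only [stdModelMap_Z, StdModel.lie_Z, stdModelMap_A, hα', hγ', S_stdModelMap_L,
      S_stdModelMap_L', map_add, LinearMap.add_apply, lie_add, ← T₁.U_lie, ← T₂.U_lie, T₁.U_isom,
      T₂.U_isom, hT.form_U_U, hT.form_U_U', LieHom.map_lie]
    ring
  · simp only [stdModelMap_A, StdModel.lie_A, hα', S_stdModelMap_L, S_stdModelMap_L', lie_add,
      ← T₁.U_lie, ← T₂.U_lie, map_add, map_sub]
    abel
  · rw [StdModel.lie_L, LieHom.map_lie, S_stdModelMap_L, S_stdModelMap_L, S_stdModelMap_L,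
      StdModel.lie_L]
  · rw [StdModel.lie_L, LieHom.map_lie, S_stdModelMap_L', S_stdModelMap_L', S_stdModelMap_L',
      StdModel.lie_L]

theorem isIsomorphic_prod (hT : IsNontrivialDecomposition T₁ T₂)
    (hα : c.α = (T₁.pullback c₁).α + (T₂.pullback c₂).α)
    (hγ : c.γ = (T₁.pullback c₁).γ + (T₂.pullback c₂).γ) :
    (stdModel c).IsIsomorphic ((stdModel c₁).prod (stdModel c₂)) := by
  let Φ : StdModel c₁ × StdModel c₂ →ₗ⁅ℝ⁆ StdModel c :=
    { hT.stdModelMap c₁ c₂ c with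
      map_lie' := fun {X Y} => hT.stdModelMap_lie hα hγ X Y }
  let Ψ : (StdModel c₁ × StdModel c₂) ≃ₗ⁅ℝ⁆ StdModel c :=
    LieEquiv.ofBijective Φ hT.stdModelMap_bijective
  exact MetricLieInv.IsIsomorphic.symm (g := (stdModel c₁).prod (stdModel c₂))
    ⟨Ψ, fun X => hT.stdModelMap_θ X, fun X Y => hT.form_stdModelMap X Y⟩

end IsNontrivialDecomposition

theorem TripleHom.IsNonzero.nontrivial_stdModel {T : TripleHom a a₁} (hT : T.IsNonzero)
    (c₁ : QuadCocycle a₁) : Nontrivial (StdModel c₁) := by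
  rw [← not_subsingleton_iff_nontrivial]
  intro h
  refine hT.elim (fun hS => hS ?_) (fun hU => hU ?_)
  · ext x
    exact congrArg StdModel.L (h.elim (StdModel.ofL c₁ (T.S x)) 0)
  · ext A
    have : A = 0 := congrArg StdModel.A (h.elim (StdModel.ofA c₁ A) 0)
    rw [this, map_zero, map_zero]

end Decomposable

end SymTriple

/-! ### The proposition -/

open SymTriple in
theorem proposition5p2 (l : LieInv.{u}) (hl : l.IsAdmissible) (a : OrthMod.{u, v} l)
    (c : QuadCocycle a) (hc : c.toClass ∈ admissibleClasses a) :
    (stdModel c).IsSymmetricTriple ∧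
      ((stdModel c).IsIndecomposable ↔ c.toClass ∈ indecomposableClasses a) := by
  -- Membership in the admissible classes provides the conditions for some representative c' only.
  -- Everything is done for c' and carried to c along the isomorphism of standard models.
  obtain ⟨ha, c', hcc', hc'⟩ := id hc
  have hiso : (stdModel c').IsIsomorphic (stdModel c) :=
    QuadCocycle.Equiv.isIsomorphic (Quotient.exact hcc'.symm)
  have hsymm : (stdModel c).IsSymmetricTriple :=
    hiso.isSymmetricTriple ((stdModel c').isSymmetricTriple_of_faithful
      (c'.faithfulOnMinus_stdModel hl.1 ha hc'.1 hc'.2.1))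
  refine ⟨hsymm, fun h => ⟨hc, ?_⟩, fun h => ⟨hsymm, ?_⟩⟩
  · rintro ⟨l₁, l₂, a₁, a₂, T₁, T₂, hT, c₁, c₂, d, hd, hα, hγ⟩
    have e : (stdModel c).IsIsomorphic ((stdModel c₁).prod (stdModel c₂)) :=
      MetricLieInv.IsIsomorphic.trans (QuadCocycle.Equiv.isIsomorphic (Quotient.exact hd))
        (hT.isIsomorphic_prod hα hγ)
    -- The restricted cocycles need not be checked for admissibility: their standard models inherit
    -- the symmetric triple property as summands.
    obtain ⟨h₁, h₂⟩ := MetricLieInv.isSymmetricTriple_of_prod (e.isSymmetricTriple hsymm)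
    exact h.2 ⟨stdModel c₁, stdModel c₂, h₁, h₂, hT.1.nontrivial_stdModel c₁,
      hT.2.1.nontrivial_stdModel c₂, e⟩
  · rintro ⟨g₁, g₂, -, -, h₁, h₂, e⟩
    refine h.2 ?_
    rw [← hcc']
    exact c'.isDecomposable_of_isIsomorphic ha hc' h₁ h₂ (hiso.trans e)
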